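/- **Conventions.** Let $\Sigma$ be a finite, non-empty, totally ordered alphabet, and write $[[n]]=\{0,\dots,n-1\}$. *Layers and ODDs.* For $w\ge 1$, a $(\Sigma,w)$-*layer* is a tuple $B=(\ell,r,T,I,F,\iota,\phi)$ with $\ell,r\subseteq[[w]]$, $T\subseteq \ell\times\Sigma\times r$, $I\subseteq \ell$, $F\subseteq r$ and $\iota,\phi\in\{0,1\}$, where $I=\emptyset$ if $\iota=0$ and $F=\emptyset$ if $\phi=0$. The set of these layers is $\mathcal B(\Sigma,w)$; thus $\mathcal B(\Sigma,w)\subseteq\mathcal B(\Sigma,w')$ for $w\le w'$. A $(\Sigma,w)$-*ODD* of length $k\ge1$ is a string $D=B_1\cdots B_k$ over $\mathcal B(\Sigma,w)$ with $\ell(B_{i+1})=r(B_i)$ for $1\le i<k$, with $\iota(B_i)=1$ iff $i=1$, and with $\phi(B_i)=1$ iff $i=k$. It accepts $\sigma_1\cdots\sigma_k\in\Sigma^k$ if there are $p_0\in I(B_1),p_1,\dots,p_{k-1},p_k\in F(B_k)$ with $(p_{i-1},\sigma_i,p_i)\in T(B_i)$ for all $1\le i\le k$. Its language $\mathcal L(D)$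 is the pair consisting of $k$ and the set of accepted strings. *Canonical forms of ODDs.* A layer is *deterministic* if ($\iota=1$ implies $I=\ell$ and $|\ell|=1$) and each $(p,\sigma)\in\ell\times\Sigma$ has at most one $q$ with $(p,\sigma,q)\in T$. It is *complete* if ($\iota=1$ implies $I\neq\emptyset$) and each $(p,\sigma)\in\ell\times\Sigma$ has at least one such $q$. It is *normalized* if it is deterministic, $\ell=[[a]]$ and $r=[[b]]$ for some $a,b\ge1$, each $q\in r$ has an incoming transition, and the order of $r$ agrees with the lexicographic order of the least pairs $(p,\sigma)$ with $(p,\sigma,q)\in T$. An ODD has one of these properties if all its layers do. The *canonical form* $\mathcal C(D)$ of a $(\Sigma,w)$-ODD $D$ is the unique deterministic, complete, normalized $(\Sigma,2^w)$-ODD with language $\mathcal L(D)$ whose number of states $|\ell(B_1)|+\sum_i|r(B_i)|$ is minimum among all deterministic, complete ODDs (of any width) with that language. *Automata.* A *finite automaton* over an alphabet has a finite state set, sets of initial and of final states, and a set of labelled transitions. It is *deterministic* (*complete*) if it has exactly (at least) one initial state and at most (at least) one transition from each state for each letter of the alphabet. Layers are ordered totally, by the shortlex order of their bit-table descriptions,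 so that layers with smaller state numbers come first. An automaton over $\mathcal B(\Sigma,w)$ is *normalized* if its state set is $[[n]]$ for some $n\ge1$, every state is reachable from an initial state, and the states are numbered in the shortlex order (by length, then lexicographically) of the first strings that reach them from an initial state. A $(\Sigma,w)$-*SOFA* (second-order finite automaton) is a finite automaton $\mathcal F$ over $\mathcal B(\Sigma,w)$ whose language $\mathcal L(\mathcal F)$ consists of $(\Sigma,w)$-ODDs; its *second language* is $\mathcal L_2(\mathcal F)=\{\mathcal L(D): D\in\mathcal L(\mathcal F)\}$. Let $n(\mathcal F)$ be its number of states. **Theorem.** There is an algorithm that maps each $(\Sigma,w)$-SOFA $\mathcal F$ (with $\Sigma$, $w\ge1$, $\mathcal F$ as input) to a deterministic, complete, normalized $(\Sigma,2^w)$-SOFA $\mathcal C_2(\mathcal F)$ in time $$2^{\max(1,\,n(\mathcal F))\cdot 2^{O(|\Sigma|\cdot w\cdot 2^w)}}$$ such that: 1. every $D\in\mathcal L(\mathcal F)$ has a unique canonical form $\mathcal C(D)$, and $\mathcal L(\mathcal C_2(\mathcal F))=\{\mathcal C(D): D\in\mathcal L(\mathcal F)\}$; 2. $\mathcal L_2(\mathcal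 C_2(\mathcal F))=\mathcal L_2(\mathcal F)$; 3. for each $w'\ge1$ and each $(\Sigma,w')$-SOFA $\mathcal F'$ with $\mathcal L_2(\mathcal F')=\mathcal L_2(\mathcal F)$, the automata $\mathcal C_2(\mathcal F')$ and $\mathcal C_2(\mathcal F)$ are identical if $w'=w$; for $w'\ne w$ they have identical states, initial states and final states, and identical transitions on all letters of their common alphabet $\mathcal B(\Sigma,2^{\min(w,w')})$. -/

import Mathlib

namespace SecondOrder

/-! ### Layers -/

/-- A layer over the alphabet `α`; its states are natural numbers. Layers carry no width:
the `(α, w)`-layers are the layers all of whose states are `< w`, see `layerAlphabet`. -/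
@[ext]
structure Layer (α : Type*) where
  left : Finset ℕ
  right : Finset ℕ
  trans : Finset (ℕ × α × ℕ)
  init : Finset ℕ
  final : Finset ℕ
  initFlag : Bool
  finalFlag : Bool
  trans_mem : ∀ p a q, (p, a, q) ∈ trans → p ∈ left ∧ q ∈ right
  init_subset : init ⊆ left
  final_subset : final ⊆ right
  init_eq_empty : initFlag = false → init = ∅
  final_eq_empty : finalFlag = false → final = ∅

/-- The set of all `(α, w)`-layers. -/
def layerAlphabet (α : Type*) (w : ℕ) : Set (Layer α) :=
  {B | B.left ⊆ Finset.range w ∧ B.right ⊆ Finset.range w}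

namespace Layer

variable {α : Type*}

def IsDeterministic (B : Layer α) : Prop :=
  (B.initFlag = true → B.init = B.left ∧ B.left.card = 1) ∧
  ∀ p ∈ B.left, ∀ (a : α) (q q' : ℕ), (p, a, q) ∈ B.trans → (p, a, q') ∈ B.trans → q = q'

def IsComplete (B : Layer α) : Prop :=
  (B.initFlag = true → B.init.Nonempty) ∧
  ∀ p ∈ B.left, ∀ a : α, ∃ q ∈ B.right, (p, a, q) ∈ B.trans

def IsReachable (B : Layer α) : Prop :=
  ∀ q ∈ B.right, ∃ p ∈ B.left, ∃ a : α, (p, a, q) ∈ B.trans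

variable [LinearOrder α]

/-- `x = (p, a)` is the lexicographically least pair with a transition `(p, a, q)`. -/
def IsLeastPred (B : Layer α) (q : ℕ) (x : ℕ × α) : Prop :=
  (x.1, x.2, q) ∈ B.trans ∧ ∀ p a, (p, a, q) ∈ B.trans → toLex x ≤ toLex (p, a)

def IsWellOrdered (B : Layer α) : Prop :=
  B.IsReachable ∧ B.IsDeterministic ∧
  ∀ q ∈ B.right, ∀ q' ∈ B.right, ∀ x x', B.IsLeastPred q x → B.IsLeastPred q' x' →
    (q < q' ↔ toLex x < toLex x')

def IsContiguous (w : ℕ) (B : Layer α) : Prop :=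
  ∃ w₁ ∈ Finset.Icc 1 w, ∃ w₂ ∈ Finset.Icc 1 w,
    B.left = Finset.range w₁ ∧ B.right = Finset.range w₂

def IsNormalized (w : ℕ) (B : Layer α) : Prop :=
  B.IsWellOrdered ∧ B.IsContiguous w

variable [Fintype α]

/-- The description of a layer with states `< w` by the concatenated bit tables of its left
states, right states, transitions, initial states, final states and flags. -/
def bits (w : ℕ) (B : Layer α) : List Bool :=
  (List.range w).map (fun p => decide (p ∈ B.left)) ++
  (List.range w).map (fun q => decide (q ∈ B.right)) ++
  (List.range w).flatMap (fun p => (Finset.univ : Finset α).sort.flatMap (fun a =>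
    (List.range w).map (fun q => decide ((p, a, q) ∈ B.trans)))) ++
  (List.range w).map (fun p => decide (p ∈ B.init)) ++
  (List.range w).map (fun q => decide (q ∈ B.final)) ++
  [B.initFlag, B.finalFlag]

/-- The least `w` such that all states of the layer are `< w`. -/
def width (B : Layer α) : ℕ := (B.left ∪ B.right).sup Nat.succ

/-- The fixed total order on layers: the shortlex order of the bit descriptions at the layers'
own widths. In particular layers of smaller width come first. -/
def Lt (B B' : Layer α) : Prop :=
  List.Shortlex (· < ·) (B.bits B.width) (B'.bits B'.width)

end Layer

/-! ### Ordered decision diagrams -/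

section ODD

variable {α : Type*}

/-- `D` is an `(α, w)`-ODD (of length `D.length`). -/
def IsODD (w : ℕ) (D : List (Layer α)) : Prop :=
  D ≠ [] ∧ (∀ B ∈ D, B ∈ layerAlphabet α w) ∧
  (∀ (i : ℕ) (h : i + 1 < D.length), D[i + 1].left = D[i].right) ∧
  (∀ (i : ℕ) (h : i < D.length), D[i].initFlag = true ↔ i = 0) ∧
  (∀ (i : ℕ) (h : i < D.length), D[i].finalFlag = true ↔ i + 1 = D.length)

/-- Acceptance of a string of the length of `D`; the accepting sequence is
`(p 0, s₁, p 1), (p 1, s₂, p 2), …`. -/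
def ODDAccepts (D : List (Layer α)) (s : List α) : Prop :=
  ∃ p : ℕ → ℕ,
    (∃ B ∈ D.head?, p 0 ∈ B.init) ∧
    (∃ B ∈ D.getLast?, p D.length ∈ B.final) ∧
    ∀ (i : ℕ) (hD : i < D.length) (hs : i < s.length), (p i, s[i], p (i + 1)) ∈ D[i].trans

/-- The length-typed language of an ODD. -/
def oddLang (D : List (Layer α)) : ℕ × Set (List α) :=
  (D.length, {s | s.length = D.length ∧ ODDAccepts D s})

/-- The number of states of an ODD. -/
def oddNumStates (D : List (Layer α)) : ℕ :=
  ((D.head?.map fun B => B.left.card).getD 0) + (D.map fun B => B.right.card).sum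

/-- `D` is a deterministic, complete `(α, w)`-ODD. -/
def IsDetCompleteODD (w : ℕ) (D : List (Layer α)) : Prop :=
  IsODD w D ∧ (∀ B ∈ D, B.IsDeterministic) ∧ (∀ B ∈ D, B.IsComplete)

/-- No deterministic, complete ODD of any width with the same language has fewer states. -/
def IsMinimizedODD (D : List (Layer α)) : Prop :=
  ∀ w' : ℕ, 0 < w' → ∀ D' : List (Layer α), IsDetCompleteODD w' D' →
    oddLang D = oddLang D' → oddNumStates D ≤ oddNumStates D'

/-- `C` is the canonical form of the `(α, w)`-ODD `D`: a minimized, normalized, deterministic,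
complete `(α, 2 ^ w)`-ODD with the language of `D`. -/
def IsCanonicalForm [LinearOrder α] (w : ℕ) (D C : List (Layer α)) : Prop :=
  IsDetCompleteODD (2 ^ w) C ∧ IsMinimizedODD C ∧ (∀ B ∈ C, B.IsNormalized (2 ^ w)) ∧
  oddLang C = oddLang D

end ODD

/-! ### Finite automata -/

/-- Finite automata with labels in `L`. The alphabet is a subset of `L` and is specified
separately, see `FA.IsOver`. -/
@[ext]
structure FA (L : Type*) where
  states : Finset ℕ
  init : Finset ℕ
  final : Finset ℕ
  trans : Finset (ℕ × L × ℕ)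
  init_subset : init ⊆ states
  final_subset : final ⊆ states
  trans_mem : ∀ q a q', (q, a, q') ∈ trans → q ∈ states ∧ q' ∈ states

namespace FA

variable {L : Type*}

/-- `F` is an automaton over the alphabet `S`. -/
def IsOver (S : Set L) (F : FA L) : Prop :=
  ∀ q a q', (q, a, q') ∈ F.trans → a ∈ S

/-- `F.Reaches s q q'`: the string `s` reaches `q'` from `q`. -/
def Reaches (F : FA L) : List L → ℕ → ℕ → Prop
  | [], q, q' => q = q'
  | a :: s, q, q' => ∃ r, (q, a, r) ∈ F.trans ∧ Reaches F s r q'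

/-- The (first) language of an automaton. -/
def lang (F : FA L) : Set (List L) :=
  {s | ∃ q ∈ F.init, ∃ q' ∈ F.final, F.Reaches s q q'}

def IsDeterministic (F : FA L) : Prop :=
  F.init.card = 1 ∧ ∀ q a r r', (q, a, r) ∈ F.trans → (q, a, r') ∈ F.trans → r = r'

/-- Completeness as an automaton over the alphabet `S`. -/
def IsComplete (S : Set L) (F : FA L) : Prop :=
  F.init.Nonempty ∧ ∀ q ∈ F.states, ∀ a ∈ S, ∃ r ∈ F.states, (q, a, r) ∈ F.trans

/-- The string `s` reaches `q` from some initial state. -/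
def ReachesFromInit (F : FA L) (s : List L) (q : ℕ) : Prop :=
  ∃ q₀ ∈ F.init, F.Reaches s q₀ q

/-- `s` is the first string, in the shortlex order induced by the order `lt` of the letters,
that reaches `q` from some initial state. -/
def IsLexFirst (lt : L → L → Prop) (F : FA L) (q : ℕ) (s : List L) : Prop :=
  F.ReachesFromInit s q ∧ ∀ s', F.ReachesFromInit s' q → ¬ List.Shortlex lt s' s

def IsNormalized (lt : L → L → Prop) (F : FA L) : Prop :=
  (∃ n : ℕ, 0 < n ∧ F.states = Finset.range n) ∧
  (∀ q ∈ F.states, ∃ s, F.ReachesFromInit s q) ∧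
  ∀ q ∈ F.states, ∀ q' ∈ F.states, ∀ s s', IsLexFirst lt F q s → IsLexFirst lt F q' s' →
    (q < q' ↔ List.Shortlex lt s s')

open Classical in
/-- The automaton obtained by deleting all transitions whose label is not in `S`. -/
noncomputable def restrict (S : Set L) (F : FA L) : FA L where
  states := F.states
  init := F.init
  final := F.final
  trans := F.trans.filter fun t => t.2.1 ∈ S
  init_subset := F.init_subset
  final_subset := F.final_subset
  trans_mem := fun q a q' h => F.trans_mem q a q' (Finset.mem_filter.mp h).1

variable {α : Type*}

/-- `F` is an `(α, w)`-second-order finite automaton. -/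
def IsSOFA (w : ℕ) (F : FA (Layer α)) : Prop :=
  F.IsOver (layerAlphabet α w) ∧ ∀ D ∈ F.lang, IsODD w D

/-- The second language of a second-order finite automaton. -/
def secondLang (F : FA (Layer α)) : Set (ℕ × Set (List α)) :=
  oddLang '' F.lang

end FA

/-! ### The model of computation

A WHILE language on binary trees. Every variable holds a tree; evaluating an expression costs one
step per syntactic operation in it, and every assignment and every test costs one further step.
Up to a polynomial this is the running time of a Turing machine. -/

/-- Binary trees. -/
inductive Dat where
  | nil : Dat
  | cons : Dat → Dat → Dat

namespace Dat

def hd : Dat → Dat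
  | nil => nil
  | cons a _ => a

def tl : Dat → Dat
  | nil => nil
  | cons _ b => b

/-- Lists as trees. -/
def list : List Dat → Dat
  | [] => nil
  | a :: l => cons a (list l)

/-- Natural numbers in unary. -/
def num (n : ℕ) : Dat := list (List.replicate n nil)

def bool (b : Bool) : Dat := if b then cons nil nil else nil

def boolList (l : List Bool) : Dat := list (l.map bool)

end Dat

/-- Expressions; `var i` is the `i`-th variable. -/
inductive Expr where
  | var : ℕ → Expr
  | nil : Expr
  | cons : Expr → Expr → Expr
  | hd : Expr → Expr
  | tl : Expr → Expr

namespace Expr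

def eval (σ : ℕ → Dat) : Expr → Dat
  | var i => σ i
  | nil => Dat.nil
  | cons e f => Dat.cons (eval σ e) (eval σ f)
  | hd e => (eval σ e).hd
  | tl e => (eval σ e).tl

def cost : Expr → ℕ
  | var _ => 1
  | nil => 1
  | cons e f => cost e + cost f + 1
  | hd e => cost e + 1
  | tl e => cost e + 1

end Expr

/-- Commands; `loop e c` is "while `e` do `c`". A test succeeds when the expression does not evaluate to `nil`. -/
inductive Cmd where
  | assign : ℕ → Expr → Cmd
  | seq : Cmd → Cmd → Cmd
  | ite : Expr → Cmd → Cmd → Cmd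
  | loop : Expr → Cmd → Cmd

/-- `Exec c σ σ' t`: started in the store `σ`, the command `c` halts in the store `σ'` after
exactly `t` steps. -/
inductive Exec : Cmd → (ℕ → Dat) → (ℕ → Dat) → ℕ → Prop
  | assign (i : ℕ) (e : Expr) (σ : ℕ → Dat) :
      Exec (Cmd.assign i e) σ (Function.update σ i (e.eval σ)) (e.cost + 1)
  | seq {c d : Cmd} {σ σ' σ'' : ℕ → Dat} {t t' : ℕ} :
      Exec c σ σ' t → Exec d σ' σ'' t' → Exec (Cmd.seq c d) σ σ'' (t + t')
  | ite_true {e : Expr} {c d : Cmd} {σ σ' : ℕ → Dat} {t : ℕ} :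
      e.eval σ ≠ Dat.nil → Exec c σ σ' t → Exec (Cmd.ite e c d) σ σ' (e.cost + 1 + t)
  | ite_false {e : Expr} {c d : Cmd} {σ σ' : ℕ → Dat} {t : ℕ} :
      e.eval σ = Dat.nil → Exec d σ σ' t → Exec (Cmd.ite e c d) σ σ' (e.cost + 1 + t)
  | loop_true {e : Expr} {c : Cmd} {σ σ' σ'' : ℕ → Dat} {t t' : ℕ} :
      e.eval σ ≠ Dat.nil → Exec c σ σ' t → Exec (Cmd.loop e c) σ' σ'' t' →
      Exec (Cmd.loop e c) σ σ'' (e.cost + 1 + t + t')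
  | loop_false {e : Expr} {c : Cmd} {σ : ℕ → Dat} :
      e.eval σ = Dat.nil → Exec (Cmd.loop e c) σ σ (e.cost + 1)

/-- On input `x` the program `c` halts with output `y` after exactly `t` steps. Input and output
are held by variable `0`; all other variables are initially `nil`. -/
def Computes (c : Cmd) (x y : Dat) (t : ℕ) : Prop :=
  ∃ σ, Exec c (Function.update (fun _ => Dat.nil) 0 x) σ t ∧ σ 0 = y

/-- The tree `d` is a description of the automaton `F` over the alphabet of `(α, w)`-layers: the
numbers `|α|`, `w`, `|Q|`, the bit tables of the initial and the final states, and a listing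
without repetition, in any order, of the transitions. A state is written as its position in the
increasing enumeration of the state set `Q`, so a state of `Q = {0, …, n - 1}` is written as
itself. -/
def FA.Encodes {α : Type*} [LinearOrder α] [Fintype α] (w : ℕ) (F : FA (Layer α))
    (d : Dat) : Prop :=
  ∃ l : List (ℕ × Layer α × ℕ), l.Nodup ∧ (∀ t, t ∈ l ↔ t ∈ F.trans) ∧
    d = Dat.list [
      Dat.num (Fintype.card α),
      Dat.num w,
      Dat.num F.states.card,
      Dat.boolList (F.states.sort.map fun q => decide (q ∈ F.init)),
      Dat.boolList (F.states.sort.map fun q => decide (q ∈ F.final)),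
      Dat.list (l.map fun t => Dat.list [
        Dat.num (F.states.filter (· < t.1)).card,
        Dat.boolList (t.2.1.bits w),
        Dat.num (F.states.filter (· < t.2.2)).card])]

end SecondOrder

/-! The proof has three ingredients: a local characterization of canonical forms, a nondeterministic
automaton that checks it, and a normalized minimal automaton whose numbering does not see the
alphabet.

Canonical forms. After a prefix has been read, what a diagram of width `w` still accepts is the
residual of a set of states, that is, of a subset of `{0, …, w - 1}`. Merging sets with equal
residuals leaves at most `2 ^ w` states on each level, and numbering them by first occurrence
normalizes the layers (`exists_canonical`). A reachable diagram whose states on each level have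
distinct residuals injects, level by level, into every deterministic complete diagram with the same
language, so it is minimal; equality of the numbers of states forces distinct residuals in the other
diagram too (`rightSum_le`). Hence canonical forms are exactly the normalized diagrams with
separated residuals (`isCanonicalForm_iff`), and such a diagram is determined by its language,
whatever the width (`canonical_unique`).

Recognition. To check that `C` is the canonical form of some `D` accepted by `F`, guess `D` while
reading `C` and remember the pairs (set of states of `D`, state of `C`) that are reached by a common
string. Separation of residuals reduces to a condition on single layers, and a set can be paired
with only one state, so the remembered relation is a partial function from subsets of `{0, …, w -
1}` to `{0, …, 2 ^ w - 1}`. This gives a finite automaton with `n * ((2 ^ w + 1) ^ 2 ^ w * 2)`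
states for the set of canonical forms (`sim_iff`, `nAcc_iff`).

Minimization. The second canonical form is the Nerode automaton of the set of canonical forms, its
states numbered by the shortlex least words of the classes. These words are taken over all layers of
all widths, yet they use only letters of the alphabet: a word with a foreign letter has no canonical
extension, and neither has the smaller word consisting of the empty layer (`minRep_over`). The
automaton therefore depends only on the set of canonical forms and, as a filter on transitions, on
the alphabet. Since equal second languages give equal sets of canonical forms (`canonLang_eq`), the
third claim follows (`minFA_restrict`).

Running time. All objects are found by enumeration, cut off at a number `fuel` which exceeds the
number of pair relations, the number of sets of states of the nondeterministic automaton, and the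
number of bit strings that describe layers. Each stage is polynomial in the fuel and the input size,
and the input size is itself polynomial in the fuel. Polynomial time is handled by closure lemmas
for `PT`, most of which are applied by `fun_prop`; `mainOut_encodes` proves the output correct and
`ptw_fullOut` bounds the time. -/

namespace SecondOrder

/-! ### Polynomial-time functions on encoded data -/

/-- The size of a tree. -/
def Dat.sz : Dat → ℕ
  | .nil => 1
  | .cons a b => Dat.sz a + Dat.sz b + 1

/-- Types whose elements are represented by trees. -/
class Enc (β : Type) where
  enc : β → Dat

open Enc

instance : Enc Unit := ⟨fun _ => .nil⟩
instance : Enc Bool := ⟨Dat.bool⟩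
instance : Enc ℕ := ⟨Dat.num⟩
open Classical in
noncomputable instance : Enc Prop := ⟨fun p => Dat.bool (decide p)⟩
instance {β : Type} [Enc β] : Enc (List β) := ⟨fun l => Dat.list (l.map enc)⟩
instance {β γ : Type} [Enc β] [Enc γ] : Enc (β × γ) := ⟨fun p => .cons (enc p.1) (enc p.2)⟩

/-- The size of the representation. -/
def size {β : Type} [Enc β] (b : β) : ℕ := (enc b).sz

section basic

variable {β γ δ ε : Type} [Enc β] [Enc γ] [Enc δ] [Enc ε]

@[simp] theorem enc_nil : enc ([] : List β) = .nil := rfl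
@[simp] theorem enc_cons (b : β) (l : List β) : enc (b :: l) = .cons (enc b) (enc l) := rfl
@[simp] theorem enc_pair (b : β) (c : γ) : enc (b, c) = .cons (enc b) (enc c) := rfl
-- Unary numbers are lists of units, so that arithmetic inherits its programs from list operations.
theorem enc_nat (n : ℕ) : enc n = enc (List.replicate n ()) := by
  show Dat.num n = Dat.list _
  simp [Dat.num, enc]

@[simp] theorem size_nil : size ([] : List β) = 1 := rfl
@[simp] theorem size_cons (b : β) (l : List β) : size (b :: l) = size b + size l + 1 := rfl
@[simp] theorem size_pair (b : β) (c : γ) : size (b, c) = size b + size c + 1 := rfl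
@[simp] theorem size_unit (u : Unit) : size u = 1 := rfl

theorem sz_pos (d : Dat) : 1 ≤ d.sz := by cases d <;> simp [Dat.sz]
theorem size_pos (b : β) : 1 ≤ size b := sz_pos _

theorem size_nat (n : ℕ) : size n = 2 * n + 1 := by
  have : size n = size (List.replicate n ()) := by simp [size, enc_nat]
  rw [this]
  induction n with
  | zero => rfl
  | succ k ih => rw [List.replicate_succ, size_cons, ih (by simp [size, enc_nat])]; simp; ring

theorem size_bool (b : Bool) : size b ≤ 3 := by cases b <;> simp [size, enc, Dat.bool, Dat.sz]
theorem size_prop (p : Prop) : size p ≤ 3 := by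
  classical
  show size (decide p) ≤ 3
  exact size_bool _

theorem length_le_size (l : List β) : l.length ≤ size l := by
  induction l with
  | nil => simp
  | cons a l ih => simp; omega

theorem size_append (l l' : List β) : size (l ++ l') + 1 = size l + size l' := by
  induction l with
  | nil => simp; omega
  | cons a l ih => simp; omega

theorem size_le_of_sublist {l l' : List β} (h : l.Sublist l') : size l ≤ size l' := by
  induction h with
  | slnil => exact le_rfl
  | cons a h ih => simp; omega
  | cons_cons a h ih => simp; omega

theorem size_le_of_mem {l : List β} {b : β} (h : b ∈ l) : size b ≤ size l := by
  induction l with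
  | nil => simp at h
  | cons a l ih =>
    rcases List.mem_cons.1 h with rfl | h
    · simp; omega
    · have := ih h; simp; omega

theorem size_reverse (l : List β) : size l.reverse = size l := by
  induction l with
  | nil => rfl
  | cons a l ih => have := size_append l.reverse [a]; simp at *; omega

theorem size_le_of_forall {l : List β} {m : ℕ} (h : ∀ b ∈ l, size b ≤ m) :
    size l ≤ l.length * (m + 1) + 1 := by
  induction l with
  | nil => simp
  | cons a l ih =>
    have := ih fun b hb => h b (by simp [hb])
    have := h a (by simp)
    simp [add_mul] at *; omega

end basic

/-! ### Polynomial bounds -/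

/-- `u` is bounded by a polynomial in `v`. -/
def PB {ι : Type} (v u : ι → ℕ) : Prop := ∃ k, ∀ i, u i ≤ (v i + 2) ^ k

namespace PB

variable {ι : Type} {v u u' : ι → ℕ}

/-- The base `v i + 2` is at least 2, so constants, sums and products can all be absorbed by the
exponent. -/
theorem const (n : ℕ) : PB v fun _ => n :=
  ⟨n, fun i => Nat.lt_two_pow_self.le.trans (Nat.pow_le_pow_left (by omega) _)⟩

theorem self : PB v v := ⟨1, fun i => by rw [pow_one]; omega⟩

theorem mono (h : PB v u) (h' : ∀ i, u' i ≤ u i) : PB v u' := by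
  obtain ⟨k, hk⟩ := h
  exact ⟨k, fun i => (h' i).trans (hk i)⟩

theorem mul (h : PB v u) (h' : PB v u') : PB v fun i => u i * u' i := by
  obtain ⟨k, hk⟩ := h
  obtain ⟨j, hj⟩ := h'
  exact ⟨k + j, fun i => by rw [pow_add]; exact Nat.mul_le_mul (hk i) (hj i)⟩

theorem add (h : PB v u) (h' : PB v u') : PB v fun i => u i + u' i := by
  obtain ⟨k, hk⟩ := h
  obtain ⟨j, hj⟩ := h'
  refine ⟨k + j + 1, fun i => ?_⟩
  have h1 : (v i + 2) ^ k ≤ (v i + 2) ^ (k + j) := Nat.pow_le_pow_right (by omega) (by omega)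
  have h2 : (v i + 2) ^ j ≤ (v i + 2) ^ (k + j) := Nat.pow_le_pow_right (by omega) (by omega)
  have := hk i
  have := hj i
  have h3 : (v i + 2) ^ (k + j) * 2 ≤ (v i + 2) ^ (k + j) * (v i + 2) :=
    Nat.mul_le_mul_left _ (by omega)
  show u i + u' i ≤ _
  rw [pow_succ]
  omega

theorem pow (h : PB v u) (n : ℕ) : PB v fun i => u i ^ n := by
  obtain ⟨k, hk⟩ := h
  exact ⟨k * n, fun i => by rw [pow_mul]; exact Nat.pow_le_pow_left (hk i) n⟩

theorem trans (h : PB v u) (h' : PB u u') : PB v u' := by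
  obtain ⟨k, hk⟩ := h'
  exact ((h.add (const 2)).pow k).mono hk

theorem comp {κ : Type} (g : κ → ι) (h : PB v u) : PB (v ∘ g) (u ∘ g) := by
  obtain ⟨k, hk⟩ := h
  exact ⟨k, fun i => hk _⟩

end PB

/-! ### Programs -/

section PTW

variable {β γ δ ε : Type} [Enc β] [Enc γ] [Enc δ] [Enc ε]

/-- The command family `c` computes `f` in time `T` in place, at any variable `b`, using only
variables from `b` on. -/
def Runs (c : ℕ → Cmd) (f : β → γ) (T : β → ℕ) : Prop :=
  ∀ (b : ℕ) (σ : ℕ → Dat) (x : β), σ b = enc x → ∃ σ' t, Exec (c b) σ σ' t ∧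
    σ' b = enc (f x) ∧ (∀ i < b, σ' i = σ i) ∧ t ≤ T x

/-- `f` is computable in time polynomial in `v`, with values of size polynomial in `v`. -/
def PTW (v : β → ℕ) (f : β → γ) : Prop :=
  ∃ c T, Runs c f T ∧ PB v T ∧ PB v fun x => size (f x)

/-- `f` is computable in polynomial time. -/
@[fun_prop]
def PT (f : β → γ) : Prop := PTW size f

/-- Programs see only trees: one program serves all functions with the same encoded values, even if
their types differ. -/
theorem PTW.of_enc_eq {v : β → ℕ} {f : β → γ} {g : β → δ} (h : PTW v f)
    (hfg : ∀ x, enc (g x) = enc (f x)) : PTW v g := by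
  obtain ⟨c, T, hc, hT, hs⟩ := h
  refine ⟨c, T, fun b σ x hx => ?_, hT, hs.mono fun x => ?_⟩
  · rw [hfg]; exact hc b σ x hx
  · simp [size, hfg]

theorem PT.of_enc_eq {f : β → γ} {g : β → δ} (h : PT f)
    (hfg : ∀ x, enc (g x) = enc (f x)) : PT g := PTW.of_enc_eq h hfg

/-- The outer function is polynomial in the size of its argument, and that size is polynomial in
`v`. This allows polynomial-time functions to be applied to data that are exponentially larger than
the input. -/
theorem PTW.comp {v : β → ℕ} {f : γ → δ} {g : β → γ} (hf : PT f) (hg : PTW v g) :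
    PTW v fun x => f (g x) := by
  obtain ⟨c, T, hc, hT, hs⟩ := hf
  obtain ⟨c', T', hc', hT', hs'⟩ := hg
  refine ⟨fun b => .seq (c' b) (c b), fun x => T' x + T (g x), fun b σ x hx => ?_,
    hT'.add (hs'.trans (hT.comp g)), hs'.trans (hs.comp g)⟩
  obtain ⟨σ₁, t₁, e₁, h₁, i₁, l₁⟩ := hc' b σ x hx
  obtain ⟨σ₂, t₂, e₂, h₂, i₂, l₂⟩ := hc b σ₁ _ h₁
  exact ⟨σ₂, t₁ + t₂, .seq e₁ e₂, h₂, fun i hi => (i₂ i hi).trans (i₁ i hi), by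
    show _ ≤ _ + _; omega⟩

@[fun_prop]
theorem PT.comp {f : γ → δ} {g : β → γ} (hf : PT f) (hg : PT g) :
    PT fun x => f (g x) := PTW.comp hf hg

/-- Functions given by an expression. -/
theorem PT.of_expr {f : β → γ} (e : ℕ → Expr) (n : ℕ)
    (he : ∀ b σ x, σ b = enc x → (e b).eval σ = enc (f x))
    (hc : ∀ b, (e b).cost ≤ n) (hs : PB size fun x => size (f x)) : PT f :=
  ⟨fun b => .assign b (e b), fun _ => n + 1, fun b σ x hx =>
    ⟨_, _, .assign b (e b) σ, by simp [he b σ x hx], fun i hi => by simp [hi.ne], by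
      have := hc b; show _ ≤ n + 1; omega⟩, PB.const _, hs⟩

@[fun_prop]
theorem PT.id' : PT (fun x : β => x) :=
  .of_expr (fun b => .var b) 1 (fun _ _ _ h => h) (fun _ => le_rfl) PB.self

/-- The constant expression for a tree. -/
def Dat.expr : Dat → Expr
  | .nil => .nil
  | .cons a b => .cons a.expr b.expr

theorem Dat.eval_expr (σ : ℕ → Dat) (d : Dat) : d.expr.eval σ = d := by
  induction d with
  | nil => rfl
  | cons a b ha hb => simp [Dat.expr, Expr.eval, ha, hb]

@[fun_prop]
theorem PT.const (c : γ) : PT (fun _ : β => c) :=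
  .of_expr (fun _ => (enc c).expr) (enc c).expr.cost (fun _ _ _ _ => Dat.eval_expr _ _)
    (fun _ => le_rfl) (PB.const _)

theorem PT.fst' : PT (fun x : β × γ => x.1) :=
  .of_expr (fun b => .hd (.var b)) 2
    (fun b σ x h => by show (σ b).hd = _; rw [h]; rfl) (fun _ => le_rfl)
    (PB.self.mono fun x => by
      obtain ⟨x, y⟩ := x
      simp; omega)

theorem PT.snd' : PT (fun x : β × γ => x.2) :=
  .of_expr (fun b => .tl (.var b)) 2
    (fun b σ x h => by show (σ b).tl = _; rw [h]; rfl) (fun _ => le_rfl)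
    (PB.self.mono fun x => by
      obtain ⟨x, y⟩ := x
      simp; omega)

@[fun_prop]
theorem PT.fst {f : δ → β × γ} (h : PT f) : PT (fun x => (f x).1) := PT.fst'.comp h
@[fun_prop]
theorem PT.snd {f : δ → β × γ} (h : PT f) : PT (fun x => (f x).2) := PT.snd'.comp h

theorem PTW.pair {v : β → ℕ} {f : β → γ} {g : β → δ} (hf : PTW v f) (hg : PTW v g) :
    PTW v fun x => (f x, g x) := by
  obtain ⟨c, T, hc, hT, hs⟩ := hf
  obtain ⟨c', T', hc', hT', hs'⟩ := hg
  -- A program run at a base leaves all variables below that base unchanged: the input in `b`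
  -- survives the first call, and the first result in `b + 1` survives the second.
  refine ⟨fun b => .seq (.assign (b + 1) (.var b)) (.seq (c (b + 1))
      (.seq (.assign (b + 2) (.var b)) (.seq (c' (b + 2))
      (.assign b (.cons (.var (b + 1)) (.var (b + 2))))))),
    fun x => T x + T' x + 8, fun b σ x hx => ?_, (hT.add hT').add (PB.const _),
    ((hs.add hs').add (PB.const 1)).mono fun x => by simp⟩
  obtain ⟨σ₁, t₁, e₁, h₁, i₁, l₁⟩ := hc (b + 1)
    (Function.update σ (b + 1) ((Expr.var b).eval σ)) x (by simp [Expr.eval, hx])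
  obtain ⟨σ₂, t₂, e₂, h₂, i₂, l₂⟩ := hc' (b + 2)
    (Function.update σ₁ (b + 2) ((Expr.var b).eval σ₁)) x
    (by simp [Expr.eval, i₁ b (by omega), hx])
  refine ⟨_, _, .seq (.assign _ _ _) (.seq e₁ (.seq (.assign _ _ _)
    (.seq e₂ (.assign _ _ _)))), ?_, fun i hi => ?_, ?_⟩
  · simp [Expr.eval, h₂, i₂ (b + 1) (by omega), h₁]
  · rw [Function.update_of_ne (by omega), i₂ i (by omega), Function.update_of_ne (by omega),
      i₁ i (by omega), Function.update_of_ne (by omega)]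
  · simp only [Expr.cost]; omega

@[fun_prop]
theorem PT.pair {f : β → γ} {g : β → δ} (hf : PT f) (hg : PT g) :
    PT fun x => (f x, g x) := PTW.pair hf hg

theorem PTW.size_le {v : β → ℕ} {f : β → γ} (h : PTW v f) : PB v fun x => size (f x) := by
  obtain ⟨_, _, _, _, h⟩ := h; exact h

theorem PT.size_le {f : β → γ} (h : PT f) : PB size fun x => size (f x) := PTW.size_le h

/-- The loop of `PTW.foldl`. -/
def foldCmd (c : ℕ → Cmd) (b : ℕ) : Cmd :=
  .loop (.var (b + 1)) (.seq (.assign (b + 3) (.cons (.var b) (.cons (.var (b + 2))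
    (.hd (.var (b + 1)))))) (.seq (c (b + 3)) (.seq (.assign (b + 2) (.var (b + 3)))
    (.assign (b + 1) (.tl (.var (b + 1)))))))

/-- Variable `b` holds the parameter, `b + 1` the rest of the list, `b + 2` the accumulator, and `b
+ 3` is the workspace of the step program. The bound `M` is needed only at accumulators that occur
in the fold; `14` is the cost of one test and three assignments. -/
theorem exec_foldCmd {g : β → δ → γ → δ} {c : ℕ → Cmd} {T : β × δ × γ → ℕ}
    (hc : Runs c (fun p : β × δ × γ => g p.1 p.2.1 p.2.2) T) (b M : ℕ) (x : β)
    (l : List γ) : ∀ (acc : δ) (σ : ℕ → Dat), σ b = enc x → σ (b + 1) = enc l →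
      σ (b + 2) = enc acc →
      (∀ l₁ y l₂, l = l₁ ++ y :: l₂ → T (x, l₁.foldl (g x) acc, y) ≤ M) →
      ∃ σ' t, Exec (foldCmd c b) σ σ' t ∧ σ' (b + 2) = enc (l.foldl (g x) acc) ∧
        (∀ i < b, σ' i = σ i) ∧ t ≤ l.length * (M + 14) + 2 := by
  induction l with
  | nil =>
    intro acc σ _ h1 h2 _
    exact ⟨σ, _, .loop_false (by simp [Expr.eval, h1]), h2, fun _ _ => rfl, by simp [Expr.cost]⟩
  | cons y l ih =>
    intro acc σ h0 h1 h2 hM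
    obtain ⟨σ₁, t₁, e₁, k₁, i₁, l₁⟩ := hc (b + 3) (Function.update σ (b + 3)
      ((Expr.cons (.var b) (.cons (.var (b + 2)) (.hd (.var (b + 1))))).eval σ)) (x, acc, y)
      (by simp [Expr.eval, h0, h1, h2, Dat.hd])
    obtain ⟨σ₂, t₂, e₂, k₂, i₂, l₂⟩ := ih (g x acc y) (Function.update
        (Function.update σ₁ (b + 2) ((Expr.var (b + 3)).eval σ₁)) (b + 1)
        ((Expr.tl (.var (b + 1))).eval
          (Function.update σ₁ (b + 2) ((Expr.var (b + 3)).eval σ₁))))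
      (by
        rw [Function.update_of_ne (by omega), Function.update_of_ne (by omega), i₁ _ (by omega),
          Function.update_of_ne (by omega), h0])
      (by simp [Expr.eval, i₁ (b + 1) (by omega), h1, Dat.tl])
      (by simp [Expr.eval, k₁])
      (fun l₁ z l₂ h => by simpa using hM (y :: l₁) z l₂ (by simp [h]))
    refine ⟨σ₂, _, .loop_true (by simp [Expr.eval, h1]) (.seq (.assign _ _ _) (.seq e₁
      (.seq (.assign _ _ _) (.assign _ _ _)))) e₂, by simpa using k₂, fun i hi => ?_, ?_⟩
    · rw [i₂ i hi, Function.update_of_ne (by omega), Function.update_of_ne (by omega),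
        i₁ i (by omega), Function.update_of_ne (by omega)]
    · have := hM [] y l rfl
      simp only [Expr.cost, List.length_cons, List.foldl_nil, add_mul] at *
      omega

/-- Iterating a polynomial-time step may let the accumulator grow exponentially, hence the explicit
polynomial bound `u` on all intermediate values. -/
theorem PTW.foldl {v : β → ℕ} (hv : ∀ x, size x ≤ v x) {l : β → List γ} {i : β → δ}
    {g : β → δ → γ → δ} (hl : PTW v l) (hi : PTW v i)
    (hg : PT (fun p : β × δ × γ => g p.1 p.2.1 p.2.2)) {u : β → ℕ} (hu : PB v u)
    (hb : ∀ x l₁ l₂, l x = l₁ ++ l₂ → size (l₁.foldl (g x) (i x)) ≤ u x) :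
    PTW v fun x => (l x).foldl (g x) (i x) := by
  obtain ⟨cl, Tl, hcl, hTl, hsl⟩ := hl
  obtain ⟨ci, Ti, hci, hTi, hsi⟩ := hi
  obtain ⟨cg, Tg, hcg, ⟨k, hTg⟩, -⟩ := hg
  refine ⟨fun b => .seq (.assign (b + 1) (.var b)) (.seq (cl (b + 1))
      (.seq (.assign (b + 2) (.var b)) (.seq (ci (b + 2))
      (.seq (foldCmd cg b) (.assign b (.var (b + 2))))))),
    fun x => Tl x + Ti x + size (l x) * ((v x + u x + size (l x) + 4) ^ k + 14) + 10,
    fun b σ x hx => ?_, ?_, hu.mono fun x => hb x _ [] (by simp)⟩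
  · obtain ⟨σ₁, t₁, e₁, h₁, i₁, l₁⟩ := hcl (b + 1)
      (Function.update σ (b + 1) ((Expr.var b).eval σ)) x (by simp [Expr.eval, hx])
    obtain ⟨σ₂, t₂, e₂, h₂, i₂, l₂⟩ := hci (b + 2)
      (Function.update σ₁ (b + 2) ((Expr.var b).eval σ₁)) x
      (by simp [Expr.eval, i₁ b (by omega), hx])
    obtain ⟨σ₃, t₃, e₃, h₃, i₃, l₃⟩ := exec_foldCmd hcg b
      ((v x + u x + size (l x) + 4) ^ k) x (l x) (i x) σ₂
      (by rw [i₂ b (by omega), Function.update_of_ne (by omega), i₁ b (by omega),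
        Function.update_of_ne (by omega), hx])
      (by rw [i₂ _ (by omega), Function.update_of_ne (by omega), h₁]) h₂
      (fun l₁ y l₂ h => (hTg _).trans (Nat.pow_le_pow_left (by
        have h1 := hb x l₁ (y :: l₂) h
        have h2 := hv x
        have h3 : size y ≤ size (l x) := size_le_of_mem (by simp [h])
        simp only [size_pair]; omega) _))
    refine ⟨_, _, .seq (.assign _ _ _) (.seq e₁ (.seq (.assign _ _ _)
      (.seq e₂ (.seq e₃ (.assign _ _ _))))), ?_, fun j hj => ?_, ?_⟩
    · simp [Expr.eval, h₃]
    · rw [Function.update_of_ne (by omega), i₃ j hj, i₂ j (by omega),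
        Function.update_of_ne (by omega), i₁ j (by omega), Function.update_of_ne (by omega)]
    · have := Nat.mul_le_mul_right ((v x + u x + size (l x) + 4) ^ k + 14) (length_le_size (l x))
      simp only [Expr.cost]; omega
  · exact ((hTl.add hTi).add (hsl.mul (((((PB.self.add hu).add hsl).add (PB.const 4)).pow k).add
      (PB.const 14)))).add (PB.const 10)

theorem PT.foldl {l : β → List γ} {i : β → δ}
    {g : β → δ → γ → δ} (hl : PT l) (hi : PT i)
    (hg : PT (fun p : β × δ × γ => g p.1 p.2.1 p.2.2)) {u : β → ℕ} (hu : PB size u)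
    (hb : ∀ x l₁ l₂, l x = l₁ ++ l₂ → size (l₁.foldl (g x) (i x)) ≤ u x) :
    PT fun x => (l x).foldl (g x) (i x) :=
  PTW.foldl (fun _ => le_rfl) hl hi hg hu hb

end PTW

end SecondOrder

namespace SecondOrder

open Enc

/-! ### Filters and bounded quantifiers on lists -/

section lists

variable {β γ : Type*}

theorem foldl_snoc_eq_map (f : β → γ) (l : List β) (acc : List γ) :
    l.foldl (fun acc y => acc ++ [f y]) acc = acc ++ l.map f := by
  induction l generalizing acc with
  | nil => simp
  | cons a l ih => simp [ih]

theorem foldl_append_eq_flatten (l : List (List β)) (acc : List β) :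
    l.foldl (fun acc y => acc ++ y) acc = acc ++ l.flatten := by
  induction l generalizing acc with
  | nil => simp
  | cons a l ih => simp [ih]

theorem iterate_tail (n : ℕ) (l : List β) : List.tail^[n] l = l.drop n := by
  induction n generalizing l with
  | zero => rfl
  | succ n ih => rw [Function.iterate_succ_apply, ih, List.drop_tail]

/-- The sublist of the elements with a property. -/
noncomputable def lfilter (l : List β) (p : β → Prop) : List β :=
  open Classical in l.filter fun y => decide (p y)

@[simp] theorem mem_lfilter {l : List β} {p : β → Prop} {y : β} :
    y ∈ lfilter l p ↔ y ∈ l ∧ p y := by simp [lfilter]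

theorem lfilter_sublist (l : List β) (p : β → Prop) : (lfilter l p).Sublist l :=
  List.filter_sublist

theorem lfilter_congr {l : List β} {p q : β → Prop} (h : ∀ x ∈ l, (p x ↔ q x)) :
    lfilter l p = lfilter l q := by
  classical
  exact List.filter_congr fun x hx => by simp [h x hx]

theorem lfilter_mono {l : List β} {p q : β → Prop} (h : ∀ x ∈ l, p x → q x) :
    (lfilter l p).Sublist (lfilter l q) := by
  have : lfilter l p = lfilter (lfilter l q) p := by
    simp only [lfilter, List.filter_filter]
    exact List.filter_congr fun x hx => by
      by_cases hp : p x <;> simp [hp, h x hx]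
  rw [this]
  exact lfilter_sublist _ _

theorem lfilter_map (f : β → γ) (p : γ → Prop) (l : List β) :
    lfilter (l.map f) p = (lfilter l fun x => p (f x)).map f := by
  classical
  simp only [lfilter, List.filter_map]
  rfl

/-- Some element of the list has the property. -/
def exIn (l : List β) (p : β → Prop) : Prop := ∃ y ∈ l, p y

/-- All elements of the list have the property. -/
def allIn (l : List β) (p : β → Prop) : Prop := ∀ y ∈ l, p y

end lists

section combinators

variable {α β γ δ : Type} [Enc α] [Enc β] [Enc γ] [Enc δ]

/-! ### Control flow and propositions -/

theorem enc_prop {p : Prop} : enc p = .nil ↔ ¬ p := by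
  classical
  show Dat.bool (decide p) = _ ↔ _
  by_cases h : p <;> simp [h, Dat.bool]

open Classical in
@[fun_prop]
theorem PT.ite {p : α → Prop} {f g : α → β} (hp : PT p) (hf : PT f) (hg : PT g) :
    PT fun x => if p x then f x else g x := by
  obtain ⟨c, T, hc, hT, hs⟩ := hp
  obtain ⟨c₁, T₁, hc₁, hT₁, hs₁⟩ := hf
  obtain ⟨c₂, T₂, hc₂, hT₂, hs₂⟩ := hg
  refine ⟨fun b => .seq (.assign (b + 1) (.var b)) (.seq (c (b + 1))
      (.ite (.var (b + 1)) (c₁ b) (c₂ b))), fun x => T x + T₁ x + T₂ x + 4,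
    fun b σ x hx => ?_, ((hT.add hT₁).add hT₂).add (PB.const 4),
    (hs₁.add hs₂).mono fun x => by dsimp only; split_ifs <;> omega⟩
  obtain ⟨σ₁, t₁, e₁, h₁, i₁, l₁⟩ := hc (b + 1)
    (Function.update σ (b + 1) ((Expr.var b).eval σ)) x (by simp [Expr.eval, hx])
  have hb : σ₁ b = enc x := by rw [i₁ b (by omega), Function.update_of_ne (by omega), hx]
  by_cases hpx : p x
  · obtain ⟨σ₂, t₂, e₂, h₂, i₂, l₂⟩ := hc₁ b σ₁ x hb
    refine ⟨_, _, .seq (.assign _ _ _) (.seq e₁ (.ite_true ?_ e₂)), by simp [h₂, hpx],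
      fun i hi => ?_, ?_⟩
    · simp only [Expr.eval, h₁, ne_eq, enc_prop]; simpa using hpx
    · rw [i₂ i hi, i₁ i (by omega), Function.update_of_ne (by omega)]
    · simp only [Expr.cost]; omega
  · obtain ⟨σ₂, t₂, e₂, h₂, i₂, l₂⟩ := hc₂ b σ₁ x hb
    refine ⟨_, _, .seq (.assign _ _ _) (.seq e₁ (.ite_false ?_ e₂)), by simp [h₂, hpx],
      fun i hi => ?_, ?_⟩
    · simp only [Expr.eval, h₁, enc_prop]; exact hpx
    · rw [i₂ i hi, i₁ i (by omega), Function.update_of_ne (by omega)]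
    · simp only [Expr.cost]; omega

theorem PT.congr {f g : α → β} (hf : PT f) (h : ∀ x, g x = f x) : PT g := by
  rwa [funext h]

@[fun_prop]
theorem PT.and {p q : α → Prop} (hp : PT p) (hq : PT q) : PT fun x => p x ∧ q x :=
  (PT.ite hp hq (PT.const False)).congr fun x => by split_ifs with h <;> simp [h]

@[fun_prop]
theorem PT.or {p q : α → Prop} (hp : PT p) (hq : PT q) : PT fun x => p x ∨ q x :=
  (PT.ite hp (PT.const True) hq).congr fun x => by split_ifs with h <;> simp [h]

@[fun_prop]
theorem PT.not {p : α → Prop} (hp : PT p) : PT fun x => ¬ p x :=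
  (PT.ite hp (PT.const False) (PT.const True)).congr fun x => by split_ifs with h <;> simp [h]

@[fun_prop]
theorem PT.iff {p q : α → Prop} (hp : PT p) (hq : PT q) : PT fun x => p x ↔ q x :=
  (PT.ite hp hq (PT.not hq)).congr fun x => by split_ifs with h <;> simp [h]

/-- The truth value of a proposition. -/
noncomputable def toBool (p : Prop) : Bool := open Classical in decide p

@[simp] theorem toBool_eq_true {p : Prop} : toBool p = true ↔ p := by simp [toBool]

@[fun_prop]
theorem PT.toBool {p : α → Prop} (hp : PT p) : PT fun x => toBool (p x) :=
  hp.of_enc_eq fun _ => rfl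

@[fun_prop]
theorem PT.ofBool {p : α → Bool} (hp : PT p) : PT fun x => p x = true :=
  hp.of_enc_eq fun x => by
    show Dat.bool (SecondOrder.toBool (p x = true)) = Dat.bool _
    congr 1
    rw [Bool.eq_iff_iff, toBool_eq_true]

/-! ### Lists -/

@[fun_prop]
theorem PT.lcons {f : α → β} {l : α → List β} (hf : PT f) (hl : PT l) :
    PT fun x => f x :: l x := (hf.pair hl).of_enc_eq fun _ => rfl

@[fun_prop]
theorem PT.reverse {l : α → List β} (hl : PT l) : PT fun x => (l x).reverse :=
  (PT.foldl (g := fun _ acc y => y :: acc) hl (PT.const []) (by fun_prop) hl.size_le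
    (fun x l₁ l₂ h => by
      rw [List.foldl_flip_cons_eq_append', List.append_nil, size_reverse]
      exact size_le_of_sublist (by simp [h]))).congr fun x => by
    rw [List.foldl_flip_cons_eq_append', List.append_nil]

@[fun_prop]
theorem PT.append {l l' : α → List β} (hl : PT l) (hl' : PT l') :
    PT fun x => l x ++ l' x :=
  (PT.foldl (g := fun _ acc y => y :: acc) hl.reverse hl' (by fun_prop)
    (hl.size_le.add hl'.size_le)
    (fun x l₁ l₂ h => by
      rw [List.foldl_flip_cons_eq_append']
      have h1 := size_append l₁.reverse (l' x)
      have h2 : size l₁ ≤ size (l x) := by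
        rw [← size_reverse (l x), h]
        exact size_le_of_sublist (by simp)
      rw [size_reverse] at h1
      omega)).congr fun x => by
    rw [List.foldl_flip_cons_eq_append', List.reverse_reverse]

@[fun_prop]
theorem PT.map {l : α → List β} {f : α → β → γ} (hl : PT l)
    (hf : PT fun p : α × β => f p.1 p.2) : PT fun x => (l x).map (f x) := by
  obtain ⟨k, hk⟩ := hf.size_le
  refine (PT.foldl (g := fun x acc y => acc ++ [f x y]) hl (PT.const []) ?_
    (u := fun x => size (l x) * ((size x + size (l x) + 1 + 2) ^ k + 1) + 1) ?_ ?_).congr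
    fun x => by rw [foldl_snoc_eq_map, List.nil_append]
  · have : PT fun p : α × List γ × β => f p.1 p.2.2 :=
      hf.comp (f := fun p : α × β => f p.1 p.2) (g := fun p : α × List γ × β => (p.1, p.2.2))
        (by fun_prop)
    fun_prop
  · exact (hl.size_le.mul (((((PB.self.add hl.size_le).add (PB.const 1)).add
      (PB.const 2)).pow k).add (PB.const 1))).add (PB.const 1)
  · intro x l₁ l₂ h
    rw [foldl_snoc_eq_map, List.nil_append]
    refine (size_le_of_forall (m := (size x + size (l x) + 1 + 2) ^ k) ?_).trans ?_
    · intro c hc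
      obtain ⟨y, hy, rfl⟩ := List.mem_map.1 hc
      refine (hk (x, y)).trans (Nat.pow_le_pow_left ?_ _)
      have : size y ≤ size (l x) := size_le_of_mem (by simp [h, hy])
      simp; omega
    · have : l₁.length ≤ size (l x) := by
        have := length_le_size (l x)
        rw [h] at this ⊢
        simp at this; omega
      have := Nat.mul_le_mul_right ((size x + size (l x) + 1 + 2) ^ k + 1) this
      simpa using this

theorem size_flatten_le (l : List (List β)) : size l.flatten ≤ size l := by
  induction l with
  | nil => simp
  | cons a l ih =>
    have := size_append a l.flatten
    simp; omega

@[fun_prop]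
theorem PT.flatten {l : α → List (List β)} (hl : PT l) : PT fun x => (l x).flatten :=
  (PT.foldl (g := fun _ acc y => acc ++ y) hl (PT.const []) (by fun_prop) hl.size_le
    (fun x l₁ l₂ h => by
      rw [foldl_append_eq_flatten, List.nil_append]
      exact (size_flatten_le _).trans (size_le_of_sublist (by simp [h])))).congr fun x => by
    rw [foldl_append_eq_flatten, List.nil_append]

@[fun_prop]
theorem PT.flatMap {l : α → List β} {f : α → β → List γ} (hl : PT l)
    (hf : PT fun p : α × β => f p.1 p.2) : PT fun x => (l x).flatMap (f x) :=
  (hl.map hf).flatten.congr fun x => by rw [List.flatMap_def]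

@[fun_prop]
theorem PT.lfilter {l : α → List β} {p : α → β → Prop} (hl : PT l)
    (hp : PT fun q : α × β => p q.1 q.2) : PT fun x => lfilter (l x) (p x) := by
  classical
  refine (PT.flatMap (f := fun x y => if p x y then [y] else []) hl ?_).congr fun x => ?_
  · exact PT.ite hp (by fun_prop) (by fun_prop)
  · rw [SecondOrder.lfilter]
    induction l x with
    | nil => rfl
    | cons a l ih => by_cases h : p x a <;> simp [h, ih]


@[fun_prop]
theorem PT.exIn {l : α → List β} {p : α → β → Prop} (hl : PT l)
    (hp : PT fun q : α × β => p q.1 q.2) : PT fun x => exIn (l x) (p x) := by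
  refine (PT.foldl (g := fun x acc y => acc ∨ p x y) hl (PT.const False) ?_ (PB.const 3)
    (fun x _ _ _ => size_prop _)).congr fun x => ?_
  · have := hp.comp (f := fun q : α × β => p q.1 q.2)
      (g := fun q : α × Prop × β => (q.1, q.2.2)) (by fun_prop)
    fun_prop
  · have : ∀ (l : List β) (a : Prop), (l.foldl (fun acc y => acc ∨ p x y) a) =
        (a ∨ SecondOrder.exIn l (p x)) := by
      intro l
      induction l with
      | nil => simp [SecondOrder.exIn]
      | cons b l ih => intro a; simp [ih, SecondOrder.exIn, or_assoc]
    rw [this]; simp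

@[fun_prop]
theorem PT.allIn {l : α → List β} {p : α → β → Prop} (hl : PT l)
    (hp : PT fun q : α × β => p q.1 q.2) : PT fun x => allIn (l x) (p x) :=
  (PT.exIn (p := fun x y => ¬ p x y) hl hp.not).not.congr fun x => by
    simp [SecondOrder.allIn, SecondOrder.exIn]

theorem PT.isNil {l : α → List β} (hl : PT l) : PT fun x => l x = [] :=
  (PT.allIn (p := fun _ _ => False) hl (PT.const _)).congr fun x => by
    cases l x with
    | nil => simp [SecondOrder.allIn]
    | cons a l => simpa [SecondOrder.allIn] using ⟨a, fun h => absurd rfl h⟩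

instance : Enc Dat := ⟨id⟩

@[fun_prop]
theorem PT.tail {l : α → List β} (hl : PT l) : PT fun x => (l x).tail := by
  have : PT fun l : List β => l.tail :=
    .of_expr (fun b => .tl (.var b)) 2 (fun b σ x h => by
      show (σ b).tl = _; rw [h]; cases x <;> rfl) (fun _ => le_rfl)
      (PB.self.mono fun x => size_le_of_sublist (List.tail_sublist x))
  exact this.comp hl

/-- The head of an encoded empty list need not encode an element of `β`, so the intermediate value
is treated as a raw tree. -/
theorem PT.take_one {l : α → List β} (hl : PT l) : PT fun x => (l x).take 1 := by
  have h : PT fun l : List β => (enc l).hd :=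
    .of_expr (fun b => .hd (.var b)) 2 (fun b σ x h => by
      show (σ b).hd = _; rw [h]; rfl) (fun _ => le_rfl)
      (PB.self.mono fun x => by cases x <;> simp [size, enc, Dat.hd, Dat.list, Dat.sz]; omega)
  have h2 : PT fun l : List β => l.take 1 := by
    classical
    refine (PT.ite (PT.isNil PT.id') (PT.const ([] : List Dat))
      (h.lcons (PT.const []))).of_enc_eq fun x => ?_
    cases x <;> simp [Dat.hd]; rfl
  exact h2.comp hl

/-! ### Natural numbers -/

theorem PT.units {n : α → ℕ} (hn : PT n) : PT fun x => List.replicate (n x) () :=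
  hn.of_enc_eq fun _ => (enc_nat _).symm

theorem PT.of_units {n : α → ℕ} (hn : PT fun x => List.replicate (n x) ()) : PT n :=
  hn.of_enc_eq fun _ => enc_nat _

@[fun_prop]
theorem PT.length {l : α → List β} (hl : PT l) : PT fun x => (l x).length :=
  .of_units ((PT.map (f := fun _ _ => ()) hl (PT.const ())).congr fun x => by simp)

@[fun_prop]
theorem PT.nadd {m n : α → ℕ} (hm : PT m) (hn : PT n) : PT fun x => m x + n x :=
  .of_units ((hm.units.append hn.units).congr fun x => by simp)

@[fun_prop]
theorem PT.nmul {m n : α → ℕ} (hm : PT m) (hn : PT n) : PT fun x => m x * n x :=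
  ((PT.flatMap (f := fun x _ => List.replicate (n x) ()) hm.units
    (hn.units.comp PT.fst')).length).congr fun x => by simp

@[fun_prop]
theorem PT.range {n : α → ℕ} (hn : PT n) : PT fun x => List.range (n x) := by
  have key : ∀ m, (List.replicate m ()).foldl (fun (acc : List ℕ) _ => acc ++ [acc.length]) [] =
      List.range m := by
    intro m
    induction m with
    | zero => rfl
    | succ m ih =>
      rw [List.replicate_succ', List.foldl_append, ih, List.range_succ]; simp
  refine (PT.foldl (g := fun _ acc _ => acc ++ [acc.length]) hn.units (PT.const []) ?_
    (u := fun x => size (n x) * (size (n x) + 1) + 1) ?_ ?_).congr fun x => (key _).symm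
  · fun_prop
  · exact (hn.size_le.mul (hn.size_le.add (PB.const 1))).add (PB.const 1)
  · intro x l₁ l₂ h
    have h1 : l₁ = List.replicate l₁.length () := by simp [List.eq_replicate_iff]
    have h2 := congrArg List.length h
    rw [h1, key]
    refine (size_le_of_forall (m := size (n x)) fun b hb => ?_).trans ?_
    · simp [size_nat] at *; omega
    · have h3 : l₁.length ≤ size (n x) := by simp [size_nat] at *; omega
      have := Nat.mul_le_mul_right (size (n x) + 1) h3
      simpa using this

theorem PTW.iterate {v : α → ℕ} (hv : ∀ x, size x ≤ v x) {n : α → ℕ} {i : α → γ} {g : α → γ → γ}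
    (hn : PTW v n) (hi : PTW v i) (hg : PT fun p : α × γ => g p.1 p.2)
    {u : α → ℕ} (hu : PB v u)
    (hb : ∀ x, ∀ m ≤ n x, size ((g x)^[m] (i x)) ≤ u x) : PTW v fun x => (g x)^[n x] (i x) := by
  have key : ∀ x m, (List.replicate m ()).foldl (fun acc _ => g x acc) (i x) =
      (g x)^[m] (i x) := by
    intro x m
    induction m with
    | zero => rfl
    | succ m ih =>
      rw [List.replicate_succ', List.foldl_append, ih, Function.iterate_succ_apply']; simp
  have h0 := PTW.foldl hv (l := fun x => List.replicate (n x) ()) (g := fun x acc _ => g x acc)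
    (hn.of_enc_eq fun x => (enc_nat _).symm) hi
    (hg.comp (f := fun p : α × γ => g p.1 p.2) (g := fun p : α × γ × Unit => (p.1, p.2.1))
      (by fun_prop)) hu ?_
  · simpa only [key] using h0
  · intro x l₁ l₂ h
    have h1 : l₁ = List.replicate l₁.length () := by simp [List.eq_replicate_iff]
    have h2 := congrArg List.length h
    rw [h1, key]
    exact hb x _ (by simp at h2; omega)

theorem PT.iterate {n : α → ℕ} {i : α → γ} {g : α → γ → γ} (hn : PT n) (hi : PT i)
    (hg : PT fun p : α × γ => g p.1 p.2) {u : α → ℕ} (hu : PB size u)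
    (hb : ∀ x, ∀ m ≤ n x, size ((g x)^[m] (i x)) ≤ u x) : PT fun x => (g x)^[n x] (i x) :=
  PTW.iterate (fun _ => le_rfl) hn hi hg hu hb

@[fun_prop]
theorem PT.drop {n : α → ℕ} {l : α → List β} (hn : PT n) (hl : PT l) :
    PT fun x => (l x).drop (n x) :=
  (PT.iterate (g := fun _ => List.tail) hn hl (by fun_prop) hl.size_le (fun x m _ => by
    rw [iterate_tail]; exact size_le_of_sublist (List.drop_sublist _ _))).congr fun x => by
    rw [iterate_tail]

@[fun_prop]
theorem PT.take {n : α → ℕ} {l : α → List β} (hn : PT n) (hl : PT l) :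
    PT fun x => (l x).take (n x) :=
  (PT.flatMap (f := fun x i => ((l x).drop i).take 1) hn.range (PT.take_one
    ((PT.snd'.drop (hl.comp PT.fst'))))).congr fun x => by
    generalize n x = m
    induction m with
    | zero => rfl
    | succ m ih =>
      rw [List.range_succ, List.flatMap_append, ← ih, List.take_add_one]
      simp [List.take_one, List.head?_drop]

/-! ### Equality -/

/-- Types with equality decidable in polynomial time. -/
class PTEq (β : Type) [Enc β] : Prop where
  eq : PT fun p : β × β => p.1 = p.2

@[fun_prop]
theorem PT.eq [PTEq β] {f g : α → β} (hf : PT f) (hg : PT g) : PT fun x => f x = g x :=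
  PTEq.eq.comp (f := fun p : β × β => p.1 = p.2) (hf.pair hg)

instance : PTEq Unit := ⟨(PT.const True).congr fun x => by simp⟩
instance : PTEq Bool := ⟨(PT.iff (PT.ofBool PT.fst') (PT.ofBool PT.snd')).congr fun x => by
  rw [Bool.eq_iff_iff]⟩
instance [PTEq β] [PTEq γ] : PTEq (β × γ) :=
  ⟨(PT.and (p := fun x : (β × γ) × (β × γ) => x.1.1 = x.2.1) (q := fun x => x.1.2 = x.2.2)
    (by fun_prop) (by fun_prop)).congr fun x => by rw [Prod.ext_iff]⟩

/-- A fold along the first list consumes the second one; the lists are equal if the first is a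
prefix and nothing remains. -/
instance [PTEq β] : PTEq (List β) := ⟨by
  have key : ∀ (l l' : List β) (p : Prop),
      (l.foldl (fun (acc : Prop × List β) y =>
        (acc.1 ∧ exIn (acc.2.take 1) (fun z => y = z), acc.2.tail)) (p, l')) =
      ((p ∧ l <+: l'), l'.drop l.length) := by
    intro l
    induction l with
    | nil => intro l' p; simp
    | cons a l ih =>
      intro l' p
      rw [List.foldl_cons, ih]
      cases l' <;> simp [SecondOrder.exIn, and_assoc]
  have h := PT.foldl (β := List β × List β) (γ := β) (δ := Prop × List β)
    (l := fun p => p.1) (i := fun p => (True, p.2))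
    (g := fun _ acc y => (acc.1 ∧ exIn (acc.2.take 1) (fun z => y = z), acc.2.tail))
    (by fun_prop) (by fun_prop) (by fun_prop) (u := fun p => size p + 4)
    (PB.self.add (PB.const 4)) (by
      rintro ⟨x, y⟩ l₁ l₂ -
      rw [key]
      have h1 := size_prop (True ∧ l₁ <+: y)
      have h2 := size_le_of_sublist (List.drop_sublist l₁.length y)
      simp only [size_pair]; omega)
  refine (PT.and (h.comp PT.id').fst (PT.isNil h.snd)).congr fun x => ?_
  simp only [key]
  rw [eq_iff_iff]
  constructor
  · rintro h; simp [h]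
  · rintro ⟨⟨_, t, h⟩, h'⟩
    rw [← h] at h'
    simp at h'
    simpa [h'] using h⟩

instance : PTEq ℕ := ⟨(PT.eq (PT.units PT.fst') (PT.units PT.snd')).congr fun x => by
  rw [eq_iff_iff]
  exact ⟨fun h => by rw [h], fun h => by simpa using congrArg List.length h⟩⟩

@[fun_prop]
theorem PT.lmem [PTEq β] {f : α → β} {l : α → List β} (hf : PT f) (hl : PT l) :
    PT fun x => f x ∈ l x :=
  (PT.exIn (p := fun x y => f x = y) hl (by fun_prop)).congr fun x => by simp [SecondOrder.exIn]

@[fun_prop]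
theorem PT.nlt {m n : α → ℕ} (hm : PT m) (hn : PT n) : PT fun x => m x < n x :=
  (hm.lmem hn.range).congr fun x => by simp

end combinators

end SecondOrder

namespace SecondOrder

/-! ### Ordered decision diagrams, layer by layer -/

section chains

variable {α : Type*}

/-- Acceptance from a state by a list of layers; `fin` are the final states for the empty list. -/
def AccF : Finset ℕ → List (Layer α) → List α → ℕ → Prop
  | fin, [], [], p => p ∈ fin
  | _, B :: D, a :: x, p => ∃ q, (p, a, q) ∈ B.trans ∧ AccF B.final D x q
  | _, [], _ :: _, _ => False
  | _, _ :: _, [], _ => False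

/-- The set of strings accepted from a state. -/
def Res (fin : Finset ℕ) (D : List (Layer α)) (p : ℕ) : Set (List α) := {x | AccF fin D x p}

/-- The set of strings accepted from some state of a set. -/
def ResS (fin : Finset ℕ) (D : List (Layer α)) (S : Finset ℕ) : Set (List α) :=
  {x | ∃ p ∈ S, AccF fin D x p}

open Classical in
/-- The states reached from a set of states by reading a letter. -/
noncomputable def stepF (B : Layer α) (S : Finset ℕ) (a : α) : Finset ℕ :=
  B.right.filter fun q => ∃ p ∈ S, (p, a, q) ∈ B.trans

theorem mem_stepF {B : Layer α} {S : Finset ℕ} {a : α} {q : ℕ} :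
    q ∈ stepF B S a ↔ ∃ p ∈ S, (p, a, q) ∈ B.trans := by
  simp only [stepF, Finset.mem_filter, and_iff_right_iff_imp]
  rintro ⟨p, _, h⟩
  exact (B.trans_mem _ _ _ h).2

theorem stepF_subset (B : Layer α) (S : Finset ℕ) (a : α) : stepF B S a ⊆ B.right := by
  intro q hq
  obtain ⟨p, -, h⟩ := mem_stepF.1 hq
  exact (B.trans_mem _ _ _ h).2

theorem cons_mem_ResS {fin : Finset ℕ} {B : Layer α} {D : List (Layer α)} {S : Finset ℕ} {a : α}
    {x : List α} : a :: x ∈ ResS fin (B :: D) S ↔ x ∈ ResS B.final D (stepF B S a) := by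
  simp only [ResS, AccF, Set.mem_ofPred_eq, mem_stepF]
  constructor
  · rintro ⟨p, hp, q, hq, h⟩; exact ⟨q, ⟨p, hp, hq⟩, h⟩
  · rintro ⟨q, ⟨p, hp, hq⟩, h⟩; exact ⟨p, hp, q, hq, h⟩

theorem nil_notMem_ResS {fin : Finset ℕ} {B : Layer α} {D : List (Layer α)} {S : Finset ℕ} :
    [] ∉ ResS fin (B :: D) S := by simp [ResS, AccF]

theorem nil_notMem_Res {fin : Finset ℕ} {B : Layer α} {D : List (Layer α)} {p : ℕ} :
    [] ∉ Res fin (B :: D) p := by simp [Res, AccF]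

/-- Two string sets not containing the empty string are equal if their left quotients are. -/
theorem ext_cons {X Y : Set (List α)} (hX : [] ∉ X) (hY : [] ∉ Y)
    (h : ∀ a x, a :: x ∈ X ↔ a :: x ∈ Y) : X = Y := by
  ext x
  cases x with
  | nil => simp [hX, hY]
  | cons a x => exact h a x

theorem length_of_accF {D : List (Layer α)} : ∀ {fin : Finset ℕ} {x : List α} {p : ℕ},
    AccF fin D x p → x.length = D.length := by
  induction D with
  | nil => intro fin x p h; cases x <;> simp_all [AccF]
  | cons B D ih =>
    intro fin x p h
    cases x with
    | nil => simp [AccF] at h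
    | cons a x => obtain ⟨q, _, h⟩ := h; simp [ih h]

/-- A final segment of an ordered decision diagram, with interface `r` on its left; `b` tells
whether it is the whole diagram. -/
def Chain (w : ℕ) : Bool → Finset ℕ → List (Layer α) → Prop
  | _, _, [] => True
  | b, r, B :: D => B ∈ layerAlphabet α w ∧ B.left = r ∧ B.initFlag = b ∧
      (B.finalFlag = true ↔ D = []) ∧ Chain w false B.right D

/-- Replaces conditions on indices by a recursion on layers, on which the later inductions run. -/
theorem chain_iff (w : ℕ) (D : List (Layer α)) : ∀ (b : Bool) (r : Finset ℕ),
    Chain w b r D ↔ (∀ B ∈ D.head?, B.left = r) ∧ (∀ B ∈ D, B ∈ layerAlphabet α w) ∧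
      (∀ (i : ℕ) (h : i + 1 < D.length), D[i + 1].left = D[i].right) ∧
      (∀ (i : ℕ) (h : i < D.length), D[i].initFlag = true ↔ i = 0 ∧ b = true) ∧
      (∀ (i : ℕ) (h : i < D.length), D[i].finalFlag = true ↔ i + 1 = D.length) := by
  induction D with
  | nil => intro b r; simp [Chain]
  | cons B D ih =>
    intro b r
    rw [Chain, ih]
    constructor
    · rintro ⟨h1, h2, h3, h4, h5, h6, h7, h8, h9⟩
      refine ⟨by simpa using h2, by simpa [h1] using h6, ?_, ?_, ?_⟩
      · rintro (_ | i) hi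
        · cases D with
          | nil => simp at hi
          | cons B' D => simpa using h5
        · simpa using h7 i (by simpa using hi)
      · rintro (_ | i) hi
        · simp [h3]
        · simpa using h8 i (by simpa using hi)
      · rintro (_ | i) hi
        · simp only [List.getElem_cons_zero, List.length_cons, h4]
          cases D <;> simp
        · simpa using h9 i (by simpa using hi)
    · rintro ⟨h1, h2, h3, h4, h5⟩
      refine ⟨h2 B (by simp), by simpa using h1, ?_, ?_, ?_, fun B' h => h2 B' (by simp [h]),
        fun i hi => ?_, fun i hi => ?_, fun i hi => ?_⟩
      · have := h4 0 (by simp); simp at this; exact this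
      · have := h5 0 (by simp)
        simp only [List.getElem_cons_zero, List.length_cons] at this
        rw [this]; cases D <;> simp
      · cases D with
        | nil => simp
        | cons B' D => simpa using h3 0 (by simp)
      · exact h3 (i + 1) (by simpa using hi)
      · exact (h4 (i + 1) (by simpa using hi)).trans (by simp)
      · exact (h5 (i + 1) (by simpa using hi)).trans (by simp)

theorem isODD_iff {w : ℕ} {D : List (Layer α)} :
    IsODD w D ↔ D ≠ [] ∧ ∃ r, Chain w true r D := by
  constructor
  · rintro ⟨h0, h1, h2, h3, h4⟩
    refine ⟨h0, (D.head h0).left, (chain_iff _ _ _ _).2 ⟨?_, h1, h2, ?_, h4⟩⟩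
    · intro B hB
      rw [List.head?_eq_some_head h0] at hB
      simp at hB; rw [hB]
    · simpa using h3
  · rintro ⟨h0, r, h⟩
    obtain ⟨_, h1, h2, h3, h4⟩ := (chain_iff _ _ _ _).1 h
    exact ⟨h0, h1, h2, by simpa using h3, h4⟩

/-- The parameter `fin` counts only if there are no layers; otherwise it is replaced along the way
by the final states of the last layer. -/
theorem accF_iff (D : List (Layer α)) : ∀ (fin : Finset ℕ) (s : List α) (p₀ : ℕ),
    s.length = D.length → (AccF fin D s p₀ ↔ ∃ p : ℕ → ℕ, p 0 = p₀ ∧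
      p D.length ∈ ((D.getLast?.map Layer.final).getD fin) ∧
      ∀ (i : ℕ) (_ : i < D.length) (_ : i < s.length), (p i, s[i], p (i + 1)) ∈ D[i].trans) := by
  induction D with
  | nil =>
    intro fin s p₀ h
    obtain rfl : s = [] := by simpa using h
    simp only [AccF, List.length_nil, List.getLast?_nil, Option.map_none, Option.getD_none]
    exact ⟨fun h => ⟨fun _ => p₀, rfl, h, by simp⟩, fun ⟨p, h1, h2, _⟩ => h1 ▸ h2⟩
  | cons B D ih =>
    intro fin s p₀ h
    cases s with
    | nil => simp at h
    | cons a s =>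
      have hl : ((B :: D).getLast?.map Layer.final).getD fin =
          (D.getLast?.map Layer.final).getD B.final := by
        cases D with
        | nil => simp
        | cons B' D => simp [List.getLast?_eq_some_getLast]
      rw [AccF, hl]
      constructor
      · rintro ⟨q, hq, hD⟩
        obtain ⟨p, hp0, hp1, hp2⟩ := (ih _ _ _ (by simpa using h)).1 hD
        refine ⟨fun i => if i = 0 then p₀ else p (i - 1), by simp, by simpa using hp1, ?_⟩
        rintro (_ | i) h1 h2
        · simpa [hp0] using hq
        · simpa using hp2 i (by simpa using h1) (by simpa using h2)
      · rintro ⟨p, hp0, hp1, hp2⟩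
        refine ⟨p 1, hp0 ▸ hp2 0 (by simp) (by simp),
          (ih _ _ _ (by simpa using h)).2 ⟨fun i => p (i + 1), rfl, by simpa using hp1, ?_⟩⟩
        intro i h1 h2
        exact hp2 (i + 1) (by simpa using h1) (by simpa using h2)

theorem oddLang_cons (B : Layer α) (D : List (Layer α)) :
    oddLang (B :: D) = (D.length + 1, ResS ∅ (B :: D) B.init) := by
  rw [oddLang, List.length_cons, Prod.mk.injEq]
  refine ⟨rfl, ?_⟩
  ext s
  simp only [Set.mem_ofPred_eq, ResS]
  constructor
  · rintro ⟨hs, p, ⟨B', hB', h1⟩, ⟨B₂, hB₂, h2⟩, h3⟩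
    simp at hB'
    subst hB'
    refine ⟨p 0, h1, (accF_iff _ _ _ _ (by simpa using hs)).2 ⟨p, rfl, ?_, h3⟩⟩
    rw [hB₂]; simpa using h2
  · rintro ⟨p₀, hp₀, h⟩
    have hl := length_of_accF h
    obtain ⟨p, h1, h2, h3⟩ := (accF_iff _ _ _ _ hl).1 h
    refine ⟨by simpa using hl, p, ⟨B, by simp, h1 ▸ hp₀⟩,
      ⟨(B :: D).getLast (by simp), by simp [List.getLast?_eq_some_getLast], ?_⟩, h3⟩
    simpa [List.getLast?_eq_some_getLast] using h2

/-! ### Deterministic complete layers -/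

/-- Determinism and completeness of a layer. -/
def Layer.DC (B : Layer α) : Prop := B.IsDeterministic ∧ B.IsComplete

theorem Layer.DC.mem_Res {B : Layer α} (h : B.DC) {fin : Finset ℕ} {D : List (Layer α)}
    {p q : ℕ} {a : α} (ht : (p, a, q) ∈ B.trans) {x : List α} :
    a :: x ∈ Res fin (B :: D) p ↔ x ∈ Res B.final D q := by
  simp only [Res, AccF, Set.mem_ofPred_eq]
  constructor
  · rintro ⟨q', hq', hx⟩
    rwa [h.1.2 p (B.trans_mem _ _ _ ht).1 a q q' ht hq']
  · exact fun hx => ⟨q, ht, hx⟩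

/-- Distinct states of `r` accept different sets of strings. -/
def Sep (fin r : Finset ℕ) (D : List (Layer α)) : Prop :=
  ∀ p ∈ r, ∀ p' ∈ r, Res fin D p = Res fin D p' → p = p'

/-- Distinct states of the same level accept different sets of strings. -/
def AllSep : Finset ℕ → Finset ℕ → List (Layer α) → Prop
  | fin, r, [] => Sep fin r ([] : List (Layer α))
  | fin, r, B :: D => Sep fin r (B :: D) ∧ AllSep B.final B.right D

theorem AllSep.sep {fin r : Finset ℕ} {D : List (Layer α)} (h : AllSep fin r D) :
    Sep fin r D := by
  cases D with
  | nil => exact h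
  | cons B D => exact h.1

/-- The states of a layer cannot be merged locally. -/
def Layer.IsReduced (B : Layer α) : Prop :=
  (∀ p ∈ B.left, ∀ p' ∈ B.left,
    (∀ a, ∃ q, (p, a, q) ∈ B.trans ∧ (p', a, q) ∈ B.trans) → p = p') ∧
  (B.finalFlag = true → ∀ q ∈ B.right, ∀ q' ∈ B.right, (q ∈ B.final ↔ q' ∈ B.final) → q = q')

theorem nil_mem_Res {fin : Finset ℕ} {p : ℕ} : [] ∈ Res fin ([] : List (Layer α)) p ↔ p ∈ fin :=
  Iff.rfl

theorem Res_nil_eq {fin fin' : Finset ℕ} {p p' : ℕ} :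
    Res fin ([] : List (Layer α)) p = Res fin' [] p' ↔ (p ∈ fin ↔ p' ∈ fin') := by
  constructor
  · intro h; rw [← nil_mem_Res (α := α), h, nil_mem_Res]
  · intro h
    ext x
    cases x with
    | nil => exact h
    | cons a x => exact Iff.rfl

/-- Two states with the same residual have successors with equal residuals for each letter. If the
right states are separated, these successors coincide, which reducedness excludes for distinct
states. Thus separation propagates from right to left through locally reduced layers. -/
theorem Layer.IsReduced.sep {B : Layer α} {D : List (Layer α)} (hr : B.IsReduced) (hd : B.DC)
    (hs : Sep B.final B.right D) (fin : Finset ℕ) : Sep fin B.left (B :: D) := by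
  intro p hp p' hp' h
  refine hr.1 p hp p' hp' fun a => ?_
  obtain ⟨q, hq, ht⟩ := hd.2.2 p hp a
  obtain ⟨q', hq', ht'⟩ := hd.2.2 p' hp' a
  obtain rfl : q = q' := by
    refine hs q hq q' hq' ?_
    ext x
    rw [← hd.mem_Res (fin := fin) ht, h, hd.mem_Res ht']
  exact ⟨q, ht, ht'⟩

theorem Layer.IsReduced.sep_final {B : Layer α} (hr : B.IsReduced) (hf : B.finalFlag = true) :
    Sep B.final B.right ([] : List (Layer α)) := by
  intro p hp p' hp' h
  exact hr.2 hf p hp p' hp' (Res_nil_eq.1 h)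

/-- Converse of the backward propagation: states with the same successors for all letters have the
same residual. -/
theorem AllSep.isReduced {w : ℕ} {D : List (Layer α)} : ∀ {b : Bool} {fin r : Finset ℕ},
    Chain w b r D → (∀ B ∈ D, B.DC) → AllSep fin r D → ∀ B ∈ D, B.IsReduced := by
  induction D with
  | nil => simp
  | cons B D ih =>
    intro b fin r hc hd hs B' hB'
    obtain ⟨-, hl, -, hf, hc⟩ := hc
    rcases List.mem_cons.1 hB' with rfl | hB'
    · have hB := hd B' (by simp)
      refine ⟨fun p hp p' hp' h => hs.1 p (hl ▸ hp) p' (hl ▸ hp') ?_, fun hff q hq q' hq' h => ?_⟩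
      · refine ext_cons nil_notMem_Res nil_notMem_Res fun a x => ?_
        obtain ⟨q, h1, h2⟩ := h a
        rw [hB.mem_Res h1, hB.mem_Res h2]
      · have := hf.1 hff
        subst this
        exact hs.2 q hq q' hq' (Res_nil_eq.2 h)
    · exact ih hc (fun B hB => hd B (by simp [hB])) hs.2 B' hB'

/-- The number of states to the right of the layers. -/
def rightSum (D : List (Layer α)) : ℕ := (D.map fun B => B.right.card).sum

theorem card_le_of_Res {fin fin' r r' : Finset ℕ} {C D : List (Layer α)} (hs : Sep fin r C)
    (h : ∀ c ∈ r, ∃ d ∈ r', Res fin C c = Res fin' D d) : r.card ≤ r'.card := by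
  choose! f hf hf' using h
  refine Finset.card_le_card_of_injOn f hf fun c hc c' hc' e => hs c hc c' hc' ?_
  rw [hf' c hc, hf' c' hc', e]

/-- The residual of a reachable right state is a left quotient, by some letter, of the residual of a
left state; completeness of the other layer realizes the same quotient there. -/
theorem Res_right {B B' : Layer α} {C D : List (Layer α)} {fin fin' : Finset ℕ} (hB : B.DC)
    (hB' : B'.DC) (hr : B.IsReachable)
    (h : ∀ c ∈ B.left, ∃ d ∈ B'.left, Res fin (B :: C) c = Res fin' (B' :: D) d) :
    ∀ c ∈ B.right, ∃ d ∈ B'.right, Res B.final C c = Res B'.final D d := by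
  intro q hq
  obtain ⟨p, hp, a, ht⟩ := hr q hq
  obtain ⟨d, hd, e⟩ := h p hp
  obtain ⟨q', hq', ht'⟩ := hB'.2.2 d hd a
  refine ⟨q', hq', ?_⟩
  ext x
  rw [← hB.mem_Res (fin := fin) ht, e, hB'.mem_Res ht']

/-- Equality of residuals injects each level of the reachable, separated diagram `C` into the
corresponding level of `D`. If the totals agree, all these injections are bijections, and `D`
inherits separation from `C`. The first half yields minimality of separated diagrams, the second
half separation of minimal ones. -/
theorem rightSum_le {w w' : ℕ} {C : List (Layer α)} : ∀ {D : List (Layer α)} {b b' : Bool}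
    {fin fin' r r' : Finset ℕ}, C.length = D.length → Chain w b r C → Chain w' b' r' D →
    (∀ B ∈ C, B.DC) → (∀ B ∈ C, B.IsReachable) → (∀ B ∈ D, B.DC) → AllSep fin r C →
    (∀ c ∈ r, ∃ d ∈ r', Res fin C c = Res fin' D d) →
    rightSum C ≤ rightSum D ∧ (r'.card + rightSum D ≤ r.card + rightSum C →
      AllSep fin' r' D) := by
  induction C with
  | nil =>
    intro D b b' fin fin' r r' hl _ _ _ _ _ hs h
    obtain rfl : D = [] := by simpa using hl.symm
    refine ⟨le_rfl, fun hle => ?_⟩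
    choose! f hf hf' using h
    have hinj : Set.InjOn f r := fun c hc c' hc' e =>
      hs c hc c' hc' (by rw [hf' c hc, hf' c' hc', e])
    have hsurj := Finset.surj_on_of_inj_on_of_card_le (fun a _ => f a) hf
      (fun a b ha hb e => hinj ha hb e) (by simpa using hle)
    intro d hd d' hd' e
    obtain ⟨c, hc, rfl⟩ := hsurj d hd
    obtain ⟨c', hc', rfl⟩ := hsurj d' hd'
    rw [hs c hc c' hc' (by rw [hf' c hc, hf' c' hc', e])]
  | cons B C ih =>
    intro D b b' fin fin' r r' hl hC hD hBC hBr hBD hs h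
    cases D with
    | nil => simp at hl
    | cons B' D =>
      obtain ⟨-, rfl, -, -, hC⟩ := hC
      obtain ⟨-, rfl, -, -, hD⟩ := hD
      have hR := Res_right (hBC B (by simp)) (hBD B' (by simp)) (hBr B (by simp)) h
      obtain ⟨h1, h2⟩ := ih (by simpa using hl) hC hD (fun B hB => hBC B (by simp [hB]))
        (fun B hB => hBr B (by simp [hB])) (fun B hB => hBD B (by simp [hB])) hs.2 hR
      have h3 := card_le_of_Res hs.2.sep hR
      have h4 := card_le_of_Res hs.1 h
      simp only [rightSum, List.map_cons, List.sum_cons] at h1 h2 ⊢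
      refine ⟨by omega, fun hle => ⟨?_, h2 (by omega)⟩⟩
      choose! f hf hf' using h
      have hinj : Set.InjOn f B.left := fun c hc c' hc' e =>
        hs.1 c hc c' hc' (by rw [hf' c hc, hf' c' hc', e])
      -- No level of `C` exceeds that of `D`, so the inequality between the totals forces equality
      -- on this level.
      have hsurj := Finset.surj_on_of_inj_on_of_card_le (fun a _ => f a) hf
        (fun a b ha hb e => hinj ha hb e) (by omega)
      intro d hd d' hd' e
      obtain ⟨c, hc, rfl⟩ := hsurj d hd
      obtain ⟨c', hc', rfl⟩ := hsurj d' hd'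
      rw [hs.1 c hc c' hc' (by rw [hf' c hc, hf' c' hc', e])]

theorem oddNumStates_eq {w : ℕ} {b : Bool} {r : Finset ℕ} {D : List (Layer α)} (h : D ≠ [])
    (hc : Chain w b r D) : oddNumStates D = r.card + rightSum D := by
  cases D with
  | nil => simp at h
  | cons B D => obtain ⟨-, rfl, -⟩ := hc; simp [oddNumStates, rightSum]

theorem ResS_singleton {fin : Finset ℕ} {D : List (Layer α)} {p : ℕ} :
    ResS fin D {p} = Res fin D p := by ext x; simp [ResS, Res]

/-- The initial state of a deterministic complete diagram. -/
theorem oddLang_of_dc {w : ℕ} {r : Finset ℕ} {D : List (Layer α)} (h : D ≠ [])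
    (hc : Chain w true r D) (hd : ∀ B ∈ D, B.DC) :
    ∃ p, r = {p} ∧ oddLang D = (D.length, Res ∅ D p) := by
  cases D with
  | nil => simp at h
  | cons B D =>
    obtain ⟨-, rfl, hi, -⟩ := hc
    obtain ⟨h1, h2⟩ := (hd B (by simp)).1.1 hi
    obtain ⟨p, hp⟩ := Finset.card_eq_one.1 h2
    refine ⟨p, hp, ?_⟩
    rw [oddLang_cons, h1, hp, ResS_singleton, List.length_cons]

end chains

end SecondOrder

namespace SecondOrder

/-! ### Canonical forms -/

section canonical

variable {α : Type*} [LinearOrder α]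

/-- This is the source of the width `2 ^ w`: states with distinct residuals come from distinct
subsets of `{0, …, w - 1}`. -/
theorem card_le_two_pow {w N : ℕ} {β : Type*} {S : ℕ → Finset ℕ} {g : Finset ℕ → β}
    (hS : ∀ q < N, S q ⊆ Finset.range w)
    (hg : ∀ q < N, ∀ q' < N, g (S q) = g (S q') → q = q') : N ≤ 2 ^ w := by
  have := Finset.card_le_card_of_injOn (s := Finset.range N) (t := (Finset.range w).powerset) S
    (fun q hq => Finset.mem_powerset.2 (hS q (by simpa using hq)))
    (fun q hq q' hq' e => hg q (by simpa using hq) q' (by simpa using hq') (by rw [e]))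
  simpa using this

/-- A numbering of the values of a function on a finite linear order by first occurrence. -/
theorem exists_first_occurrence {X β : Type*} [LinearOrder X] (U : Finset X) (hU : U.Nonempty)
    (g : X → β) : ∃ (n : ℕ) (e : ℕ → X), 0 < n ∧ (∀ q < n, e q ∈ U) ∧
      (∀ q < n, ∀ q' < n, (e q < e q' ↔ q < q')) ∧
      (∀ q < n, ∀ y ∈ U, g y = g (e q) → e q ≤ y) ∧ ∀ x ∈ U, ∃ q < n, g x = g (e q) := by
  classical
  -- `M` contains the least element of each fibre; its increasing enumeration is the numbering
  -- sought.
  set M := U.filter fun x => ∀ y ∈ U, g y = g x → x ≤ y with hM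
  have hex : ∀ x ∈ U, ∃ m ∈ M, g x = g m := by
    intro x hx
    have hne : (U.filter fun y => g y = g x).Nonempty := ⟨x, by simp [hx]⟩
    have hmin := Finset.min'_mem _ hne
    rw [Finset.mem_filter] at hmin
    refine ⟨_, Finset.mem_filter.2 ⟨hmin.1, fun y hy h => Finset.min'_le _ _ ?_⟩, hmin.2.symm⟩
    simp [hy, h, hmin.2]
  obtain ⟨x₀, hx₀⟩ := hU
  obtain ⟨m₀, hm₀, -⟩ := hex x₀ hx₀
  let o := M.orderEmbOfFin rfl
  have ho : ∀ i, o i ∈ M := fun i => Finset.orderEmbOfFin_mem M rfl i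
  refine ⟨M.card, fun q => if h : q < M.card then o ⟨q, h⟩ else x₀, Finset.card_pos.2 ⟨_, hm₀⟩,
    fun q hq => ?_, fun q hq q' hq' => ?_, fun q hq y hy h => ?_, fun x hx => ?_⟩
  · simp only [hq, dif_pos]; exact (Finset.mem_filter.1 (ho _)).1
  · simp only [hq, hq', dif_pos]; simp [o.lt_iff_lt]
  · simp only [hq, dif_pos] at h ⊢; exact (Finset.mem_filter.1 (ho _)).2 y hy h
  · obtain ⟨m, hm, h⟩ := hex x hx
    have : m ∈ Set.range o := by rw [Finset.range_orderEmbOfFin]; exact hm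
    obtain ⟨i, rfl⟩ := this
    exact ⟨i, i.2, by simp [h]⟩

theorem Layer.IsNormalized.mem_layerAlphabet {w : ℕ} {B : Layer α} (h : B.IsNormalized w) :
    B ∈ layerAlphabet α w := by
  obtain ⟨-, w₁, h1, w₂, h2, h3, h4⟩ := h
  simp only [Finset.mem_Icc] at h1 h2
  constructor
  · rw [h3]; exact Finset.range_mono h1.2
  · rw [h4]; exact Finset.range_mono h2.2

/-- A canonical state `q < N` stands for the set `S q` of states of `D`, and distinct `q` have
distinct residuals. The successors of pairs `(p, a)` are merged when their residuals in the
remaining layers of `D` agree, and are numbered by their first pair. As residuals refer to `D` and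
not to the diagram under construction, a single pass from left to right yields a diagram that is
already minimal. -/
theorem exists_canonical [Fintype α] [Nonempty α] {w : ℕ} (D : List (Layer α)) : ∀ (b : Bool)
    (r fin fin' : Finset ℕ) (N : ℕ) (S : ℕ → Finset ℕ), Chain w b r D → 0 < N →
    (∀ q < N, S q ⊆ Finset.range w) → (b = true → N = 1) →
    (∀ q < N, ∀ q' < N, ResS fin D (S q) = ResS fin D (S q') → q = q') →
    (D = [] → ∀ q < N, (q ∈ fin' ↔ ∃ p ∈ S q, p ∈ fin)) →
    ∃ C : List (Layer α), C.length = D.length ∧ Chain (2 ^ w) b (Finset.range N) C ∧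
      (∀ B ∈ C, B.DC) ∧ (∀ B ∈ C, B.IsNormalized (2 ^ w)) ∧ AllSep fin' (Finset.range N) C ∧
      ∀ q < N, Res fin' C q = ResS fin D (S q) := by
  induction D with
  | nil =>
    intro b r fin fin' N S _ hN hS hb hsep hfin
    have key : ∀ q < N, Res fin' ([] : List (Layer α)) q = ResS fin [] (S q) := by
      intro q hq
      ext x
      cases x with
      | nil => simpa [Res, ResS, AccF] using hfin rfl q hq
      | cons a x => simp [Res, ResS, AccF]
    refine ⟨[], rfl, trivial, by simp, by simp, fun p hp p' hp' h => ?_, key⟩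
    simp only [Finset.mem_range] at hp hp'
    exact hsep p hp p' hp' (by rw [← key p hp, h, key p' hp'])
  | cons B D ih =>
    intro b r fin fin' N S hc hN hS hb hsep _
    classical
    obtain ⟨hBw, -, hBi, hBf, hc⟩ := hc
    -- `g` sends a pair to the residual of the set it leads to; its fibres are the states of the
    -- next level.
    let g : ℕ ×ₗ α → Set (List α) := fun x =>
      ResS B.final D (stepF B (S (ofLex x).1) (ofLex x).2)
    let U : Finset (ℕ ×ₗ α) := (Finset.range N ×ˢ Finset.univ).map toLex.toEmbedding
    have memU : ∀ p a, toLex (p, a) ∈ U ↔ p < N := by intro p a; simp [U]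
    have hUne : U.Nonempty := by
      obtain ⟨a⟩ := ‹Nonempty α›
      exact ⟨toLex (0, a), (memU _ _).2 hN⟩
    obtain ⟨n, e, hn, heU, helt, hemin, hex⟩ := exists_first_occurrence U hUne g
    have heN : ∀ q < n, (ofLex (e q)).1 < N := fun q hq =>
      (memU (ofLex (e q)).1 (ofLex (e q)).2).1 (heU q hq)
    have heinj : ∀ q < n, ∀ q' < n, g (e q) = g (e q') → q = q' := by
      intro q hq q' hq' h
      have h1 := hemin q hq _ (heU q' hq') h.symm
      have h2 := hemin q' hq' _ (heU q hq) h
      by_contra hne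
      rcases lt_or_gt_of_ne hne with hl | hl
      · exact absurd ((helt q hq q' hq').2 hl) (not_lt.2 h2)
      · exact absurd ((helt q' hq' q hq).2 hl) (not_lt.2 h1)
    -- A new state is represented by the set reached by its first pair; other pairs of its class may
    -- reach different sets with the same residual.
    let S' : ℕ → Finset ℕ := fun q => stepF B (S (ofLex (e q)).1) (ofLex (e q)).2
    have hS' : ∀ q < n, S' q ⊆ Finset.range w := fun q _ =>
      (stepF_subset _ _ _).trans hBw.2
    let B' : Layer α :=
      { left := Finset.range N
        right := Finset.range n
        trans := (Finset.range N ×ˢ (Finset.univ ×ˢ Finset.range n)).filter fun t =>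
          g (toLex (t.1, t.2.1)) = g (e t.2.2)
        init := if b then Finset.range N else ∅
        final := (Finset.range n).filter fun q => ∃ p ∈ S' q, p ∈ B.final
        initFlag := b
        finalFlag := B.finalFlag
        trans_mem := by
          intro p a q h
          simp only [Finset.mem_filter, Finset.mem_product] at h
          exact ⟨h.1.1, h.1.2.2⟩
        init_subset := by split_ifs <;> simp
        final_subset := Finset.filter_subset _ _
        init_eq_empty := by rintro rfl; simp
        final_eq_empty := by
          intro h; simp [B.final_eq_empty h] }
    have hT : ∀ p a q, (p, a, q) ∈ B'.trans ↔ p < N ∧ q < n ∧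
        g (toLex (p, a)) = g (e q) := by
      intro p a q
      simp [B', and_assoc]
    have hDC : B'.DC := by
      refine ⟨⟨fun h => ?_, fun p _ a q q' h h' => ?_⟩, fun h => ?_, fun p hp a => ?_⟩
      · have h : b = true := h
        simp [B', h, hb h]
      · rw [hT] at h h'
        exact heinj q h.2.1 q' h'.2.1 (h.2.2.symm.trans h'.2.2)
      · have h : b = true := h
        simp [B', h, hb h]
      · have hp : p < N := by simpa [B'] using hp
        obtain ⟨q, hq, h⟩ := hex _ ((memU p a).2 hp)
        exact ⟨q, by simpa [B'] using hq, (hT _ _ _).2 ⟨hp, hq, h⟩⟩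
    have hN2 : N ≤ 2 ^ w := card_le_two_pow hS hsep
    have hn2 : n ≤ 2 ^ w := card_le_two_pow (g := ResS B.final D) hS' heinj
    have hleast : ∀ q < n, ∀ x, B'.IsLeastPred q x → toLex x = e q := by
      rintro q hq ⟨p, a⟩ ⟨h1, h2⟩
      rw [hT] at h1
      refine le_antisymm (h2 (ofLex (e q)).1 (ofLex (e q)).2 ((hT _ _ _).2 ⟨heN q hq, hq, rfl⟩)) ?_
      exact hemin q hq _ ((memU _ _).2 h1.1) h1.2.2
    have hnorm : B'.IsNormalized (2 ^ w) := by
      refine ⟨⟨fun q hq => ?_, hDC.1, fun q hq q' hq' x x' hx hx' => ?_⟩, N, by simp; omega, n,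
        by simp; omega, rfl, rfl⟩
      · have hq : q < n := by simpa [B'] using hq
        exact ⟨(ofLex (e q)).1, by simpa [B'] using heN q hq, (ofLex (e q)).2,
          (hT _ _ _).2 ⟨heN q hq, hq, rfl⟩⟩
      · have hq : q < n := by simpa [B'] using hq
        have hq' : q' < n := by simpa [B'] using hq'
        rw [hleast q hq x hx, hleast q' hq' x' hx', helt q hq q' hq']
    obtain ⟨C, hlen, hC, hCd, hCn, hCs, hCr⟩ := ih false B.right B.final B'.final n S' hc hn hS'
      (by simp) heinj (fun _ q hq => by simp [B', hq])
    have key : ∀ q < N, Res fin' (B' :: C) q = ResS fin (B :: D) (S q) := by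
      intro q hq
      refine ext_cons nil_notMem_Res nil_notMem_ResS fun a x => ?_
      obtain ⟨q', hq', h⟩ := hex _ ((memU q a).2 hq)
      rw [hDC.mem_Res ((hT _ _ _).2 ⟨hq, hq', h⟩), cons_mem_ResS, hCr q' hq']
      exact (Set.ext_iff.1 h x).symm
    refine ⟨B' :: C, by simp [hlen], ⟨hnorm.mem_layerAlphabet, rfl, rfl, ?_, hC⟩, ?_, ?_,
      ⟨?_, hCs⟩, key⟩
    · show B.finalFlag = true ↔ _
      rw [hBf, ← List.length_eq_zero_iff, ← List.length_eq_zero_iff, hlen]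
    · simpa [hDC] using hCd
    · simpa [hnorm] using hCn
    · intro p hp p' hp' h
      simp only [Finset.mem_range] at hp hp'
      exact hsep p hp p' hp' (by rw [← key p hp, h, key p' hp'])

/-- An order isomorphism between initial segments of `ℕ` is the identity. -/
theorem eq_of_order_rel {m n : ℕ} {ρ : ℕ → ℕ → Prop} (h1 : ∀ q < m, ∃ q' < n, ρ q q')
    (h2 : ∀ q' < n, ∃ q < m, ρ q q') (hρ : ∀ q q', ρ q q' → q < m ∧ q' < n)
    (h : ∀ q q' s s', ρ q q' → ρ s s' → (q < s ↔ q' < s')) : ∀ q q', ρ q q' → q = q' := by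
  intro q
  induction q using Nat.strong_induction_on with
  | _ q ih =>
    intro q' hq
    have hle : q ≤ q' := by
      by_contra hlt
      push Not at hlt
      obtain ⟨s, hs, hss⟩ := h1 q' (hlt.trans (hρ _ _ hq).1)
      have e := ih q' hlt s hss
      have := (h _ _ _ _ hss hq).1 hlt
      subst e
      omega
    rcases hle.lt_or_eq with hlt | rfl
    · obtain ⟨s, hs, hss⟩ := h2 q (hlt.trans (hρ _ _ hq).2)
      have hsq := (h _ _ _ _ hss hq).2 hlt
      exact absurd (ih s hsq q hss) hsq.ne
    · rfl

theorem Layer.exists_isLeastPred {B : Layer α} {p q : ℕ} {a : α} (h : (p, a, q) ∈ B.trans) :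
    ∃ x, B.IsLeastPred q x := by
  classical
  let U : Finset (ℕ ×ₗ α) :=
    (B.trans.filter fun t => t.2.2 = q).image fun t => toLex (t.1, t.2.1)
  have hne : U.Nonempty := ⟨toLex (p, a), Finset.mem_image.2 ⟨(p, a, q), by simp [h], rfl⟩⟩
  obtain ⟨⟨p', a', q'⟩, h1, h2⟩ := Finset.mem_image.1 (Finset.min'_mem U hne)
  simp only [Finset.mem_filter] at h1
  obtain ⟨h1, rfl⟩ := h1
  refine ⟨(p', a'), h1, fun p'' a'' h'' => ?_⟩
  rw [h2]
  exact Finset.min'_le _ _ (Finset.mem_image.2 ⟨(p'', a'', q'), by simp [h''], rfl⟩)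

/-- Equal residuals match the right states of the two first layers. Matched states have the same
incoming transitions, hence the same least predecessors, so by normalization the matching preserves
the order and is the identity. The layers then agree and the induction continues on the right. The
two widths play no role. -/
theorem canonical_unique {w w' : ℕ} {C : List (Layer α)} : ∀ {C' : List (Layer α)} {b : Bool}
    {fin fin' : Finset ℕ} {r : Finset ℕ}, C.length = C'.length →
    Chain w b r C → Chain w' b r C' → (∀ B ∈ C, B.DC) → (∀ B ∈ C', B.DC) →
    (∀ B ∈ C, B.IsNormalized w) → (∀ B ∈ C', B.IsNormalized w') → AllSep fin r C →
    AllSep fin' r C' → (∀ q ∈ r, Res fin C q = Res fin' C' q) → C = C' := by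
  induction C with
  | nil =>
    intro C' _ _ _ _ hl _ _ _ _ _ _ _ _ _
    simpa using hl.symm
  | cons B C ih =>
    intro C' b fin fin' r hl hC hC' hd hd' hn hn' hs hs' hr
    cases C' with
    | nil => simp at hl
    | cons B' C' =>
      obtain ⟨-, hBl, hBi, hBf, hC⟩ := hC
      obtain ⟨-, hBl', hBi', hBf', hC'⟩ := hC'
      have hB := hd B (by simp)
      have hB' := hd' B' (by simp)
      obtain ⟨⟨hreach, -, hord⟩, -, -, n, -, -, hright⟩ := hn B (by simp)
      obtain ⟨⟨hreach', -, hord'⟩, -, -, n', -, -, hright'⟩ := hn' B' (by simp)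
      have hres : ∀ p a q q', (p, a, q) ∈ B.trans → (p, a, q') ∈ B'.trans →
          Res B.final C q = Res B'.final C' q' := by
        intro p a q q' h h'
        ext x
        rw [← hB.mem_Res (fin := fin) h, hr p (hBl ▸ (B.trans_mem _ _ _ h).1), hB'.mem_Res h']
      let ρ : ℕ → ℕ → Prop := fun q q' => q ∈ B.right ∧ q' ∈ B'.right ∧
        Res B.final C q = Res B'.final C' q'
      have hT : ∀ q q', ρ q q' → ∀ p a, (p, a, q) ∈ B.trans ↔ (p, a, q') ∈ B'.trans := by
        rintro q q' ⟨hq, hq', h⟩ p a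
        constructor
        · intro ht
          obtain ⟨q'', hq'', ht'⟩ := hB'.2.2 p (by rw [hBl', ← hBl]; exact (B.trans_mem _ _ _ ht).1) a
          rwa [hs'.2.sep q' hq' q'' hq'' (by rw [← h, hres _ _ _ _ ht ht'])]
        · intro ht'
          obtain ⟨q'', hq'', ht⟩ := hB.2.2 p (by rw [hBl, ← hBl']; exact (B'.trans_mem _ _ _ ht').1) a
          rwa [hs.2.sep q hq q'' hq'' (by rw [h, hres _ _ _ _ ht ht'])]
      have hρ1 : ∀ q ∈ B.right, ∃ q' ∈ B'.right, ρ q q' := by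
        intro q hq
        obtain ⟨p, hp, a, ht⟩ := hreach q hq
        obtain ⟨q', hq', ht'⟩ := hB'.2.2 p (by rwa [hBl', ← hBl]) a
        exact ⟨q', hq', hq, hq', hres _ _ _ _ ht ht'⟩
      have hρ2 : ∀ q' ∈ B'.right, ∃ q ∈ B.right, ρ q q' := by
        intro q' hq'
        obtain ⟨p, hp, a, ht'⟩ := hreach' q' hq'
        obtain ⟨q, hq, ht⟩ := hB.2.2 p (by rwa [hBl, ← hBl']) a
        exact ⟨q, hq, hq, hq', hres _ _ _ _ ht ht'⟩
      have heq : ∀ q q', ρ q q' → q = q' := by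
        refine eq_of_order_rel (m := n) (n := n') ?_ ?_ ?_ ?_
        · simpa [hright, hright'] using hρ1
        · simpa [hright, hright'] using hρ2
        · rintro q q' ⟨hq, hq', -⟩
          simpa [hright, hright'] using And.intro hq hq'
        · intro q q' s s' hq hs
          obtain ⟨p, -, a, ht⟩ := hreach q hq.1
          obtain ⟨x, hx⟩ := Layer.exists_isLeastPred ht
          obtain ⟨p, -, a, ht⟩ := hreach s hs.1
          obtain ⟨y, hy⟩ := Layer.exists_isLeastPred ht
          have tr : ∀ q q', ρ q q' → ∀ x, B.IsLeastPred q x → B'.IsLeastPred q' x :=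
            fun q q' h x hx => ⟨(hT q q' h _ _).1 hx.1,
              fun p a ht => hx.2 p a ((hT q q' h _ _).2 ht)⟩
          rw [hord q hq.1 s hs.1 x y hx hy,
            hord' q' hq.2.1 s' hs.2.1 x y (tr _ _ hq _ hx) (tr _ _ hs _ hy)]
      have hrr : B.right = B'.right := by
        ext q
        constructor
        · intro hq
          obtain ⟨q', hq', h⟩ := hρ1 q hq
          rwa [heq _ _ h]
        · intro hq
          obtain ⟨q', hq', h⟩ := hρ2 q hq
          rwa [← heq _ _ h]
      have hrefl : ∀ q ∈ B.right, ρ q q := by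
        intro q hq
        obtain ⟨q', hq', h⟩ := hρ1 q hq
        rwa [← heq _ _ h] at h
      have hCC : C = C' := by
        refine ih (by simpa using hl) hC (hrr ▸ hC') (fun B hB => hd B (by simp [hB]))
          (fun B hB => hd' B (by simp [hB])) (fun B hB => hn B (by simp [hB]))
          (fun B hB => hn' B (by simp [hB])) hs.2 (hrr ▸ hs'.2) fun q hq => (hrefl q hq).2.2
      subst hCC
      have hflag : B.finalFlag = B'.finalFlag := by rw [Bool.eq_iff_iff, hBf, hBf']
      congr 1
      ext t
      · rw [hBl, hBl']
      · rw [hrr]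
      · obtain ⟨p, a, q⟩ := t
        constructor
        · intro h; exact (hT q q (hrefl q (B.trans_mem _ _ _ h).2) p a).1 h
        · intro h; exact (hT q q (hrefl q (hrr ▸ (B'.trans_mem _ _ _ h).2)) p a).2 h
      · cases b with
        | false => rw [B.init_eq_empty hBi, B'.init_eq_empty hBi']
        | true => rw [(hB.1.1 hBi).1, (hB'.1.1 hBi').1, hBl, hBl']
      · cases hf : B.finalFlag with
        | false => rw [B.final_eq_empty hf, B'.final_eq_empty (hflag ▸ hf)]
        | true =>
          have hCn := hBf.1 hf
          subst hCn
          constructor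
          · intro h; exact (Res_nil_eq.1 (hrefl _ (B.final_subset h)).2.2).1 h
          · intro h; exact (Res_nil_eq.1 (hrefl _ (hrr ▸ B'.final_subset h)).2.2).2 h
      · rw [hBi, hBi']
      · rw [hflag]

end canonical

end SecondOrder

namespace SecondOrder

/-! ### Existence, uniqueness and local verification of canonical forms -/

section canonicalForm

variable {α : Type*} [LinearOrder α]

/-- A reduced form of `IsCanonicalForm`, in terms of the residuals of the states. -/
def Canon (w : ℕ) (D C : List (Layer α)) : Prop :=
  C ≠ [] ∧ Chain (2 ^ w) true (Finset.range 1) C ∧ (∀ B ∈ C, B.DC) ∧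
  (∀ B ∈ C, B.IsNormalized (2 ^ w)) ∧ AllSep ∅ (Finset.range 1) C ∧
  (C.length, Res ∅ C 0) = oddLang D

theorem Canon.oddLang_eq {w : ℕ} {D C : List (Layer α)} (h : Canon w D C) :
    oddLang C = oddLang D := by
  obtain ⟨h1, h2, h3, -, -, h6⟩ := h
  obtain ⟨p, hp, hl⟩ := oddLang_of_dc h1 h2 h3
  obtain rfl : p = 0 := by simpa using hp.symm
  rw [hl, h6]

theorem exists_canon [Fintype α] [Nonempty α] {w : ℕ} {D : List (Layer α)} (hD : IsODD w D) :
    ∃ C, Canon w D C := by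
  obtain ⟨h0, r, hc⟩ := isODD_iff.1 hD
  cases D with
  | nil => simp at h0
  | cons B D =>
    obtain ⟨C, h1, h2, h3, h4, h5, h6⟩ := exists_canonical (B :: D) true r ∅ ∅ 1
      (fun _ => B.init) hc one_pos (fun _ _ => B.init_subset.trans hc.1.1) (fun _ => rfl)
      (fun q hq q' hq' _ => by omega) (by simp)
    refine ⟨C, ?_, h2, h3, h4, h5, ?_⟩
    · rintro rfl; simp at h1
    · rw [oddLang_cons, h6 0 one_pos, h1, List.length_cons]

theorem Canon.isCanonicalForm {w : ℕ} {D C : List (Layer α)}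
    (h : Canon w D C) : IsCanonicalForm w D C := by
  have hL := h.oddLang_eq
  obtain ⟨h1, h2, h3, h4, h5, h6⟩ := h
  refine ⟨⟨isODD_iff.2 ⟨h1, _, h2⟩, fun B hB => (h3 B hB).1, fun B hB => (h3 B hB).2⟩, ?_, h4, hL⟩
  rintro w' - D' ⟨hD', hd, hc⟩ he
  obtain ⟨h1', r', h2'⟩ := isODD_iff.1 hD'
  have hdc : ∀ B ∈ D', B.DC := fun B hB => ⟨hd B hB, hc B hB⟩
  obtain ⟨p', rfl, hl'⟩ := oddLang_of_dc h1' h2' hdc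
  rw [hL, ← h6, hl', Prod.mk.injEq] at he
  rw [oddNumStates_eq h1 h2, oddNumStates_eq h1' h2']
  have := (rightSum_le he.1 h2 h2' h3 (fun B hB => (h4 B hB).1.1) hdc h5
    (fun c hc => ⟨p', by simp, by simp at hc; rw [hc]; exact he.2⟩)).1
  simpa using this

/-- A minimal diagram has no more states than the separated one constructed by `exists_canon`, so
the equality case of `rightSum_le` makes it separated. -/
theorem IsCanonicalForm.canon [Fintype α] [Nonempty α] {w : ℕ} {D C : List (Layer α)}
    (hD : IsODD w D) (h : IsCanonicalForm w D C) : Canon w D C := by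
  obtain ⟨⟨hC, hd, hc⟩, hmin, hn, hL⟩ := h
  obtain ⟨h1, r, h2⟩ := isODD_iff.1 hC
  have hdc : ∀ B ∈ C, B.DC := fun B hB => ⟨hd B hB, hc B hB⟩
  obtain ⟨p, rfl, hl⟩ := oddLang_of_dc h1 h2 hdc
  obtain ⟨C', hC'⟩ := exists_canon hD
  have hf := hC'.isCanonicalForm
  have hle := hmin (2 ^ w) (by positivity) C' hf.1 (hL.trans hf.2.2.2.symm)
  obtain ⟨h1', h2', h3', h4', h5', h6'⟩ := hC'
  -- The left states of the first layer form both a singleton and a nonempty initial segment.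
  have hp : p = 0 := by
    cases C with
    | nil => simp at h1
    | cons B C =>
      obtain ⟨-, hl, -⟩ := h2
      obtain ⟨-, w₁, hw, -, -, hw₁, -⟩ := hn B (by simp)
      have : 0 ∈ B.left := by simp at hw; simp [hw₁]; omega
      rw [hl] at this
      simpa [eq_comm] using this
  subst hp
  have he : (C'.length, Res ∅ C' 0) = (C.length, Res ∅ C 0) := by rw [h6', ← hL, hl]
  rw [Prod.mk.injEq] at he
  rw [oddNumStates_eq h1 h2, oddNumStates_eq h1' h2'] at hle
  have := (rightSum_le he.1 h2' h2 h3' (fun B hB => (h4' B hB).1.1) hdc h5'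
    (fun c hc => ⟨0, by simp, by simp at hc; rw [hc]; exact he.2⟩)).2 hle
  exact ⟨h1, h2, hdc, hn, this, by rw [← hL, hl]⟩

theorem Canon.unique {w w' : ℕ} {D D' C C' : List (Layer α)} (h : Canon w D C)
    (h' : Canon w' D' C') (he : oddLang D = oddLang D') : C = C' := by
  obtain ⟨h1, h2, h3, h4, h5, h6⟩ := h
  obtain ⟨h1', h2', h3', h4', h5', h6'⟩ := h'
  rw [← h6, ← h6', Prod.mk.injEq] at he
  exact canonical_unique he.1 h2 h2' h3 h3' h4 h4' h5 h5'
    fun q hq => by simp at hq; rw [hq]; exact he.2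

theorem isCanonicalForm_iff [Fintype α] [Nonempty α] {w : ℕ} {D C : List (Layer α)}
    (hD : IsODD w D) : IsCanonicalForm w D C ↔ Canon w D C :=
  ⟨fun h => h.canon hD, fun h => h.isCanonicalForm⟩

theorem existsUnique_isCanonicalForm [Fintype α] [Nonempty α] {w : ℕ} {D : List (Layer α)}
    (hD : IsODD w D) : ∃! C, IsCanonicalForm w D C := by
  obtain ⟨C, hC⟩ := exists_canon hD
  exact ⟨C, hC.isCanonicalForm, fun C' hC' => (hC'.canon hD).unique hC rfl⟩

/-! ### Simultaneous runs on a diagram and its canonical form -/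

/-- The pairs reached from the pairs in `f` by reading a letter. -/
def stepRel (f : Set (Finset ℕ × ℕ)) (B C : Layer α) : Set (Finset ℕ × ℕ) :=
  {e' | ∃ e ∈ f, ∃ a, e'.1 = stepF B e.1 a ∧ (e.2, a, e'.2) ∈ C.trans}

/-- The local conditions for the layers `B` and `C` of a diagram and its canonical form, where `f`
and `f'` are the sets of pairs (set of states, state) reached before and after these layers. -/
def MTrans (w : ℕ) (f : Set (Finset ℕ × ℕ)) (B C : Layer α) (f' : Set (Finset ℕ × ℕ))
    (ok : Prop) : Prop :=
  (C.DC ∧ C.IsNormalized (2 ^ w) ∧ C.IsReduced) ∧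
  (C.initFlag = B.initFlag ∧ C.finalFlag = B.finalFlag) ∧
  (∀ p, p ∈ C.left ↔ ∃ e ∈ f, e.2 = p) ∧
  f' = stepRel f B C ∧
  (∀ q, q ∈ C.right ↔ ∃ e ∈ f', e.2 = q) ∧
  (∀ e ∈ f', ∀ e' ∈ f', e.1 = e'.1 → e.2 = e'.2) ∧
  (ok ↔ ∀ e ∈ f', ((∃ p ∈ e.1, p ∈ B.final) ↔ e.2 ∈ C.final))

/-- A simultaneous run, started with the pairs in `f`. -/
def Sim (w : ℕ) : Set (Finset ℕ × ℕ) → Prop → List (Layer α) → List (Layer α) → Prop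
  | _, ok, [], [] => ok
  | f, _, B :: D, C :: Cs => ∃ f' ok', MTrans w f B C f' ok' ∧ Sim w f' ok' D Cs
  | _, _, [], _ :: _ => False
  | _, _, _ :: _, [] => False

/-- The pairs in `f` are those reached by common strings. From a run, local reducedness yields
separation from right to left, and equality of the residuals of each pair is pulled back through the
layer. Conversely, residual equality is pushed forward to successor pairs, and pairs with the same
set have the same residual, so by separation the same state. The value `ok` is recomputed after each
layer, but only the last one counts; it compares acceptance at the end. -/
theorem sim_iff {w : ℕ} {D : List (Layer α)} : ∀ {C : List (Layer α)} {b : Bool}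
    {r r' fin fin' : Finset ℕ} {f : Set (Finset ℕ × ℕ)} {ok : Prop}, Chain w b r D →
    (∀ p, p ∈ r' ↔ ∃ e ∈ f, e.2 = p) →
    (ok ↔ ∀ e ∈ f, ((∃ p ∈ e.1, p ∈ fin) ↔ e.2 ∈ fin')) →
    (D = [] → Sep fin' r' ([] : List (Layer α))) →
    (Sim w f ok D C ↔ C.length = D.length ∧ Chain (2 ^ w) b r' C ∧ (∀ B ∈ C, B.DC) ∧
      (∀ B ∈ C, B.IsNormalized (2 ^ w)) ∧ AllSep fin' r' C ∧
      ∀ e ∈ f, ResS fin D e.1 = Res fin' C e.2) := by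
  induction D with
  | nil =>
    intro C b r r' fin fin' f ok _ hr hok hs
    cases C with
    | cons => simp [Sim]
    | nil =>
      have : ∀ e : Finset ℕ × ℕ, ResS fin ([] : List (Layer α)) e.1 = Res fin' [] e.2 ↔
          ((∃ p ∈ e.1, p ∈ fin) ↔ e.2 ∈ fin') := by
        intro e
        constructor
        · intro h; simpa [ResS, Res, AccF] using Set.ext_iff.1 h []
        · intro h
          ext x
          cases x with
          | nil => simpa [ResS, Res, AccF] using h
          | cons a x => simp [ResS, Res, AccF]
      simp only [Sim, hok, this]
      exact ⟨fun h => ⟨trivial, trivial, by simp, by simp, hs rfl, h⟩, fun h => h.2.2.2.2.2⟩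
  | cons B D ih =>
    intro C b r r' fin fin' f ok hc hr _ _
    obtain ⟨hBw, -, hBi, hBf, hc⟩ := hc
    cases C with
    | nil => simp [Sim]
    | cons C Cs =>
      constructor
      · rintro ⟨f', ok', ⟨⟨hd, hn, hred⟩, ⟨hi, hf⟩, hleft, rfl, hright, -, hok'⟩, hsim⟩
        obtain ⟨i1, i2, i3, i4, i5, i6⟩ := (ih hc hright hok'
          (fun h => hred.sep_final (by rw [hf, hBf, h]))).1 hsim
        have hl : C.left = r' := by ext p; rw [hleft, hr]
        refine ⟨by simp [i1], ⟨hn.mem_layerAlphabet, hl, hi.trans hBi, ?_, i2⟩,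
          by simpa [hd] using i3, by simpa [hn] using i4, ⟨?_, i5⟩, ?_⟩
        · rw [hf, hBf, ← List.length_eq_zero_iff, ← List.length_eq_zero_iff, i1]
        · rw [← hl]; exact hred.sep hd i5.sep fin'
        · rintro ⟨S, c⟩ he
          refine ext_cons nil_notMem_ResS nil_notMem_Res fun a x => ?_
          obtain ⟨c', -, ht⟩ := hd.2.2 c ((hleft c).2 ⟨_, he, rfl⟩) a
          rw [cons_mem_ResS, hd.mem_Res ht, i6 (stepF B S a, c') ⟨_, he, a, rfl, ht⟩]
      · rintro ⟨h1, h2, h3, h4, h5, h6⟩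
        have hd := h3 C (by simp)
        have hn := h4 C (by simp)
        have hred := h5.isReduced h2 h3 C (by simp)
        obtain ⟨-, hl, hi, hf, h2⟩ := h2
        have hlen : Cs.length = D.length := by simpa using h1
        have hff : C.finalFlag = B.finalFlag := by
          rw [Bool.eq_iff_iff, hf, hBf, ← List.length_eq_zero_iff, ← List.length_eq_zero_iff, hlen]
        have hright : ∀ q, q ∈ C.right ↔ ∃ e ∈ stepRel f B C, e.2 = q := by
          intro q
          constructor
          · intro hq
            obtain ⟨p, hp, a, ht⟩ := hn.1.1 q hq
            rw [hl] at hp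
            obtain ⟨e, he, rfl⟩ := (hr p).1 hp
            exact ⟨(stepF B e.1 a, q), ⟨e, he, a, rfl, ht⟩, rfl⟩
          · rintro ⟨e', ⟨e, he, a, -, ht⟩, rfl⟩
            exact (C.trans_mem _ _ _ ht).2
        have hres : ∀ e ∈ stepRel f B C, ResS B.final D e.1 = Res C.final Cs e.2 := by
          rintro ⟨S', c'⟩ ⟨e, he, a, rfl, ht⟩
          ext x
          rw [← cons_mem_ResS (fin := fin), h6 e he, hd.mem_Res ht]
        refine ⟨stepRel f B C, _, ⟨⟨hd, hn, hred⟩, ⟨hi.trans hBi.symm, hff⟩,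
          fun p => by rw [hl, hr], rfl, hright, ?_, Iff.rfl⟩, ?_⟩
        · intro e he e' he' h
          exact h5.2.sep _ ((hright _).2 ⟨e, he, rfl⟩) _ ((hright _).2 ⟨e', he', rfl⟩)
            (by rw [← hres e he, ← hres e' he', h])
        · exact (ih hc hright Iff.rfl (fun h => hred.sep_final (by rw [hff, hBf, h]))).2
            ⟨hlen, h2, fun B hB => h3 B (by simp [hB]), fun B hB => h4 B (by simp [hB]), h5.2, hres⟩

theorem sim_iff_canon {w : ℕ} {r : Finset ℕ} {B : Layer α} {D C : List (Layer α)}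
    (hc : Chain w true r (B :: D)) {ok : Prop} :
    Sim w {(B.init, 0)} ok (B :: D) C ↔ Canon w (B :: D) C := by
  -- The initial `ok` is ignored when a layer follows, so it may be replaced by the value that
  -- `sim_iff` asks for.
  have hok : Sim w {(B.init, 0)} ok (B :: D) C ↔ Sim w {(B.init, 0)} (∀ e ∈
      ({(B.init, 0)} : Set (Finset ℕ × ℕ)), ((∃ p ∈ e.1, p ∈ (∅ : Finset ℕ)) ↔
        e.2 ∈ (∅ : Finset ℕ))) (B :: D) C := by
    cases C <;> rfl
  rw [hok, sim_iff (r' := Finset.range 1) hc (by simp [eq_comm]) Iff.rfl (by simp), Canon,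
    oddLang_cons]
  constructor
  · rintro ⟨h1, h2, h3, h4, h5, h6⟩
    refine ⟨by rintro rfl; simp at h1, h2, h3, h4, h5, ?_⟩
    rw [h6 _ rfl, h1, List.length_cons]
  · rintro ⟨h1, h2, h3, h4, h5, h6⟩
    rw [Prod.mk.injEq] at h6
    refine ⟨by simpa using h6.1, h2, h3, h4, h5, ?_⟩
    rintro e rfl
    exact h6.2.symm

end canonicalForm

end SecondOrder

namespace SecondOrder

/-! ### The minimal automaton of a language -/

section minimal

open List (Shortlex)

variable {L : Type*}

/-- Nerode equivalence of words. -/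
def Ner (𝓛 : Set (List L)) (u v : List L) : Prop := ∀ z, u ++ z ∈ 𝓛 ↔ v ++ z ∈ 𝓛

namespace Ner

variable {𝓛 : Set (List L)} {u v x : List L}

theorem refl (u : List L) : Ner 𝓛 u u := fun _ => Iff.rfl
theorem symm (h : Ner 𝓛 u v) : Ner 𝓛 v u := fun z => (h z).symm
theorem trans (h : Ner 𝓛 u v) (h' : Ner 𝓛 v x) : Ner 𝓛 u x := fun z => (h z).trans (h' z)
theorem append (h : Ner 𝓛 u v) (z : List L) : Ner 𝓛 (u ++ z) (v ++ z) := fun y => by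
  simpa using h (z ++ y)
theorem mem_iff (h : Ner 𝓛 u v) : u ∈ 𝓛 ↔ v ∈ 𝓛 := by simpa using h []

end Ner

/-- `u` is the first word of its class. -/
def MinRep (lt : L → L → Prop) (𝓛 : Set (List L)) (u : List L) : Prop :=
  ∀ v, Shortlex lt v u → ¬ Ner 𝓛 v u

/-- `R` lists the first words of all classes in shortlex order. -/
def IsRepList (lt : L → L → Prop) (𝓛 : Set (List L)) (R : List (List L)) : Prop :=
  R.Pairwise (Shortlex lt) ∧ ∀ u, u ∈ R ↔ MinRep lt 𝓛 u

variable {lt : L → L → Prop} {𝓛 : Set (List L)}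

theorem shortlex_snoc {u v : List L} (h : Shortlex lt u v) (a b : L) :
    Shortlex lt (u ++ [a]) (v ++ [b]) := by
  rcases List.shortlex_def.1 h with h | ⟨h, h'⟩
  · exact .of_length_lt (by simpa using h)
  · refine .of_lex (by simpa using h) ?_
    have key : ∀ {u v : List L}, u.length = v.length → List.Lex lt u v →
        List.Lex lt (u ++ [a]) (v ++ [b]) := by
      intro u v hl h
      induction h with
      | nil => simp at hl
      | rel h => exact .rel h
      | cons h ih => exact .cons (ih (by simpa using hl))
    exact key h h'

/-- Replacing a prefix by a smaller equivalent word makes the whole word smaller and keeps it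
equivalent. First words are thus closed under prefixes and can be enumerated by one-letter
extensions. -/
theorem MinRep.of_snoc {u : List L} {a : L} (h : MinRep lt 𝓛 (u ++ [a])) : MinRep lt 𝓛 u :=
  fun v hv hn => h (v ++ [a]) (shortlex_snoc hv a a) (hn.append [a])

theorem minRep_nil : MinRep lt 𝓛 [] := fun _ h => absurd h List.not_shortlex_nil_right

theorem exists_minRep (hwf : WellFounded lt) (u : List L) :
    ∃ m, MinRep lt 𝓛 m ∧ Ner 𝓛 m u ∧ ¬ Shortlex lt u m := by
  obtain ⟨m, hm, hmin⟩ := (List.Shortlex.wf hwf).has_min {v | Ner 𝓛 v u} ⟨u, Ner.refl u⟩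
  exact ⟨m, fun v hv hn => hmin v (hn.trans hm) hv, hm, hmin u (Ner.refl u)⟩

theorem MinRep.eq [Std.Trichotomous lt] {u v : List L} (hu : MinRep lt 𝓛 u)
    (hv : MinRep lt 𝓛 v) (h : Ner 𝓛 u v) : u = v :=
  Std.Trichotomous.trichotomous (r := Shortlex lt) u v (fun h' => hv u h' h)
    (fun h' => hu v h' h.symm)

theorem asymm_of_wf {X : Type*} {r : X → X → Prop} (hwf : WellFounded r) {a b : X} (h : r a b) :
    ¬ r b a := hwf.asymmetric a b h

/-- A cycle of length three would have no minimal element, so transitivity need not be assumed for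
the order of the letters. -/
theorem trans_of_wf {X : Type*} {r : X → X → Prop} (hwf : WellFounded r) [Std.Trichotomous r]
    {a b c : X} (h : r a b) (h' : r b c) : r a c := by
  by_contra hac
  by_cases hca : r c a
  · obtain ⟨m, hm, hmin⟩ := hwf.has_min {a, b, c} ⟨a, by simp⟩
    rcases hm with rfl | rfl | rfl
    · exact hmin c (by simp) hca
    · exact hmin a (by simp) h
    · exact hmin b (by simp) h'
  · obtain rfl := Std.Trichotomous.trichotomous (r := r) a c hac hca
    exact asymm_of_wf hwf h h'

theorem nodup_of_pairwise_wf {X : Type*} {r : X → X → Prop} (hwf : WellFounded r) {l : List X}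
    (h : l.Pairwise r) : l.Nodup :=
  List.Pairwise.imp (fun {a b} (hab : r a b) (e : a = b) =>
    asymm_of_wf hwf hab (by subst e; exact hab)) h

theorem IsRepList.unique (hwf : WellFounded lt) {R R' : List (List L)}
    (h : IsRepList lt 𝓛 R) (h' : IsRepList lt 𝓛 R') : R = R' := by
  have hw := List.Shortlex.wf hwf
  refine List.Perm.eq_of_pairwise (fun a b _ _ h1 h2 => absurd h2 (asymm_of_wf hw h1)) h.1 h'.1 ?_
  rw [List.perm_ext_iff_of_nodup (nodup_of_pairwise_wf hw h.1)
    (nodup_of_pairwise_wf hw h'.1)]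
  exact fun u => (h.2 u).trans (h'.2 u).symm

open Classical in
/-- The automaton whose states are (the positions of) the words in `R`. -/
noncomputable def repFA (𝓛 : Set (List L)) (R : List (List L)) (A : Finset L) : FA L where
  states := Finset.range R.length
  init := (Finset.range R.length).filter fun i => i = 0
  final := (Finset.range R.length).filter fun i => R.getD i [] ∈ 𝓛
  trans := (Finset.range R.length ×ˢ (A ×ˢ Finset.range R.length)).filter fun t =>
    Ner 𝓛 (R.getD t.1 [] ++ [t.2.1]) (R.getD t.2.2 [])
  init_subset := Finset.filter_subset _ _
  final_subset := Finset.filter_subset _ _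
  trans_mem := by
    intro q a q' h
    simp only [Finset.mem_filter, Finset.mem_product] at h
    exact ⟨h.1.1, h.1.2.2⟩

open Classical in
/-- The minimal automaton of a language over an alphabet, with normalized numbering. -/
noncomputable def minFA (lt : L → L → Prop) (𝓛 : Set (List L)) (A : Finset L) : FA L :=
  repFA 𝓛 (if h : ∃ R, IsRepList lt 𝓛 R then h.choose else [[]]) A

theorem minFA_eq (hwf : WellFounded lt) {R : List (List L)} (h : IsRepList lt 𝓛 R)
    (A : Finset L) : minFA lt 𝓛 A = repFA 𝓛 R A := by
  have he : ∃ R, IsRepList lt 𝓛 R := ⟨R, h⟩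
  rw [minFA, dif_pos he, he.choose_spec.unique hwf h]

/-- The list of first words does not involve the alphabet, which only filters the transitions; two
such filters commute. -/
theorem minFA_restrict (A A' : Finset L) :
    (minFA lt 𝓛 A).restrict A' = (minFA lt 𝓛 A').restrict A := by
  ext
  · rfl
  · rfl
  · rfl
  · simp only [FA.restrict, minFA, repFA, Finset.mem_filter, Finset.mem_product, Finset.mem_coe]
    tauto

section repFA

variable {R : List (List L)} {A : Finset L}

theorem mem_repFA_trans {i j : ℕ} {a : L} : (i, a, j) ∈ (repFA 𝓛 R A).trans ↔
    i < R.length ∧ a ∈ A ∧ j < R.length ∧ Ner 𝓛 (R.getD i [] ++ [a]) (R.getD j []) := by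
  simp [repFA, and_assoc]

theorem IsRepList.getD_zero (h : IsRepList lt 𝓛 R) :
    0 < R.length ∧ R.getD 0 [] = [] := by
  have h0 := (h.2 []).2 minRep_nil
  cases R with
  | nil => simp at h0
  | cons a R =>
    refine ⟨by simp, ?_⟩
    rcases List.mem_cons.1 h0 with h0 | h0
    · simp [← h0]
    · exact absurd (List.rel_of_pairwise_cons h.1 h0) List.not_shortlex_nil_right

theorem IsRepList.minRep_getD (h : IsRepList lt 𝓛 R) {i : ℕ} (hi : i < R.length) :
    MinRep lt 𝓛 (R.getD i []) := by
  rw [List.getD_eq_getElem _ _ hi]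
  exact (h.2 _).1 (List.getElem_mem hi)

theorem IsRepList.lt_iff (hwf : WellFounded lt) (h : IsRepList lt 𝓛 R) {i j : ℕ}
    (hi : i < R.length) (hj : j < R.length) :
    Shortlex lt (R.getD i []) (R.getD j []) ↔ i < j := by
  have hw := List.Shortlex.wf hwf
  have key := List.pairwise_iff_getElem.1 h.1
  rw [List.getD_eq_getElem _ _ hi, List.getD_eq_getElem _ _ hj]
  refine ⟨fun hs => ?_, key i j hi hj⟩
  by_contra hij
  rcases (not_lt.1 hij).lt_or_eq with h' | rfl
  · exact asymm_of_wf hw hs (key j i hj hi h')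
  · exact asymm_of_wf hw hs hs

theorem IsRepList.eq_of_ner [Std.Trichotomous lt] (hwf : WellFounded lt)
    (h : IsRepList lt 𝓛 R) {i j : ℕ} (hi : i < R.length) (hj : j < R.length)
    (hn : Ner 𝓛 (R.getD i []) (R.getD j [])) : i = j := by
  have e := (h.minRep_getD hi).eq (h.minRep_getD hj) hn
  have h1 := h.lt_iff hwf hi hj
  have h2 := h.lt_iff hwf hj hi
  have hw := List.Shortlex.wf hwf
  rw [e] at h1 h2
  have h3 : ¬ Shortlex lt (R.getD j []) (R.getD j []) := fun h => asymm_of_wf hw h h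
  rw [iff_false_left h3] at h1 h2
  omega

theorem IsRepList.exists_ner (hwf : WellFounded lt) (h : IsRepList lt 𝓛 R) (u : List L) :
    ∃ i < R.length, Ner 𝓛 u (R.getD i []) := by
  obtain ⟨m, hm, hn, -⟩ := exists_minRep (𝓛 := 𝓛) hwf u
  obtain ⟨i, hi, rfl⟩ := List.getElem_of_mem ((h.2 m).2 hm)
  exact ⟨i, hi, by rw [List.getD_eq_getElem _ _ hi]; exact hn.symm⟩

theorem repFA_reaches [Std.Trichotomous lt] (hwf : WellFounded lt)
    (h : IsRepList lt 𝓛 R) (s : List L) : ∀ {i j : ℕ}, i < R.length → j < R.length →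
    ((repFA 𝓛 R A).Reaches s i j ↔ (∀ a ∈ s, a ∈ A) ∧
      Ner 𝓛 (R.getD i [] ++ s) (R.getD j [])) := by
  induction s with
  | nil =>
    intro i j hi hj
    simp only [FA.Reaches, List.append_nil, List.not_mem_nil, false_imp_iff, implies_true, true_and]
    exact ⟨fun e => e ▸ Ner.refl _, fun hn => h.eq_of_ner hwf hi hj hn⟩
  | cons a s ih =>
    intro i j hi hj
    rw [FA.Reaches]
    constructor
    · rintro ⟨r, hr, hs⟩
      rw [mem_repFA_trans] at hr
      obtain ⟨h1, h2⟩ := (ih hr.2.2.1 hj).1 hs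
      refine ⟨by simpa [hr.2.1] using h1, ?_⟩
      simpa using (hr.2.2.2.append s).trans h2
    · rintro ⟨h1, h2⟩
      obtain ⟨r, hr, hn⟩ := h.exists_ner hwf (R.getD i [] ++ [a])
      refine ⟨r, mem_repFA_trans.2 ⟨hi, h1 a (by simp), hr, hn⟩, (ih hr hj).2
        ⟨fun b hb => h1 b (by simp [hb]), ?_⟩⟩
      exact (hn.symm.append s).trans (by simpa using h2)

theorem repFA_reachesFromInit [Std.Trichotomous lt] (hwf : WellFounded lt)
    (h : IsRepList lt 𝓛 R) {s : List L} {j : ℕ} (hj : j < R.length) :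
    (repFA 𝓛 R A).ReachesFromInit s j ↔ (∀ a ∈ s, a ∈ A) ∧ Ner 𝓛 s (R.getD j []) := by
  obtain ⟨h0, h1⟩ := h.getD_zero
  have := repFA_reaches (A := A) hwf h s h0 hj
  rw [h1, List.nil_append] at this
  rw [← this]
  simp only [FA.ReachesFromInit, repFA, Finset.mem_filter, Finset.mem_range]
  exact ⟨fun ⟨q, hq, h⟩ => hq.2 ▸ h, fun h => ⟨0, ⟨h0, rfl⟩, h⟩⟩

theorem repFA_lang [Std.Trichotomous lt] (hwf : WellFounded lt)
    (h : IsRepList lt 𝓛 R) : (repFA 𝓛 R A).lang = {s | s ∈ 𝓛 ∧ ∀ a ∈ s, a ∈ A} := by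
  ext s
  constructor
  · rintro ⟨q, hq, q', hq', hr⟩
    have hj : q' < R.length := Finset.mem_range.1 ((repFA 𝓛 R A).final_subset hq')
    obtain ⟨h1, h2⟩ := (repFA_reachesFromInit hwf h hj).1 ⟨q, hq, hr⟩
    refine ⟨h2.mem_iff.2 ?_, h1⟩
    simp only [repFA, Finset.mem_filter] at hq'
    exact hq'.2
  · rintro ⟨h1, h2⟩
    obtain ⟨j, hj, hn⟩ := h.exists_ner hwf s
    obtain ⟨q, hq, hr⟩ := (repFA_reachesFromInit (A := A) hwf h hj).2 ⟨h2, hn⟩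
    refine ⟨q, hq, j, ?_, hr⟩
    simp only [repFA, Finset.mem_filter]
    exact ⟨by simpa using hj, hn.mem_iff.1 h1⟩

theorem repFA_isDeterministic [Std.Trichotomous lt] (hwf : WellFounded lt)
    (h : IsRepList lt 𝓛 R) : (repFA 𝓛 R A).IsDeterministic := by
  obtain ⟨h0, -⟩ := h.getD_zero
  refine ⟨Finset.card_eq_one.2 ⟨0, ?_⟩, fun q a r r' hr hr' => ?_⟩
  · ext i
    simp only [repFA, Finset.mem_filter, Finset.mem_range, Finset.mem_singleton]
    exact ⟨fun h => h.2, fun h => ⟨h ▸ h0, h⟩⟩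
  · rw [mem_repFA_trans] at hr hr'
    exact h.eq_of_ner hwf hr.2.2.1 hr'.2.2.1 (hr.2.2.2.symm.trans hr'.2.2.2)

theorem repFA_isComplete [Std.Trichotomous lt] (hwf : WellFounded lt)
    (h : IsRepList lt 𝓛 R) : (repFA 𝓛 R A).IsComplete A := by
  obtain ⟨h0, -⟩ := h.getD_zero
  refine ⟨⟨0, Finset.mem_filter.2 ⟨by simpa using h0, rfl⟩⟩, fun q hq a ha => ?_⟩
  obtain ⟨j, hj, hn⟩ := h.exists_ner hwf (R.getD q [] ++ [a])
  exact ⟨j, by simpa [repFA] using hj, mem_repFA_trans.2 ⟨by simpa [repFA] using hq, ha, hj, hn⟩⟩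

/-- If first words use only letters of `A`, the automaton can read them, and the first word of a
class is also the first one to reach its state. Without this condition a class might be unreachable
or be reached first by a larger word. -/
theorem repFA_isNormalized [Std.Trichotomous lt] (hwf : WellFounded lt)
    (h : IsRepList lt 𝓛 R) (hA : ∀ u, MinRep lt 𝓛 u → ∀ a ∈ u, a ∈ A) :
    (repFA 𝓛 R A).IsNormalized lt := by
  have hrep : ∀ j < R.length, (repFA 𝓛 R A).ReachesFromInit (R.getD j []) j := fun j hj =>
    (repFA_reachesFromInit hwf h hj).2 ⟨hA _ (h.minRep_getD hj), Ner.refl _⟩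
  have hfirst : ∀ j < R.length, ∀ s, (repFA 𝓛 R A).IsLexFirst lt j s → s = R.getD j [] := by
    rintro j hj s ⟨h1, h2⟩
    have hn := ((repFA_reachesFromInit hwf h hj).1 h1).2
    exact Std.Trichotomous.trichotomous (r := Shortlex lt) _ _
      (fun h' => h.minRep_getD hj s h' hn) (h2 _ (hrep j hj))
  refine ⟨⟨R.length, (h.getD_zero).1, rfl⟩, fun q hq => ⟨_, hrep q (by simpa [repFA] using hq)⟩,
    fun q hq q' hq' s s' hs hs' => ?_⟩
  have hq : q < R.length := by simpa [repFA] using hq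
  have hq' : q' < R.length := by simpa [repFA] using hq'
  rw [hfirst q hq s hs, hfirst q' hq' s' hs', h.lt_iff hwf hq hq']

end repFA

/-! ### Enumeration of the first words -/

/-- The one-letter extensions of the words in `R`. -/
def extensions (A : List L) (R : List (List L)) : List (List L) :=
  R.flatMap fun u => A.map fun a => u ++ [a]

/-- Append the first one-letter extension of the given words that is inequivalent to them all. -/
noncomputable def addRep (𝓛 : Set (List L)) (A : List L) (R : List (List L)) : List (List L) :=
  R ++ (lfilter (extensions A R) fun v => ∀ r ∈ R, ¬ Ner 𝓛 v r).take 1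

/-- `R` lists an initial segment of the first words. -/
def IsRepPrefix (lt : L → L → Prop) (𝓛 : Set (List L)) (R : List (List L)) : Prop :=
  R.Pairwise (Shortlex lt) ∧ (∀ u ∈ R, MinRep lt 𝓛 u) ∧ [] ∈ R ∧
    ∀ u ∈ R, ∀ v, MinRep lt 𝓛 v → Shortlex lt v u → v ∈ R

variable {A : List L} {R : List (List L)}

theorem pairwise_extensions (hA : A.Pairwise lt) (hR : R.Pairwise (Shortlex lt)) :
    (extensions A R).Pairwise (Shortlex lt) := by
  refine List.pairwise_flatMap.2 ⟨fun u _ => List.pairwise_map.2 (hA.imp fun hab => ?_),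
    hR.imp fun huv x hx y hy => ?_⟩
  · exact Shortlex.append_left (List.shortlex_singleton_iff _ _ |>.2 hab) u
  · obtain ⟨a, -, rfl⟩ := List.mem_map.1 hx
    obtain ⟨b, -, rfl⟩ := List.mem_map.1 hy
    exact shortlex_snoc huv a b

/-- Let `u` be the least missing first word. Its longest proper prefix is a smaller first word and
thus in `R`, so `u` is among the candidates. A smaller candidate would be equivalent to a first word
below `u`, hence to a word of `R`, which the filter excludes. As the candidates are sorted, the one
appended is `u`. -/
theorem IsRepPrefix.addRep [Std.Trichotomous lt] (hwf : WellFounded lt) (hA : A.Pairwise lt)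
    (hA' : ∀ u, MinRep lt 𝓛 u → ∀ a ∈ u, a ∈ A) (h : IsRepPrefix lt 𝓛 R) :
    IsRepList lt 𝓛 R ∧ addRep 𝓛 A R = R ∨
      IsRepPrefix lt 𝓛 (addRep 𝓛 A R) ∧ (addRep 𝓛 A R).length = R.length + 1 := by
  have hw := List.Shortlex.wf hwf
  obtain ⟨h1, h2, h3, h4⟩ := h
  by_cases hall : ∀ u, MinRep lt 𝓛 u → u ∈ R
  · refine .inl ⟨⟨h1, fun u => ⟨h2 u, hall u⟩⟩, ?_⟩
    have : (lfilter (extensions A R) fun v => ∀ r ∈ R, ¬ Ner 𝓛 v r) = [] := by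
      rw [List.eq_nil_iff_forall_not_mem]
      intro v hv
      obtain ⟨m, hm, hn, -⟩ := exists_minRep (𝓛 := 𝓛) hwf v
      exact (mem_lfilter.1 hv).2 m (hall m hm) hn.symm
    simp [SecondOrder.addRep, this]
  · right
    push Not at hall
    obtain ⟨u, ⟨hu, huR⟩, hmin⟩ := hw.has_min {u | MinRep lt 𝓛 u ∧ u ∉ R} hall
    have hmin' : ∀ m, MinRep lt 𝓛 m → Shortlex lt m u → m ∈ R := by
      intro m hm hlt
      by_contra hmR
      exact hmin m ⟨hm, hmR⟩ hlt
    have hnew : ∀ r ∈ R, ¬ Ner 𝓛 u r := fun r hr hn => huR (hu.eq (h2 r hr) hn ▸ hr)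
    have hmem : u ∈ lfilter (extensions A R) fun v => ∀ r ∈ R, ¬ Ner 𝓛 v r := by
      refine mem_lfilter.2 ⟨?_, hnew⟩
      rcases List.eq_nil_or_concat' u with rfl | ⟨u', a, rfl⟩
      · exact absurd h3 huR
      · have := hmin' u' hu.of_snoc (.of_length_lt (by simp))
        exact List.mem_flatMap.2 ⟨u', this, List.mem_map.2 ⟨a, hA' _ hu a (by simp), rfl⟩⟩
    have hsorted : (lfilter (extensions A R) fun v => ∀ r ∈ R, ¬ Ner 𝓛 v r).Pairwise
        (Shortlex lt) := (pairwise_extensions hA h1).sublist (lfilter_sublist _ _)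
    have hadd : SecondOrder.addRep 𝓛 A R = R ++ [u] := by
      rw [SecondOrder.addRep]
      congr 1
      cases hl : lfilter (extensions A R) fun v => ∀ r ∈ R, ¬ Ner 𝓛 v r with
      | nil => rw [hl] at hmem; simp at hmem
      | cons v l =>
        rw [hl] at hmem hsorted
        have hv : v ∈ lfilter (extensions A R) fun v => ∀ r ∈ R, ¬ Ner 𝓛 v r := by simp [hl]
        rcases List.mem_cons.1 hmem with rfl | hmem
        · simp
        · have hvu := List.rel_of_pairwise_cons hsorted hmem
          obtain ⟨m, hm, hn, hvm⟩ := exists_minRep (𝓛 := 𝓛) hwf v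
          have hmu : Shortlex lt m u := by
            by_cases hmv : Shortlex lt m v
            · exact trans_of_wf hw hmv hvu
            · rw [Std.Trichotomous.trichotomous (r := Shortlex lt) m v hmv hvm]; exact hvu
          exact absurd hn.symm ((mem_lfilter.1 hv).2 m (hmin' m hm hmu))
    rw [hadd]
    refine ⟨⟨?_, ?_, by simp [h3], ?_⟩, by simp⟩
    · refine List.pairwise_append.2 ⟨h1, by simp, fun r hr v hv => ?_⟩
      obtain rfl : v = u := by simpa using hv
      by_contra hlt
      by_cases hvr : Shortlex lt v r
      · exact huR (h4 r hr v hu hvr)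
      · exact huR (Std.Trichotomous.trichotomous (r := Shortlex lt) r v hlt hvr ▸ hr)
    · intro v hv
      rcases List.mem_append.1 hv with hv | hv
      · exact h2 v hv
      · obtain rfl : v = u := by simpa using hv
        exact hu
    · intro v hv x hx hxv
      refine List.mem_append_left _ ?_
      rcases List.mem_append.1 hv with hv | hv
      · exact h4 v hv x hx hxv
      · obtain rfl : v = u := by simpa using hv
        exact hmin' x hx hxv

theorem isRepPrefix_nil : IsRepPrefix lt 𝓛 [[]] := by
  refine ⟨by simp, by simpa using minRep_nil, by simp, ?_⟩
  rintro u hu v - h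
  obtain rfl : u = [] := by simpa using hu
  exact absurd h List.not_shortlex_nil_right

/-- As long as the list is incomplete each round adds a word; `K` such rounds would yield `K + 1`
pairwise inequivalent words. -/
theorem isRepList_iterate_addRep [Std.Trichotomous lt] (hwf : WellFounded lt)
    (hA : A.Pairwise lt) (hA' : ∀ u, MinRep lt 𝓛 u → ∀ a ∈ u, a ∈ A) {K : ℕ}
    (hK : ∀ R : List (List L), R.Pairwise (fun u v => ¬ Ner 𝓛 u v) →
      (∀ u ∈ R, ∀ a ∈ u, a ∈ A) → R.length ≤ K) :
    IsRepList lt 𝓛 ((addRep 𝓛 A)^[K] [[]]) := by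
  have key : ∀ k, IsRepList lt 𝓛 ((SecondOrder.addRep 𝓛 A)^[k] [[]]) ∨
      IsRepPrefix lt 𝓛 ((SecondOrder.addRep 𝓛 A)^[k] [[]]) ∧
        ((SecondOrder.addRep 𝓛 A)^[k] [[]]).length = k + 1 := by
    intro k
    induction k with
    | zero => exact .inr ⟨isRepPrefix_nil, rfl⟩
    | succ k ih =>
      rw [Function.iterate_succ_apply']
      rcases ih with ih | ⟨ih, hl⟩
      · have hp : IsRepPrefix lt 𝓛 ((SecondOrder.addRep 𝓛 A)^[k] [[]]) :=
          ⟨ih.1, fun u => (ih.2 u).1, (ih.2 _).2 minRep_nil, fun _ _ v hv _ => (ih.2 v).2 hv⟩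
        rcases hp.addRep hwf hA hA' with h | h
        · exact .inl (by rw [h.2]; exact h.1)
        · exfalso
          obtain ⟨⟨h1, h2, -⟩, hl⟩ := h
          have hw := List.Shortlex.wf hwf
          have := ((nodup_of_pairwise_wf hw h1).subperm fun u hu => (ih.2 u).2 (h2 u hu)).length_le
          omega
      · rcases ih.addRep hwf hA hA' with h | h
        · exact .inl (by rw [h.2]; exact h.1)
        · exact .inr ⟨h.1, by rw [h.2, hl]⟩
  rcases key K with h | ⟨h, hl⟩
  · exact h
  · have := hK _ (h.1.imp_of_mem fun {u v} hu hv huv hn => ?_)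
      (fun u hu => hA' u (h.2.1 u hu))
    · omega
    · exact h.2.1 v hv u huv hn

end minimal

end SecondOrder

namespace SecondOrder

/-! ### Bit descriptions of layers -/

/-- A layer described by its bits at a given width. -/
abbrev Code := ℕ × List Bool

/-- The `i`-th bit is set. -/
def bit (v : List Bool) (i : ℕ) : Prop := exIn ((v.drop i).take 1) fun b => b = true

theorem bit_iff {v : List Bool} {i : ℕ} : bit v i ↔ v[i]? = some true := by
  simp [bit, exIn, List.take_one, List.head?_drop]

/-- The length of the description of a layer of width `u` over `s` letters. -/
def codeLen (s u : ℕ) : ℕ := u + u + u * (s * u) + u + u + 2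

namespace Code

def L (c : Code) (p : ℕ) : Prop := p < c.1 ∧ bit c.2 p
def R (c : Code) (q : ℕ) : Prop := q < c.1 ∧ bit c.2 (c.1 + q)
def T (s : ℕ) (c : Code) (p a q : ℕ) : Prop :=
  (p < c.1 ∧ a < s ∧ q < c.1) ∧ bit c.2 (c.1 + c.1 + (p * (s * c.1) + (a * c.1 + q)))
def I (s : ℕ) (c : Code) (p : ℕ) : Prop :=
  p < c.1 ∧ bit c.2 (c.1 + c.1 + c.1 * (s * c.1) + p)
def F (s : ℕ) (c : Code) (q : ℕ) : Prop :=
  q < c.1 ∧ bit c.2 (c.1 + c.1 + c.1 * (s * c.1) + c.1 + q)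
def iFlag (s : ℕ) (c : Code) : Prop := bit c.2 (c.1 + c.1 + c.1 * (s * c.1) + c.1 + c.1)
def fFlag (s : ℕ) (c : Code) : Prop := bit c.2 (c.1 + c.1 + c.1 * (s * c.1) + c.1 + c.1 + 1)

/-- The code describes a layer whose width is the width of the code. -/
def Valid (s : ℕ) (c : Code) : Prop :=
  (allIn (List.range c.1) fun p => allIn (List.range s) fun a => allIn (List.range c.1) fun q =>
    ¬ c.T s p a q ∨ (c.L p ∧ c.R q)) ∧
  (allIn (List.range c.1) fun p => (¬ c.I s p ∨ (c.L p ∧ c.iFlag s)) ∧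
    (¬ c.F s p ∨ (c.R p ∧ c.fFlag s))) ∧
  (c.1 = 0 ∨ exIn (List.range c.1) fun p => p + 1 = c.1 ∧ (c.L p ∨ c.R p))

end Code

theorem length_flatMap_const {β γ : Type*} {f : β → List γ} {m : ℕ} (l : List β)
    (h : ∀ x ∈ l, (f x).length = m) : (l.flatMap f).length = l.length * m := by
  induction l with
  | nil => simp
  | cons a l ih =>
    rw [List.flatMap_cons, List.length_append, h a (by simp), ih fun x hx => h x (by simp [hx])]
    simp; ring

theorem getElem?_flatMap_const {β γ : Type*} {f : β → List γ} {m : ℕ} (l : List β)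
    (h : ∀ x, (f x).length = m) : ∀ (i j : ℕ), j < m →
      (l.flatMap f)[i * m + j]? = l[i]?.bind fun x => (f x)[j]? := by
  induction l with
  | nil => simp
  | cons a l ih =>
    intro i j hj
    rw [List.flatMap_cons]
    cases i with
    | zero => rw [List.getElem?_append_left (by rw [h]; omega)]; simp
    | succ i =>
      rw [List.getElem?_append_right (by rw [h, add_mul]; omega), h]
      have : (i + 1) * m + j - m = i * m + j := by rw [add_mul]; omega
      rw [this, ih i j hj]; simp

/-- Codes of the same width with the same components are equal. -/
theorem code_ext {s u : ℕ} {v v' : List Bool} (hv : v.length = codeLen s u)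
    (hv' : v'.length = codeLen s u) (hL : ∀ p, Code.L (u, v) p ↔ Code.L (u, v') p)
    (hR : ∀ p, Code.R (u, v) p ↔ Code.R (u, v') p)
    (hT : ∀ p a q, Code.T s (u, v) p a q ↔ Code.T s (u, v') p a q)
    (hI : ∀ p, Code.I s (u, v) p ↔ Code.I s (u, v') p)
    (hF : ∀ p, Code.F s (u, v) p ↔ Code.F s (u, v') p)
    (hi : Code.iFlag s (u, v) ↔ Code.iFlag s (u, v'))
    (hf : Code.fFlag s (u, v) ↔ Code.fFlag s (u, v')) : v = v' := by
  have key : ∀ i < codeLen s u, (bit v i ↔ bit v' i) := by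
    intro i hi'
    have hcl : codeLen s u = u + u + u * (s * u) + u + u + 2 := rfl
    by_cases h1 : i < u
    · simpa [Code.L, h1] using hL i
    obtain ⟨i, rfl⟩ := Nat.exists_eq_add_of_le (not_lt.1 h1)
    by_cases h2 : i < u
    · simpa [Code.R, h2] using hR i
    obtain ⟨i, rfl⟩ := Nat.exists_eq_add_of_le (not_lt.1 h2)
    by_cases h3 : i < u * (s * u)
    · have hu : 0 < u := Nat.pos_of_ne_zero (by rintro rfl; simp at h3)
      have hsu : 0 < s * u := Nat.pos_of_ne_zero (by intro h; simp [h] at h3)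
      -- Positions in the transition table are read in mixed radix, `i = p * (s * u) + (a * u + q)`.
      have := hT (i / (s * u)) (i % (s * u) / u) (i % (s * u) % u)
      have e : i / (s * u) * (s * u) + (i % (s * u) / u * u + i % (s * u) % u) = i := by
        rw [Nat.div_add_mod' (i % (s * u)) u, Nat.div_add_mod' i (s * u)]
      have b1 : i / (s * u) < u := Nat.div_lt_of_lt_mul (by rwa [mul_comm])
      have b2 : i % (s * u) / u < s :=
        Nat.div_lt_of_lt_mul (by rw [mul_comm u s]; exact Nat.mod_lt _ hsu)
      have b3 : i % (s * u) % u < u := Nat.mod_lt _ hu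
      simp only [Code.T, e, b1, b2, b3, and_self, true_and] at this
      rwa [← add_assoc]
    obtain ⟨i, rfl⟩ := Nat.exists_eq_add_of_le (not_lt.1 h3)
    by_cases h4 : i < u
    · simpa [Code.I, h4, add_assoc] using hI i
    obtain ⟨i, rfl⟩ := Nat.exists_eq_add_of_le (not_lt.1 h4)
    by_cases h5 : i < u
    · simpa [Code.F, h5, add_assoc] using hF i
    obtain ⟨i, rfl⟩ := Nat.exists_eq_add_of_le (not_lt.1 h5)
    have h6 : i = 0 ∨ i = 1 := by omega
    rcases h6 with rfl | rfl
    · simpa [Code.iFlag, add_assoc] using hi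
    · simpa [Code.fFlag, add_assoc] using hf
  refine List.ext_getElem (by rw [hv, hv']) fun i h h' => ?_
  have := key i (by omega)
  rw [bit_iff, bit_iff, List.getElem?_eq_getElem h, List.getElem?_eq_getElem h'] at this
  rw [Bool.eq_iff_iff]
  simpa using this

section layers

variable {α : Type*}

theorem mem_layerAlphabet_width (B : Layer α) : B ∈ layerAlphabet α B.width := by
  constructor <;> intro p hp <;> rw [Finset.mem_range, Layer.width] <;>
    exact Nat.lt_of_succ_le (Finset.le_sup (f := Nat.succ) (by simp [hp]))

theorem width_le_iff {w : ℕ} {B : Layer α} : B.width ≤ w ↔ B ∈ layerAlphabet α w := by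
  constructor
  · intro h
    obtain ⟨h1, h2⟩ := mem_layerAlphabet_width B
    exact ⟨h1.trans (Finset.range_mono h), h2.trans (Finset.range_mono h)⟩
  · rintro ⟨h1, h2⟩
    refine Finset.sup_le fun p hp => ?_
    rcases Finset.mem_union.1 hp with hp | hp
    · simpa using h1 hp
    · simpa using h2 hp

variable [LinearOrder α] [Fintype α]

/-- `a` is the `i`-th letter. -/
def IsLetter (i : ℕ) (a : α) : Prop := (Finset.univ : Finset α).sort[i]? = some a

theorem IsLetter.lt {i : ℕ} {a : α} (h : IsLetter i a) : i < Fintype.card α := by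
  have := (List.getElem?_eq_some_iff.1 h).1
  simpa using this

theorem exists_isLetter (a : α) : ∃ i, IsLetter i a :=
  List.getElem?_of_mem ((Finset.mem_sort (s := Finset.univ) (· ≤ ·)).2 (Finset.mem_univ a))

theorem exists_letter {i : ℕ} (h : i < Fintype.card α) : ∃ a : α, IsLetter i a := by
  have hi : i < (Finset.univ : Finset α).sort.length := by simpa using h
  exact ⟨_, List.getElem?_eq_getElem hi⟩

theorem IsLetter.unique {i : ℕ} {a b : α} (h : IsLetter i a) (h' : IsLetter i b) : a = b := by
  rw [IsLetter] at h h'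
  simpa [h] using h'

theorem IsLetter.lt_iff {i j : ℕ} {a b : α} (h : IsLetter i a) (h' : IsLetter j b) :
    i < j ↔ a < b := by
  obtain ⟨hi, rfl⟩ := List.getElem?_eq_some_iff.1 h
  obtain ⟨hj, rfl⟩ := List.getElem?_eq_some_iff.1 h'
  exact ((Finset.sortedLT_sort (Finset.univ : Finset α)).strictMono_get.lt_iff_lt
    (a := ⟨i, hi⟩) (b := ⟨j, hj⟩)).symm

theorem IsLetter.inj {i j : ℕ} {a : α} (h : IsLetter i a) (h' : IsLetter j a) : i = j := by
  have h1 := h.lt_iff h'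
  have h2 := h'.lt_iff h
  simp only [lt_self_iff_false, iff_false] at h1 h2
  omega

theorem length_bits (u : ℕ) (B : Layer α) : (B.bits u).length = codeLen (Fintype.card α) u := by
  have h : ∀ p ∈ List.range u, ((Finset.univ : Finset α).sort.flatMap (fun a =>
      (List.range u).map (fun q => decide ((p, a, q) ∈ B.trans)))).length =
      Fintype.card α * u := by
    intro p _
    rw [length_flatMap_const (m := u) _ (by simp)]; simp
  simp only [Layer.bits, List.length_append, List.length_map, List.length_range,
    length_flatMap_const _ h, codeLen, List.length_cons, List.length_nil]

/-- The code `c` describes the layer `B`. -/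
def Codes (c : Code) (B : Layer α) : Prop := B ∈ layerAlphabet α c.1 ∧ c.2 = B.bits c.1

section codes

variable {u : ℕ} {B : Layer α}

theorem bits_getElem?_trans {p i q : ℕ} {a : α} (hp : p < u) (ha : IsLetter i a) (hq : q < u) :
    ((List.range u).flatMap (fun p => (Finset.univ : Finset α).sort.flatMap (fun a =>
      (List.range u).map (fun q => decide ((p, a, q) ∈ B.trans)))))[
        p * (Fintype.card α * u) + (i * u + q)]? = some (decide ((p, a, q) ∈ B.trans)) := by
  have hlt : i * u + q < Fintype.card α * u := by
    have : (i + 1) * u ≤ Fintype.card α * u := Nat.mul_le_mul_right _ ha.lt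
    rw [add_mul] at this; omega
  rw [getElem?_flatMap_const (m := Fintype.card α * u) _ (fun p => by
    rw [length_flatMap_const (m := u) _ (by simp)]; simp) p _ hlt, List.getElem?_range hp]
  simp only [Option.bind_some]
  rw [getElem?_flatMap_const (m := u) _ (by simp) i q hq, ha]
  simp [hq]

/-- The dictionary between the predicates evaluated by programs and the components of layers.
Letters appear in codes as their positions in the sorted alphabet. -/
theorem codes_iff {c : Code} (h : Codes c B) :
    (∀ p, c.L p ↔ p ∈ B.left) ∧ (∀ p, c.R p ↔ p ∈ B.right) ∧
    (∀ p i q, c.T (Fintype.card α) p i q ↔ ∃ a, IsLetter i a ∧ (p, a, q) ∈ B.trans) ∧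
    (∀ p, c.I (Fintype.card α) p ↔ p ∈ B.init) ∧ (∀ p, c.F (Fintype.card α) p ↔ p ∈ B.final) ∧
    (c.iFlag (Fintype.card α) ↔ B.initFlag = true) ∧
    (c.fFlag (Fintype.card α) ↔ B.finalFlag = true) := by
  obtain ⟨u, v⟩ := c
  obtain ⟨⟨hl, hr⟩, hv⟩ := h
  dsimp only at hl hr hv
  subst hv
  have hlt : ∀ {p}, p ∈ B.left → p < u := fun h => by simpa using hl h
  have hrt : ∀ {p}, p ∈ B.right → p < u := fun h => by simpa using hr h
  set s := Fintype.card α with hs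
  set TT := (List.range u).flatMap (fun p => (Finset.univ : Finset α).sort.flatMap (fun a =>
      (List.range u).map (fun q => decide ((p, a, q) ∈ B.trans)))) with hTT
  have hTl : TT.length = u * (s * u) := by
    rw [hTT, length_flatMap_const (m := s * u)]
    · simp
    · intro p _
      rw [length_flatMap_const (m := u) _ (by simp)]; simp [hs]
  have hb : B.bits u = (List.range u).map (fun p => decide (p ∈ B.left)) ++
      ((List.range u).map (fun q => decide (q ∈ B.right)) ++ (TT ++
      ((List.range u).map (fun p => decide (p ∈ B.init)) ++
      ((List.range u).map (fun q => decide (q ∈ B.final)) ++ [B.initFlag, B.finalFlag])))) := by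
    simp [Layer.bits, hTT]
  have app : ∀ {l l' : List Bool} {m i : ℕ}, l.length = m → (l ++ l')[m + i]? = l'[i]? := by
    rintro l l' m i rfl
    rw [List.getElem?_append_right (by omega), Nat.add_sub_cancel_left]
  have rng : ∀ {f : ℕ → Bool} {l' : List Bool} {p : ℕ}, p < u →
      ((List.range u).map f ++ l')[p]? = some (f p) := by
    intro f l' p hp
    rw [List.getElem?_append_left (by simpa using hp), List.getElem?_map, List.getElem?_range hp]
    rfl
  refine ⟨fun p => ?_, fun p => ?_, fun p i q => ?_, fun p => ?_, fun p => ?_, ?_, ?_⟩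
  · simp only [Code.L, bit_iff]
    constructor
    · rintro ⟨hp, h⟩
      rw [hb, rng hp] at h; simpa using h
    · intro h
      exact ⟨hlt h, by rw [hb, rng (hlt h)]; simpa using h⟩
  · simp only [Code.R, bit_iff]
    constructor
    · rintro ⟨hp, h⟩
      rw [hb, app (by simp), rng hp] at h; simpa using h
    · intro h
      exact ⟨hrt h, by rw [hb, app (by simp), rng (hrt h)]; simpa using h⟩
  · have key : ∀ a, p < u → q < u → IsLetter i a →
        (B.bits u)[u + u + (p * (s * u) + (i * u + q))]? =
          some (decide ((p, a, q) ∈ B.trans)) := by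
      intro a hp hq ha
      rw [hb, add_assoc, app (by simp), app (by simp), List.getElem?_append_left,
        bits_getElem?_trans hp ha hq]
      rw [hTl]
      have h1 : (p + 1) * (s * u) ≤ u * (s * u) := Nat.mul_le_mul_right _ hp
      have h2 : (i + 1) * u ≤ s * u := Nat.mul_le_mul_right _ ha.lt
      rw [add_mul] at h1 h2; omega
    simp only [Code.T, bit_iff]
    constructor
    · rintro ⟨⟨hp, hi, hq⟩, h⟩
      obtain ⟨a, ha⟩ := exists_letter (α := α) hi
      rw [key a hp hq ha] at h
      exact ⟨a, ha, by simpa using h⟩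
    · rintro ⟨a, ha, h⟩
      have hp := hlt (B.trans_mem _ _ _ h).1
      have hq := hrt (B.trans_mem _ _ _ h).2
      exact ⟨⟨hp, ha.lt, hq⟩, by rw [key a hp hq ha]; simpa using h⟩
  · simp only [Code.I, bit_iff]
    have key : p < u → (B.bits u)[u + u + u * (s * u) + p]? = some (decide (p ∈ B.init)) := by
      intro hp
      rw [hb, add_assoc, add_assoc, app (by simp), app (by simp), app hTl, rng hp]
    constructor
    · rintro ⟨hp, h⟩
      rw [key hp] at h; simpa using h
    · intro h
      have hp := hlt (B.init_subset h)
      exact ⟨hp, by rw [key hp]; simpa using h⟩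
  · simp only [Code.F, bit_iff]
    have key : p < u → (B.bits u)[u + u + u * (s * u) + u + p]? =
        some (decide (p ∈ B.final)) := by
      intro hp
      rw [hb, add_assoc, add_assoc, add_assoc, app (by simp), app (by simp), app hTl,
        app (by simp), rng hp]
    constructor
    · rintro ⟨hp, h⟩
      rw [key hp] at h; simpa using h
    · intro h
      have hp := hrt (B.final_subset h)
      exact ⟨hp, by rw [key hp]; simpa using h⟩
  · simp only [Code.iFlag, bit_iff]
    have := app (l := (List.range u).map (fun q => decide (q ∈ B.final)))
      (l' := [B.initFlag, B.finalFlag]) (m := u) (i := 0) (by simp)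
    rw [add_zero] at this
    rw [hb, add_assoc, add_assoc, add_assoc, app (by simp), app (by simp), app hTl,
        app (by simp), this]
    simp
  · simp only [Code.fFlag, bit_iff]
    rw [hb, add_assoc, add_assoc, add_assoc, add_assoc, app (by simp), app (by simp), app hTl,
        app (by simp), app (by simp)]
    simp

theorem Codes.unique {c : Code} {B B' : Layer α} (h : Codes c B) (h' : Codes c B') : B = B' := by
  obtain ⟨h1, h2, h3, h4, h5, h6, h7⟩ := codes_iff h
  obtain ⟨h1', h2', h3', h4', h5', h6', h7'⟩ := codes_iff h'
  ext x
  · rw [← h1, h1']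
  · rw [← h2, h2']
  · obtain ⟨p, a, q⟩ := x
    obtain ⟨i, hi⟩ := exists_isLetter a
    have : ∀ B : Layer α, (p, a, q) ∈ B.trans ↔ ∃ a, IsLetter i a ∧ (p, a, q) ∈ B.trans :=
      fun B => ⟨fun h => ⟨a, hi, h⟩, fun ⟨b, hb, h⟩ => hi.unique hb ▸ h⟩
    rw [this B, this B', ← h3, h3']
  · rw [← h4, h4']
  · rw [← h5, h5']
  · rw [Bool.eq_iff_iff, ← h6, h6']
  · rw [Bool.eq_iff_iff, ← h7, h7']

/-- The code of a layer at its own width. -/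
def Layer.code (B : Layer α) : Code := (B.width, B.bits B.width)

theorem codes_code (B : Layer α) : Codes B.code B := ⟨mem_layerAlphabet_width B, rfl⟩

theorem code_injective : Function.Injective (Layer.code (α := α)) := fun B B' h =>
  (codes_code B).unique (h ▸ codes_code B')

/-- The length of a description determines the width. So the shortlex order compares widths first,
and the bits at a layer's own width determine the layer. -/
theorem codeLen_strictMono (s : ℕ) : StrictMono (codeLen s) := by
  intro u u' h
  have : u * (s * u) ≤ u' * (s * u') := Nat.mul_le_mul h.le (Nat.mul_le_mul_left _ h.le)
  simp only [codeLen]; omega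

theorem layer_lt_wf : WellFounded (Layer.Lt (α := α)) :=
  InvImage.wf (fun B : Layer α => B.bits B.width) (List.Shortlex.wf wellFounded_lt)

theorem bits_width_injective : Function.Injective fun B : Layer α => B.bits B.width := by
  intro B B' h
  have hl := congrArg List.length h
  simp only [length_bits] at hl
  have hw := (codeLen_strictMono _).injective hl
  exact code_injective (Prod.ext hw h)

instance : Std.Trichotomous (Layer.Lt (α := α)) :=
  ⟨fun _ _ h h' => bits_width_injective
    (Std.Trichotomous.trichotomous (r := List.Shortlex (· < ·)) _ _ h h')⟩

open Classical in
/-- The layer described by a valid code. -/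
theorem exists_layer_of_valid {c : Code} (hl : c.2.length = codeLen (Fintype.card α) c.1)
    (hv : c.Valid (Fintype.card α)) : ∃ B : Layer α, B.code = c := by
  obtain ⟨u, v⟩ := c
  obtain ⟨hT, hIF, hw⟩ := hv
  dsimp only at hl hT hIF hw
  simp only [allIn, exIn, List.mem_range] at hT hIF hw
  set s := Fintype.card α with hs
  let B : Layer α :=
    { left := (Finset.range u).filter fun p => Code.L (u, v) p
      right := (Finset.range u).filter fun p => Code.R (u, v) p
      trans := (Finset.range u ×ˢ (Finset.univ ×ˢ Finset.range u)).filter fun t =>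
        ∃ i, IsLetter i t.2.1 ∧ Code.T s (u, v) t.1 i t.2.2
      init := (Finset.range u).filter fun p => Code.I s (u, v) p
      final := (Finset.range u).filter fun p => Code.F s (u, v) p
      initFlag := toBool (Code.iFlag s (u, v))
      finalFlag := toBool (Code.fFlag s (u, v))
      trans_mem := by
        intro p a q h
        simp only [Finset.mem_filter, Finset.mem_product, Finset.mem_range] at h ⊢
        obtain ⟨⟨hp, -, hq⟩, i, hi, h⟩ := h
        rcases hT p hp i hi.lt q hq with h' | h'
        · exact absurd h h'
        · exact ⟨⟨hp, h'.1⟩, hq, h'.2⟩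
      init_subset := by
        intro p hp
        simp only [Finset.mem_filter, Finset.mem_range] at hp ⊢
        rcases (hIF p hp.1).1 with h | h
        · exact absurd hp.2 h
        · exact ⟨hp.1, h.1⟩
      final_subset := by
        intro p hp
        simp only [Finset.mem_filter, Finset.mem_range] at hp ⊢
        rcases (hIF p hp.1).2 with h | h
        · exact absurd hp.2 h
        · exact ⟨hp.1, h.1⟩
      init_eq_empty := by
        intro h
        refine Finset.filter_eq_empty_iff.2 fun p hp hI => ?_
        rcases (hIF p (Finset.mem_range.1 hp)).1 with h' | h'
        · exact h' hI
        · rw [← toBool_eq_true (p := Code.iFlag s (u, v)), h] at h'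
          simp at h'
      final_eq_empty := by
        intro h
        refine Finset.filter_eq_empty_iff.2 fun p hp hI => ?_
        rcases (hIF p (Finset.mem_range.1 hp)).2 with h' | h'
        · exact h' hI
        · rw [← toBool_eq_true (p := Code.fFlag s (u, v)), h] at h'
          simp at h' }
  have hB : B ∈ layerAlphabet α u := ⟨Finset.filter_subset _ _, Finset.filter_subset _ _⟩
  obtain ⟨h1, h2, h3, h4, h5, h6, h7⟩ := codes_iff (c := (u, B.bits u)) (B := B) ⟨hB, rfl⟩
  have hbits : B.bits u = v := by
    refine code_ext (length_bits u B) hl (fun p => ?_) (fun p => ?_) (fun p i q => ?_)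
      (fun p => ?_) (fun p => ?_) ?_ ?_
    · rw [h1]; simpa [B] using fun h => h.1
    · rw [h2]; simpa [B] using fun h => h.1
    · rw [h3]
      constructor
      · rintro ⟨a, ha, h⟩
        obtain ⟨-, j, hj, h⟩ := Finset.mem_filter.1 h
        rwa [ha.inj hj]
      · intro h
        obtain ⟨a, ha⟩ := exists_letter (α := α) h.1.2.1
        refine ⟨a, ha, Finset.mem_filter.2 ⟨?_, i, ha, h⟩⟩
        simpa using And.intro h.1.1 h.1.2.2
    · rw [h4, ← hs]; simpa [B] using fun h => h.1
    · rw [h5, ← hs]; simpa [B] using fun h => h.1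
    · rw [h6]; simp [B, hs]
    · rw [h7]; simp [B, hs]
  -- The last clause of validity says that the state `u - 1` occurs if `u ≠ 0`; without it a layer
  -- would have codes of several widths.
  have hwid : B.width = u := by
    refine le_antisymm (width_le_iff.2 hB) ?_
    rcases hw with rfl | ⟨p, hp, rfl, h⟩
    · exact Nat.zero_le _
    · refine Finset.le_sup (f := Nat.succ) (Finset.mem_union.2 ?_)
      rcases h with h | h
      · exact .inl (Finset.mem_filter.2 ⟨by simp, h⟩)
      · exact .inr (Finset.mem_filter.2 ⟨by simp, h⟩)
  exact ⟨B, by rw [Layer.code, hwid, hbits]⟩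

theorem valid_code (B : Layer α) : B.code.Valid (Fintype.card α) := by
  obtain ⟨h1, h2, h3, h4, h5, h6, h7⟩ := codes_iff (codes_code B)
  refine ⟨fun p _ i _ q _ => ?_, fun p _ => ⟨?_, ?_⟩, ?_⟩
  · beta_reduce
    rw [h1, h2, h3, ← imp_iff_not_or]
    rintro ⟨a, -, h⟩
    exact B.trans_mem _ _ _ h
  · rw [h4, h1, h6, ← imp_iff_not_or]
    intro h
    refine ⟨B.init_subset h, ?_⟩
    by_contra hf
    simp [B.init_eq_empty (by simpa using hf)] at h
  · rw [h5, h2, h7, ← imp_iff_not_or]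
    intro h
    refine ⟨B.final_subset h, ?_⟩
    by_contra hf
    simp [B.final_eq_empty (by simpa using hf)] at h
  · by_cases hw : B.width = 0
    · exact .inl hw
    · right
      have hne : (B.left ∪ B.right).Nonempty := by
        rw [Finset.nonempty_iff_ne_empty]
        intro h
        simp [Layer.width, h] at hw
      obtain ⟨p, hp, he⟩ := Finset.exists_mem_eq_sup _ hne Nat.succ
      refine ⟨p, List.mem_range.2 ?_, ?_, ?_⟩
      · show p < B.width
        rw [Layer.width, he]; omega
      · exact he.symm
      · rw [h1, h2]; exact Finset.mem_union.1 hp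

end codes

end layers

end SecondOrder

namespace SecondOrder

/-! ### Enumeration of products of lists -/

section gen

variable {δ : Type*}

/-- Prepend the words of `H` to the words of `acc`. -/
def genStep (H acc : List (List δ)) : List (List δ) := H.flatMap fun y => acc.map fun z => y ++ z

/-- All concatenations of words chosen from the given lists. -/
def gen (l : List (List (List δ))) : List (List δ) := l.foldr genStep [[]]

/-- `gen`, with all intermediate results truncated to length `K`. -/
def genK (K : ℕ) (l : List (List (List δ))) : List (List δ) :=
  l.reverse.foldl (fun acc H => (genStep H acc).take K) [[]]

theorem gen_cons (H : List (List δ)) (l : List (List (List δ))) :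
    gen (H :: l) = genStep H (gen l) := rfl

theorem mem_gen_cons {H : List (List δ)} {l : List (List (List δ))} {x : List δ} :
    x ∈ gen (H :: l) ↔ ∃ y ∈ H, ∃ z ∈ gen l, y ++ z = x := by
  simp [gen_cons, genStep]

theorem length_gen_cons (H : List (List δ)) (l : List (List (List δ))) :
    (gen (H :: l)).length = H.length * (gen l).length := by
  rw [gen_cons, genStep, length_flatMap_const (m := (gen l).length)]
  simp

/-- Truncation keeps the enumeration polynomial in `K` on every input. Nothing is cut off if `K`
bounds the full product, since nonempty factors make all partial products at most as long. -/
theorem genK_eq_gen {K : ℕ} (l : List (List (List δ))) (h : ∀ H ∈ l, H ≠ [])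
    (hK : (gen l).length ≤ K) : genK K l = gen l := by
  induction l with
  | nil => rfl
  | cons H l ih =>
    rw [length_gen_cons] at hK
    have hH : 1 ≤ H.length := List.length_pos_iff.2 (h H (by simp))
    have hK' : (gen l).length ≤ K := (Nat.le_mul_of_pos_left _ hH).trans hK
    have ih := ih (fun H hH => h H (by simp [hH])) hK'
    rw [genK] at ih ⊢
    rw [List.reverse_cons, List.foldl_append, ih, List.foldl_cons, List.foldl_nil,
      List.take_of_length_le, gen_cons]
    rwa [← gen_cons, length_gen_cons]

theorem length_gen {m : ℕ} (l : List (List (List δ))) (h : ∀ H ∈ l, H.length = m) :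
    (gen l).length = m ^ l.length := by
  induction l with
  | nil => simp [gen]
  | cons H l ih =>
    rw [length_gen_cons, h H (by simp), ih fun H hH => h H (by simp [hH]), List.length_cons,
      pow_succ']

/-- The sublists of a list, truncated to length `K`. -/
def subsK (K : ℕ) (l : List δ) : List (List δ) := genK K (l.map fun x => [[], [x]])

theorem lfilter_mem_subsK {K : ℕ} {l : List δ} (hK : 2 ^ l.length ≤ K) (p : δ → Prop) :
    lfilter l p ∈ subsK K l := by
  classical
  rw [subsK, genK_eq_gen _ (by simp) (by rw [length_gen (m := 2) _ (by simp)]; simpa using hK)]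
  clear hK
  induction l with
  | nil => simp [lfilter, gen]
  | cons a l ih =>
    refine mem_gen_cons.2 ⟨if p a then [a] else [], by split_ifs <;> simp, _, ih, ?_⟩
    by_cases h : p a <;> simp [lfilter, h]

theorem length_subsK_le {K : ℕ} {l : List δ} (hK : 2 ^ l.length ≤ K) :
    (subsK K l).length ≤ K := by
  rw [subsK, genK_eq_gen _ (by simp) (by rw [length_gen (m := 2) _ (by simp)]; simpa using hK),
    length_gen (m := 2) _ (by simp)]
  simpa using hK

/-- All bit strings of length `m` in lexicographic order, truncated to length `K`. -/
def allBits (K m : ℕ) : List (List Bool) :=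
  genK K ((List.range m).map fun _ => [[false], [true]])

theorem mem_gen_bits {m : ℕ} {v : List Bool} :
    v ∈ gen (List.replicate m [[false], [true]]) ↔ v.length = m := by
  induction m generalizing v with
  | zero => simp [gen]
  | succ m ih =>
    rw [List.replicate_succ, mem_gen_cons]
    constructor
    · rintro ⟨y, hy, z, hz, rfl⟩
      rw [ih] at hz
      simp at hy
      rcases hy with rfl | rfl <;> simp [hz]
    · intro h
      cases v with
      | nil => simp at h
      | cons b v => exact ⟨[b], by cases b <;> simp, v, ih.2 (by simpa using h), rfl⟩

theorem pairwise_gen_bits (m : ℕ) :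
    (gen (List.replicate m [[false], [true]])).Pairwise (List.Lex (· < ·)) := by
  induction m with
  | zero => simp [gen]
  | succ m ih =>
    rw [List.replicate_succ, gen_cons]
    simp only [genStep, List.flatMap_cons, List.flatMap_nil, List.append_nil, List.pairwise_append,
      List.pairwise_map]
    refine ⟨ih.imp fun h => .cons h, ih.imp fun h => .cons h, ?_⟩
    intro x hx y hy
    obtain ⟨x, -, rfl⟩ := List.mem_map.1 hx
    obtain ⟨y, -, rfl⟩ := List.mem_map.1 hy
    exact .rel (by decide)

theorem allBits_eq {K m : ℕ} (hK : 2 ^ m ≤ K) :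
    allBits K m = gen (List.replicate m [[false], [true]]) := by
  have : (List.range m).map (fun _ => [[false], [true]]) =
      List.replicate m [[false], [true]] := by simp
  rw [allBits, this, genK_eq_gen]
  · intro H hH; simp [List.eq_of_mem_replicate hH]
  · rw [length_gen (m := 2)]
    · simpa using hK
    · intro H hH; simp [List.eq_of_mem_replicate hH]

end gen

/-! ### The letters -/

/-- The codes of all layers of width at most `W` over `s` letters. -/
noncomputable def letters (K s W : ℕ) : List Code :=
  (List.range (W + 1)).flatMap fun u =>
    (lfilter (allBits K (codeLen s u)) fun v => Code.Valid s (u, v)).map fun v => (u, v)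

/-- Valid codes of one width are listed lexicographically and have the same length, which grows with
the width. The concatenation over increasing widths is therefore sorted by `Layer.Lt`. -/
theorem exists_letters {α : Type*} [LinearOrder α] [Fintype α] {K W : ℕ}
    (hK : 2 ^ codeLen (Fintype.card α) W ≤ K) : ∃ Ls : List (Layer α),
      letters K (Fintype.card α) W = Ls.map Layer.code ∧ Ls.Pairwise Layer.Lt ∧
      ∀ B, B ∈ Ls ↔ B ∈ layerAlphabet α W := by
  set s := Fintype.card α with hs
  have hK' : ∀ u < W + 1, allBits K (codeLen s u) =
      gen (List.replicate (codeLen s u) [[false], [true]]) := by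
    intro u hu
    exact allBits_eq ((Nat.pow_le_pow_right (by omega)
      ((codeLen_strictMono s).monotone (by omega))).trans hK)
  have hmem : ∀ u v, (u, v) ∈ letters K s W ↔
      u < W + 1 ∧ v.length = codeLen s u ∧ Code.Valid s (u, v) := by
    intro u v
    simp only [letters, List.mem_flatMap, List.mem_map, mem_lfilter, List.mem_range]
    constructor
    · rintro ⟨u, hu, v, ⟨h1, h2⟩, h⟩
      cases h
      rw [hK' u hu, mem_gen_bits] at h1
      exact ⟨hu, h1, h2⟩
    · rintro ⟨hu, h1, h2⟩
      exact ⟨u, hu, v, ⟨by rw [hK' u hu, mem_gen_bits]; exact h1, h2⟩, rfl⟩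
  have hsort : (letters K s W).Pairwise fun c c' => List.Shortlex (· < ·) c.2 c'.2 := by
    refine List.pairwise_flatMap.2 ⟨fun u hu => List.pairwise_map.2 ?_, ?_⟩
    · have h1 := (pairwise_gen_bits (codeLen s u)).sublist
        (lfilter_sublist _ fun v => Code.Valid s (u, v))
      rw [hK' u (by simpa using hu)]
      refine h1.imp_of_mem fun {v v'} hv hv' hlt => .of_lex ?_ hlt
      rw [mem_gen_bits.1 (mem_lfilter.1 hv).1, mem_gen_bits.1 (mem_lfilter.1 hv').1]
    · refine (List.pairwise_lt_range (n := W + 1)).imp_of_mem ?_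
      intro u u' hu hu' hlt x hx y hy
      obtain ⟨v, hv, rfl⟩ := List.mem_map.1 hx
      obtain ⟨v', hv', rfl⟩ := List.mem_map.1 hy
      rw [hK' u (by simpa using hu)] at hv
      rw [hK' u' (by simpa using hu')] at hv'
      refine .of_length_lt ?_
      rw [mem_gen_bits.1 (mem_lfilter.1 hv).1, mem_gen_bits.1 (mem_lfilter.1 hv').1]
      exact codeLen_strictMono s hlt
  have hdec : ∀ c ∈ letters K s W, ∃ B : Layer α, B.code = c := by
    rintro ⟨u, v⟩ hc
    obtain ⟨-, h1, h2⟩ := (hmem u v).1 hc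
    exact exists_layer_of_valid h1 h2
  have hlist : ∀ l : List Code, (∀ c ∈ l, ∃ B : Layer α, B.code = c) →
      ∃ Ls : List (Layer α), l = Ls.map Layer.code := by
    intro l
    induction l with
    | nil => exact fun _ => ⟨[], rfl⟩
    | cons c l ih =>
      intro h
      obtain ⟨B, rfl⟩ := h c (by simp)
      obtain ⟨Ls, rfl⟩ := ih fun c hc => h c (by simp [hc])
      exact ⟨B :: Ls, rfl⟩
  obtain ⟨Ls, hLs⟩ := hlist _ hdec
  refine ⟨Ls, hLs, ?_, fun B => ?_⟩
  · rw [hLs, List.pairwise_map] at hsort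
    exact hsort
  · have : B ∈ Ls ↔ B.code ∈ letters K s W := by
      rw [hLs, List.mem_map_of_injective code_injective]
    rw [this, Layer.code, hmem, ← width_le_iff, Nat.lt_succ_iff]
    exact ⟨fun h => h.1, fun h => ⟨h, length_bits _ _, valid_code B⟩⟩

/-! ### Subset construction and minimization -/

section subset

variable {Q A : Type} (Qs : List Q) (Ls : List A) (t : Q → A → Q → Prop) (fin : Q → Prop)

/-- The states reached from `X` by the letter `c`. -/
noncomputable def del (X : List Q) (c : A) : List Q := lfilter Qs fun y => exIn X fun x => t x c y

/-- The states from which `Y` is reached by the letter `c`. -/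
noncomputable def pre (c : A) (Y : List Q) : List Q := lfilter Qs fun x => exIn Y fun y => t x c y

/-- The preimages of the sets in `𝒴` and the set of final states. -/
noncomputable def preStep (K : ℕ) (𝒴 : List (List Q)) : List (List Q) :=
  lfilter (subsK K Qs) fun Y => Y = lfilter Qs fin ∨
    exIn 𝒴 fun Y' => exIn Ls fun c => Y = pre Qs t c Y'

/-- The sets of states from which a string is accepted. -/
noncomputable def pres (K : ℕ) : List (List Q) := (preStep Qs Ls t fin K)^[K] []

/-- `X` and `X'` meet the same sets of `𝒴`. -/
def Eqv (𝒴 : List (List Q)) (X X' : List Q) : Prop :=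
  allIn 𝒴 fun Y => (exIn X fun x => x ∈ Y) ↔ (exIn X' fun x => x ∈ Y)

/-- Append the first successor of the sets in `R` that is inequivalent to them all. -/
noncomputable def repStep (𝒴 : List (List Q)) (R : List (List Q)) : List (List Q) :=
  R ++ (lfilter (R.flatMap fun X => Ls.map fun c => del Qs t X c) fun X =>
    allIn R fun r => ¬ Eqv 𝒴 X r).take 1

/-- Acceptance of a string from a state, along states in `Qs`. -/
def NAcc : List A → Q → Prop
  | [], x => fin x
  | c :: z, x => ∃ y ∈ Qs, t x c y ∧ NAcc z y

variable {Qs Ls t fin}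

theorem exIn_del_NAcc {X : List Q} {c : A} {z : List A} :
    (∃ x ∈ del Qs t X c, NAcc Qs t fin z x) ↔ ∃ x ∈ X, NAcc Qs t fin (c :: z) x := by
  simp only [del, mem_lfilter, exIn, NAcc]
  constructor
  · rintro ⟨y, ⟨hy, x, hx, h⟩, hz⟩; exact ⟨x, hx, y, hy, h, hz⟩
  · rintro ⟨x, hx, y, hy, h, hz⟩; exact ⟨y, ⟨hy, x, hx, h⟩, hz⟩

theorem exIn_foldl_del_NAcc {u z : List A} {X : List Q} :
    (∃ x ∈ u.foldl (del Qs t) X, NAcc Qs t fin z x) ↔ ∃ x ∈ X, NAcc Qs t fin (u ++ z) x := by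
  induction u generalizing X with
  | nil => simp
  | cons c u ih => rw [List.foldl_cons, ih, exIn_del_NAcc, List.cons_append]

theorem pre_lfilter_NAcc {c : A} {z : List A} :
    pre Qs t c (lfilter Qs (NAcc Qs t fin z)) = lfilter Qs (NAcc Qs t fin (c :: z)) := by
  refine lfilter_congr fun x _ => ?_
  simp only [exIn, mem_lfilter, NAcc]
  exact ⟨fun ⟨y, ⟨h1, h2⟩, h3⟩ => ⟨y, h1, h3, h2⟩, fun ⟨y, h1, h3, h2⟩ => ⟨y, ⟨h1, h2⟩, h3⟩⟩

theorem preStep_mono {K : ℕ} {𝒴 𝒴' : List (List Q)} (h : ∀ Y ∈ 𝒴, Y ∈ 𝒴') :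
    (preStep Qs Ls t fin K 𝒴).Sublist (preStep Qs Ls t fin K 𝒴') := by
  refine lfilter_mono fun Y _ hY => ?_
  rcases hY with hY | ⟨Y', hY', hY⟩
  · exact .inl hY
  · exact .inr ⟨Y', h Y' hY', hY⟩

/-- The iterates form an increasing chain of lists of length at most `K`. Until it becomes
stationary each step adds an element, so it is stationary after `K` steps. -/
theorem pres_stable {K : ℕ} (hK : 2 ^ Qs.length ≤ K) :
    preStep Qs Ls t fin K (pres Qs Ls t fin K) = pres Qs Ls t fin K := by
  set g := preStep Qs Ls t fin K with hg
  have hsub : ∀ k, (g^[k] []).Sublist (g^[k + 1] []) := by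
    intro k
    induction k with
    | zero => simp
    | succ k ih =>
      rw [Function.iterate_succ_apply', Function.iterate_succ_apply' g (k + 1)]
      exact preStep_mono fun Y hY => ih.subset hY
  have hle : ∀ k, (g^[k] []).length ≤ K := by
    intro k
    cases k with
    | zero => simp
    | succ k =>
      rw [Function.iterate_succ_apply']
      exact (lfilter_sublist _ _).length_le.trans (length_subsK_le hK)
  have key : ∀ k, g (g^[k] []) = g^[k] [] ∨ k ≤ (g^[k] []).length := by
    intro k
    induction k with
    | zero => simp
    | succ k ih =>
      rcases ih with ih | ih
      · left; rw [Function.iterate_succ_apply', ih, ih]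
      · by_cases he : g (g^[k] []) = g^[k] []
        · left; rw [Function.iterate_succ_apply', he, he]
        · right
          have h1 := (hsub k).length_le
          rcases h1.lt_or_eq with h1 | h1
          · omega
          · have := (hsub k).eq_of_length h1
            rw [Function.iterate_succ_apply'] at this
            exact absurd this.symm he
  rcases key K with h | h
  · exact h
  · have h1 := (hsub K).length_le
    have h2 := hle (K + 1)
    have := (hsub K).eq_of_length (by omega)
    rw [Function.iterate_succ_apply'] at this
    exact this.symm

theorem mem_pres_iff {K : ℕ} (hK : 2 ^ Qs.length ≤ K) {Y : List Q} :
    Y ∈ pres Qs Ls t fin K ↔ ∃ z : List A, (∀ c ∈ z, c ∈ Ls) ∧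
      Y = lfilter Qs (NAcc Qs t fin z) := by
  constructor
  · have : ∀ k, ∀ Y ∈ (preStep Qs Ls t fin K)^[k] [], ∃ z : List A, (∀ c ∈ z, c ∈ Ls) ∧
        Y = lfilter Qs (NAcc Qs t fin z) := by
      intro k
      induction k with
      | zero => simp
      | succ k ih =>
        intro Y hY
        rw [Function.iterate_succ_apply'] at hY
        rcases (mem_lfilter.1 hY).2 with rfl | ⟨Y', hY', c, hc, rfl⟩
        · exact ⟨[], by simp, rfl⟩
        · obtain ⟨z, hz, rfl⟩ := ih Y' hY'
          exact ⟨c :: z, by simpa [hc] using hz, pre_lfilter_NAcc⟩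
    exact this K Y
  · rintro ⟨z, hz, rfl⟩
    induction z with
    | nil =>
      rw [← pres_stable hK]
      exact mem_lfilter.2 ⟨lfilter_mem_subsK hK _, .inl rfl⟩
    | cons c z ih =>
      rw [← pres_stable hK]
      exact mem_lfilter.2 ⟨lfilter_mem_subsK hK _, .inr ⟨_, ih fun c hc => hz c (by simp [hc]), c,
        hz c (by simp), pre_lfilter_NAcc.symm⟩⟩

/-- A set of states accepts `z` exactly if it meets the set of states from which `z` is accepted,
and `pres` consists of these sets for all `z`. Thus finitely many tests decide equality of
languages. -/
theorem eqv_pres_iff {K : ℕ} (hK : 2 ^ Qs.length ≤ K) {X X' : List Q} (hX : ∀ x ∈ X, x ∈ Qs)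
    (hX' : ∀ x ∈ X', x ∈ Qs) : Eqv (pres Qs Ls t fin K) X X' ↔
      ∀ z : List A, (∀ c ∈ z, c ∈ Ls) →
        ((∃ x ∈ X, NAcc Qs t fin z x) ↔ ∃ x ∈ X', NAcc Qs t fin z x) := by
  have key : ∀ (z : List A) (X : List Q), (∀ x ∈ X, x ∈ Qs) →
      ((exIn X fun x => x ∈ lfilter Qs (NAcc Qs t fin z)) ↔ ∃ x ∈ X, NAcc Qs t fin z x) := by
    intro z X hX
    simp only [exIn, mem_lfilter]
    exact ⟨fun ⟨x, h1, h2⟩ => ⟨x, h1, h2.2⟩, fun ⟨x, h1, h2⟩ => ⟨x, h1, hX x h1, h2⟩⟩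
  constructor
  · intro h z hz
    rw [← key z X hX, ← key z X' hX']
    exact h _ ((mem_pres_iff hK).2 ⟨z, hz, rfl⟩)
  · intro h Y hY
    obtain ⟨z, hz, rfl⟩ := (mem_pres_iff hK).1 hY
    rw [key z X hX, key z X' hX']
    exact h z hz

theorem foldl_del_subset {u : List A} {X : List Q} (hX : ∀ x ∈ X, x ∈ Qs) :
    ∀ x ∈ u.foldl (del Qs t) X, x ∈ Qs := by
  rcases List.eq_nil_or_concat' u with rfl | ⟨u, c, rfl⟩
  · exact hX
  · rw [List.foldl_append]
    intro x hx
    exact (mem_lfilter.1 hx).1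

/-- Continuations that leave the alphabet never lead into `𝓛`, so the continuations tested by the
automaton suffice for Nerode equivalence among all words. -/
theorem eqv_iff_ner {L : Type*} {code : L → A} {Bs : List L} (hLs : Ls = Bs.map code)
    {𝓛 : Set (List L)} {K : ℕ} (hK : 2 ^ Qs.length ≤ K) {X₀ : List Q} (hX₀ : ∀ x ∈ X₀, x ∈ Qs)
    (h𝓛 : ∀ u ∈ 𝓛, ∀ a ∈ u, a ∈ Bs)
    (hacc : ∀ u : List L, (∀ a ∈ u, a ∈ Bs) →
      ((∃ x ∈ X₀, NAcc Qs t fin (u.map code) x) ↔ u ∈ 𝓛)) {u v : List L}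
    (hu : ∀ a ∈ u, a ∈ Bs) (hv : ∀ a ∈ v, a ∈ Bs) :
    Eqv (pres Qs Ls t fin K) ((u.map code).foldl (del Qs t) X₀)
      ((v.map code).foldl (del Qs t) X₀) ↔ Ner 𝓛 u v := by
  rw [eqv_pres_iff hK (foldl_del_subset hX₀) (foldl_del_subset hX₀)]
  simp only [exIn_foldl_del_NAcc]
  have hmem : ∀ u z : List L, (∀ a ∈ u, a ∈ Bs) → (∀ a ∈ z, a ∈ Bs) →
      ((∃ x ∈ X₀, NAcc Qs t fin (u.map code ++ z.map code) x) ↔ u ++ z ∈ 𝓛) := by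
    intro u z hu hz
    rw [← List.map_append, hacc]
    intro a ha
    rcases List.mem_append.1 ha with ha | ha
    · exact hu a ha
    · exact hz a ha
  constructor
  · intro h z
    by_cases hz : ∀ a ∈ z, a ∈ Bs
    · rw [← hmem u z hu hz, ← hmem v z hv hz]
      refine h _ fun c hc => ?_
      obtain ⟨a, ha, rfl⟩ := List.mem_map.1 hc
      rw [hLs]
      exact List.mem_map_of_mem (hz a ha)
    · exact iff_of_false (fun h => hz fun a ha => h𝓛 _ h a (by simp [ha]))
        (fun h => hz fun a ha => h𝓛 _ h a (by simp [ha]))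
  · intro h z hz
    have : ∃ z' : List L, z = z'.map code ∧ ∀ a ∈ z', a ∈ Bs := by
      clear h
      induction z with
      | nil => exact ⟨[], rfl, by simp⟩
      | cons c z ih =>
        obtain ⟨z', rfl, hz'⟩ := ih fun c hc => hz c (by simp [hc])
        have hc := hz c (by simp)
        rw [hLs] at hc
        obtain ⟨a, ha, rfl⟩ := List.mem_map.1 hc
        exact ⟨a :: z', rfl, by simpa [ha] using hz'⟩
    obtain ⟨z', rfl, hz'⟩ := this
    rw [hmem u z' hu hz', hmem v z' hv hz']
    exact h z'

/-- Inequivalent words reach different sets in the subset construction, and there are at most `K`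
such sets. -/
theorem length_le_of_pairwise_not_ner {L : Type*} {code : L → A} {Bs : List L} (hLs : Ls = Bs.map code)
    {𝓛 : Set (List L)} {K : ℕ} (hK : 2 ^ Qs.length ≤ K) {X₀ : List Q} (hX₀ : ∃ p, X₀ = lfilter Qs p)
    (h𝓛 : ∀ u ∈ 𝓛, ∀ a ∈ u, a ∈ Bs)
    (hacc : ∀ u : List L, (∀ a ∈ u, a ∈ Bs) →
      ((∃ x ∈ X₀, NAcc Qs t fin (u.map code) x) ↔ u ∈ 𝓛)) {R : List (List L)}
    (hR : R.Pairwise fun u v => ¬ Ner 𝓛 u v) (hR' : ∀ u ∈ R, ∀ a ∈ u, a ∈ Bs) :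
    R.length ≤ K := by
  obtain ⟨p, rfl⟩ := hX₀
  have hX₀ : ∀ x ∈ lfilter Qs p, x ∈ Qs := fun x hx => (mem_lfilter.1 hx).1
  have hnd : (R.map fun u => (u.map code).foldl (del Qs t) (lfilter Qs p)).Nodup := by
    refine List.pairwise_map.2 (hR.imp_of_mem fun {u v} hu hv hn e => hn ?_)
    rw [← eqv_iff_ner hLs hK hX₀ h𝓛 hacc (hR' u hu) (hR' v hv), e]
    exact fun Y _ => Iff.rfl
  have hsub : ∀ X ∈ R.map fun u => (u.map code).foldl (del Qs t) (lfilter Qs p),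
      X ∈ subsK K Qs := by
    intro X hX
    obtain ⟨u, -, rfl⟩ := List.mem_map.1 hX
    rcases List.eq_nil_or_concat' (u.map code) with h | ⟨u', c, h⟩
    · rw [h]; exact lfilter_mem_subsK hK _
    · rw [h, List.foldl_append]; exact lfilter_mem_subsK hK _
  have := (hnd.subperm hsub).length_le.trans (length_subsK_le hK)
  simpa using this

/-- The sets computed by `repStep` are those reached by the words computed by `addRep`. -/
theorem iterate_repStep {L : Type*} {code : L → A} {Bs : List L} (hLs : Ls = Bs.map code)
    {𝓛 : Set (List L)} {K : ℕ} (hK : 2 ^ Qs.length ≤ K) {X₀ : List Q} (hX₀ : ∀ x ∈ X₀, x ∈ Qs)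
    (h𝓛 : ∀ u ∈ 𝓛, ∀ a ∈ u, a ∈ Bs)
    (hacc : ∀ u : List L, (∀ a ∈ u, a ∈ Bs) →
      ((∃ x ∈ X₀, NAcc Qs t fin (u.map code) x) ↔ u ∈ 𝓛)) (k : ℕ) :
    (repStep Qs Ls t (pres Qs Ls t fin K))^[k] [X₀] =
      ((addRep 𝓛 Bs)^[k] [[]]).map (fun u => (u.map code).foldl (del Qs t) X₀) ∧
    ∀ u ∈ (addRep 𝓛 Bs)^[k] [[]], ∀ a ∈ u, a ∈ Bs := by
  induction k with
  | zero => simp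
  | succ k ih =>
    obtain ⟨ih1, ih2⟩ := ih
    rw [Function.iterate_succ_apply', Function.iterate_succ_apply', ih1]
    set R := (addRep 𝓛 Bs)^[k] [[]]
    have hext : ∀ u ∈ extensions Bs R, ∀ a ∈ u, a ∈ Bs := by
      intro u hu a ha
      obtain ⟨u', hu', h⟩ := List.mem_flatMap.1 hu
      obtain ⟨b, hb, rfl⟩ := List.mem_map.1 h
      rcases List.mem_append.1 ha with ha | ha
      · exact ih2 u' hu' a ha
      · simp at ha; rwa [ha]
    -- Successors of the sets reached by words are the sets reached by the one-letter extensions, in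
    -- the same order.
    have hflat : (R.map fun u => (u.map code).foldl (del Qs t) X₀).flatMap
        (fun X => Ls.map fun c => del Qs t X c) =
        (extensions Bs R).map fun u => (u.map code).foldl (del Qs t) X₀ := by
      rw [extensions, List.map_flatMap, List.flatMap_map, hLs]
      simp [Function.comp_def]
    refine ⟨?_, ?_⟩
    · rw [repStep, addRep, List.map_append, hflat, lfilter_map, List.map_take]
      congr 3
      refine lfilter_congr fun u hu => ?_
      constructor
      · intro h r hr hn
        exact h _ (List.mem_map_of_mem hr) ((eqv_iff_ner hLs hK hX₀ h𝓛 hacc (hext u hu) (ih2 r hr)).2 hn)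
      · intro h X hX
        obtain ⟨r, hr, rfl⟩ := List.mem_map.1 hX
        exact fun hn => h r hr ((eqv_iff_ner hLs hK hX₀ h𝓛 hacc (hext u hu) (ih2 r hr)).1 hn)
    · intro u hu
      rcases List.mem_append.1 hu with hu | hu
      · exact ih2 u hu
      · exact hext u (mem_lfilter.1 (List.mem_of_mem_take hu)).1

end subset

end SecondOrder

namespace SecondOrder

/-! ### The nondeterministic automaton of the canonical forms -/

/-- Lists of pairs (set of states, state). -/
abbrev Pairs := List (List ℕ × ℕ)

/-- States of the automaton: a state of the given automaton, the pairs reached, and a bit telling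
whether the strings read so far have the same languages. -/
abbrev NSt := ℕ × Pairs × Bool

/-- Transitions of the given automaton, as they are written in its description. -/
abbrev Tr := ℕ × List Bool × ℕ × Unit

namespace Code

/-- The layer is deterministic. -/
def Det (s : ℕ) (c : Code) : Prop :=
  (¬ c.iFlag s ∨ allIn (List.range c.1) fun p => (c.L p ↔ p = 0) ∧ (c.I s p ↔ p = 0)) ∧
  allIn (List.range c.1) fun p => allIn (List.range s) fun a => allIn (List.range c.1) fun q =>
    allIn (List.range c.1) fun q' => (¬ c.T s p a q ∨ ¬ c.T s p a q') ∨ q = q'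

/-- Every state has a transition for every letter, and every state has a predecessor. -/
def Total (s : ℕ) (c : Code) : Prop :=
  (allIn (List.range c.1) fun p => allIn (List.range s) fun a =>
    ¬ c.L p ∨ exIn (List.range c.1) fun q => c.T s p a q) ∧
  allIn (List.range c.1) fun q =>
    ¬ c.R q ∨ exIn (List.range c.1) fun p => exIn (List.range s) fun a => c.T s p a q

/-- The left and right states are initial segments. -/
def Contig (c : Code) : Prop :=
  (c.L 0 ∧ c.R 0) ∧ allIn (List.range c.1) fun p => allIn (List.range p) fun p' =>
    (¬ c.L p ∨ c.L p') ∧ (¬ c.R p ∨ c.R p')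

/-- The right states are ordered by their least predecessors. -/
def Ordered (s : ℕ) (c : Code) : Prop :=
  allIn (List.range c.1) fun q' => allIn (List.range q') fun q => ¬ (c.R q ∧ c.R q') ∨
    exIn (List.range c.1) fun p => exIn (List.range s) fun a => c.T s p a q ∧
      allIn (List.range c.1) fun p' => allIn (List.range s) fun a' => ¬ c.T s p' a' q' ∨
        (p < p' ∨ (p = p' ∧ a < a'))

/-- The layer is reduced. -/
def Reduced (s : ℕ) (c : Code) : Prop :=
  (allIn (List.range c.1) fun p => allIn (List.range c.1) fun p' => ¬ (c.L p ∧ c.L p') ∨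
    (p = p' ∨ exIn (List.range s) fun a => allIn (List.range c.1) fun q =>
      ¬ (c.T s p a q ∧ c.T s p' a q))) ∧
  (¬ c.fFlag s ∨ allIn (List.range c.1) fun q => allIn (List.range c.1) fun q' =>
    ¬ (c.R q ∧ c.R q') ∨ (q = q' ∨ ¬ (c.F s q ↔ c.F s q')))

/-- The local conditions on the layers of a canonical form. -/
def Good (s : ℕ) (c : Code) : Prop :=
  (c.Det s ∧ c.Total s) ∧ (c.Contig ∧ c.Ordered s) ∧ c.Reduced s

end Code

/-- The states reached from the states in `S` by the `i`-th letter. -/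
noncomputable def stepL (s w : ℕ) (b : Code) (S : List ℕ) (i : ℕ) : List ℕ :=
  lfilter (List.range w) fun q => exIn S fun p => b.T s p i q

open Classical in
/-- The pairs before the layer `b`. -/
noncomputable def startL (s w : ℕ) (b : Code) (f : Pairs) : Pairs :=
  if b.iFlag s then [(lfilter (List.range w) fun p => b.I s p, 0)] else f

/-- The local conditions for a layer `b` and a layer `c` of the canonical form, where `f` and `f'`
are the pairs reached before and after these layers. -/
def StepL (s w : ℕ) (f : Pairs) (b c : Code) (f' : Pairs) (ok : Bool) : Prop :=
  ((c.iFlag s ↔ b.iFlag s) ∧ (c.fFlag s ↔ b.fFlag s)) ∧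
  ((allIn (List.range c.1) fun p => ¬ c.L p ∨ exIn f fun e => e.2 = p) ∧
    allIn f fun e => c.L e.2) ∧
  ((allIn f fun e => allIn (List.range s) fun i => allIn (List.range c.1) fun q =>
      ¬ c.T s e.2 i q ∨ (stepL s w b e.1 i, q) ∈ f') ∧
    allIn f' fun e' => exIn f fun e => exIn (List.range s) fun i =>
      e'.1 = stepL s w b e.1 i ∧ c.T s e.2 i e'.2) ∧
  ((allIn (List.range c.1) fun q => ¬ c.R q ∨ exIn f' fun e => e.2 = q) ∧
    allIn f' fun e => c.R e.2) ∧
  (allIn f' fun e => allIn f' fun e' => ¬ e.1 = e'.1 ∨ e.2 = e'.2) ∧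
  (ok = true ↔ allIn f' fun e => ((exIn e.1 fun p => b.F s p) ↔ c.F s e.2))

/-- The transition relation. -/
def NTrans (s w : ℕ) (tr : List Tr) (x : NSt) (c : Code) (y : NSt) : Prop :=
  c.Good s ∧ exIn tr fun τ => (τ.1 = x.1 ∧ τ.2.2.1 = y.1) ∧
    StepL s w (startL s w (w, τ.2.1) x.2.1) (w, τ.2.1) c y.2.1 y.2.2

/-- All functional lists of pairs. -/
def pairLists (K w W : ℕ) : List Pairs :=
  genK K ((subsK K (List.range w)).map fun S => [] :: (List.range W).map fun c => [(S, c)])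

/-- All states. -/
def nStates (K n w W : ℕ) : List NSt :=
  (List.range n).flatMap fun q => (pairLists K w W).flatMap fun f => [(q, f, true), (q, f, false)]

/-- The final states. -/
def NFinal (fb : List Bool) (x : NSt) : Prop := bit fb x.1 ∧ x.2.2 = true

/-- The initial states. -/
noncomputable def nInit (K n w W : ℕ) (ib : List Bool) : List NSt :=
  lfilter (nStates K n w W) fun x => bit ib x.1 ∧ (x.2.1 = [] ∧ x.2.2 = false)

section good

variable {α : Type*} [LinearOrder α] [Fintype α]

theorem IsLetter.lex_lt {p p' i i' : ℕ} {a a' : α} (h : IsLetter i a) (h' : IsLetter i' a') :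
    toLex (p, a) < toLex (p', a') ↔ p < p' ∨ (p = p' ∧ i < i') := by
  rw [Prod.Lex.toLex_lt_toLex, h.lt_iff h']

/-- Codes avoid least predecessors: `q` precedes `q'` if some pair leading to `q` is below all pairs
leading to `q'`. For initial layers, contiguity forces the single left state to be `0`, which is
what `Code.Det` tests. -/
theorem good_iff {w : ℕ} {c : Code} {B : Layer α} (hc : Codes c B)
    (hB : B ∈ layerAlphabet α w) :
    c.Good (Fintype.card α) ↔ B.DC ∧ B.IsNormalized w ∧ B.IsReduced := by
  obtain ⟨hL, hR, hT, hI, hF, hi, hf⟩ := codes_iff hc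
  have hlt : ∀ {p}, p ∈ B.left → p < c.1 := fun h => ((hL _).2 h).1
  have hrt : ∀ {p}, p ∈ B.right → p < c.1 := fun h => ((hR _).2 h).1
  have hT' : ∀ {p i q a}, IsLetter i a → (c.T (Fintype.card α) p i q ↔ (p, a, q) ∈ B.trans) :=
    fun {p i q a} ha => by
      rw [hT]; exact ⟨fun ⟨b, hb, h⟩ => ha.unique hb ▸ h, fun h => ⟨a, ha, h⟩⟩
  have htot : c.Total (Fintype.card α) ↔ (∀ p ∈ B.left, ∀ a : α, ∃ q ∈ B.right,
      (p, a, q) ∈ B.trans) ∧ B.IsReachable := by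
    simp only [Code.Total, allIn, exIn, List.mem_range, ← imp_iff_not_or, hL, hR]
    refine and_congr ?_ ?_
    · constructor
      · intro h p hp a
        obtain ⟨i, ha⟩ := exists_isLetter a
        obtain ⟨q, -, ht⟩ := h p (hlt hp) i ha.lt hp
        have := (hT' ha).1 ht
        exact ⟨q, (B.trans_mem _ _ _ this).2, this⟩
      · intro h p _ i hi hp
        obtain ⟨a, ha⟩ := exists_letter (α := α) hi
        obtain ⟨q, hq, ht⟩ := h p hp a
        exact ⟨q, hrt hq, (hT' ha).2 ht⟩
    · constructor
      · intro h q hq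
        obtain ⟨p, -, i, hi, ht⟩ := h q (hrt hq) hq
        obtain ⟨a, ha⟩ := exists_letter (α := α) hi
        have := (hT' ha).1 ht
        exact ⟨p, (B.trans_mem _ _ _ this).1, a, this⟩
      · intro h q _ hq
        obtain ⟨p, hp, a, ht⟩ := h q hq
        obtain ⟨i, ha⟩ := exists_isLetter a
        exact ⟨p, hlt hp, i, ha.lt, (hT' ha).2 ht⟩
  have hdet : (∀ p < c.1, ∀ i < Fintype.card α, ∀ q < c.1, ∀ q' < c.1,
      (¬ c.T (Fintype.card α) p i q ∨ ¬ c.T (Fintype.card α) p i q') ∨ q = q') ↔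
      ∀ p ∈ B.left, ∀ (a : α) (q q' : ℕ), (p, a, q) ∈ B.trans → (p, a, q') ∈ B.trans →
        q = q' := by
    constructor
    · intro h p hp a q q' ht ht'
      obtain ⟨i, ha⟩ := exists_isLetter a
      have := h p (hlt hp) i ha.lt q (hrt (B.trans_mem _ _ _ ht).2) q'
        (hrt (B.trans_mem _ _ _ ht').2)
      rw [hT' ha, hT' ha] at this
      tauto
    · intro h p _ i hi q _ q' _
      obtain ⟨a, ha⟩ := exists_letter (α := α) hi
      rw [hT' ha, hT' ha]
      by_contra hcon
      push Not at hcon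
      exact hcon.2 (h p (B.trans_mem _ _ _ hcon.1.1).1 a q q' hcon.1.1 hcon.1.2)
  have hcontig : c.Contig ↔ B.IsContiguous w := by
    have key : ∀ S : Finset ℕ, S ⊆ Finset.range w → ((0 ∈ S ∧ ∀ p ∈ S, ∀ p' < p, p' ∈ S) ↔
        ∃ w₁ ∈ Finset.Icc 1 w, S = Finset.range w₁) := by
      intro S hS
      constructor
      · rintro ⟨h0, h⟩
        have hcard : S = Finset.range S.card := by
          -- A member `p` of a downward closed set comes with `p + 1` elements of the set.
          have hsub : S ⊆ Finset.range S.card := by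
            intro p hp
            have : Finset.range (p + 1) ⊆ S := by
              intro p' hp'
              rcases (Nat.lt_succ_iff.1 (Finset.mem_range.1 hp')).lt_or_eq with hlt | rfl
              · exact h p hp p' hlt
              · exact hp
            have := Finset.card_le_card this
            simp at this ⊢; omega
          exact Finset.eq_of_subset_of_card_le hsub (by simp)
        refine ⟨S.card, Finset.mem_Icc.2 ⟨Finset.card_pos.2 ⟨0, h0⟩, ?_⟩, hcard⟩
        simpa using Finset.card_le_card hS
      · rintro ⟨w₁, h, rfl⟩
        simp only [Finset.mem_Icc] at h
        refine ⟨by simp; omega, fun p hp p' hp' => ?_⟩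
        simp at hp ⊢; omega
    have hl := key B.left hB.1
    have hr := key B.right hB.2
    simp only [Layer.IsContiguous]
    have e : (∃ w₁ ∈ Finset.Icc 1 w, ∃ w₂ ∈ Finset.Icc 1 w,
        B.left = Finset.range w₁ ∧ B.right = Finset.range w₂) ↔
        (∃ w₁ ∈ Finset.Icc 1 w, B.left = Finset.range w₁) ∧
        ∃ w₁ ∈ Finset.Icc 1 w, B.right = Finset.range w₁ := by
      constructor
      · rintro ⟨a, ha, b, hb, h1, h2⟩; exact ⟨⟨a, ha, h1⟩, b, hb, h2⟩
      · rintro ⟨⟨a, ha, h1⟩, b, hb, h2⟩; exact ⟨a, ha, b, hb, h1, h2⟩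
    rw [e, ← hl, ← hr]
    simp only [Code.Contig, allIn, List.mem_range, ← imp_iff_not_or, hL, hR]
    constructor
    · rintro ⟨⟨h1, h2⟩, h3⟩
      exact ⟨⟨h1, fun p hp p' hp' => (h3 p (hlt hp) p' hp').1 hp⟩, h2,
        fun p hp p' hp' => (h3 p (hrt hp) p' hp').2 hp⟩
    · rintro ⟨⟨h1, h3⟩, h2, h4⟩
      exact ⟨⟨h1, h2⟩, fun p _ p' hp' => ⟨fun hp => h3 p hp p' hp', fun hp => h4 p hp p' hp'⟩⟩
  have hord : B.IsReachable → (c.Ordered (Fintype.card α) ↔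
      ∀ q ∈ B.right, ∀ q' ∈ B.right, ∀ x x', B.IsLeastPred q x → B.IsLeastPred q' x' →
        (q < q' ↔ toLex x < toLex x')) := by
    intro hreach
    -- One implication between the two orders suffices: trichotomy on the states yields the
    -- converse.
    have e : c.Ordered (Fintype.card α) ↔ ∀ q ∈ B.right, ∀ q' ∈ B.right, q < q' →
        ∃ p a, (p, a, q) ∈ B.trans ∧ ∀ p' a', (p', a', q') ∈ B.trans →
          toLex (p, a) < toLex (p', a') := by
      simp only [Code.Ordered, allIn, exIn, List.mem_range, ← imp_iff_not_or, hR]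
      constructor
      · intro h q hq q' hq' hlt'
        obtain ⟨p, hp, i, hi, ht, hmin⟩ := h q' (hrt hq') q hlt' ⟨hq, hq'⟩
        obtain ⟨a, ha⟩ := exists_letter (α := α) hi
        refine ⟨p, a, (hT' ha).1 ht, fun p' a' ht' => ?_⟩
        obtain ⟨i', ha'⟩ := exists_isLetter a'
        rw [ha.lex_lt ha']
        exact hmin p' (hlt (B.trans_mem _ _ _ ht').1) i' ha'.lt ((hT' ha').2 ht')
      · rintro h q' _ q hlt' ⟨hq, hq'⟩
        obtain ⟨p, a, ht, hmin⟩ := h q hq q' hq' hlt'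
        obtain ⟨i, ha⟩ := exists_isLetter a
        refine ⟨p, hlt (B.trans_mem _ _ _ ht).1, i, ha.lt, (hT' ha).2 ht, fun p' _ i' hi' ht' => ?_⟩
        obtain ⟨a', ha'⟩ := exists_letter (α := α) hi'
        rw [← ha.lex_lt ha']
        exact hmin p' a' ((hT' ha').1 ht')
    rw [e]
    constructor
    · intro h
      have hlt' : ∀ q ∈ B.right, ∀ q' ∈ B.right, ∀ x x', B.IsLeastPred q x →
          B.IsLeastPred q' x' → q < q' → toLex x < toLex x' := by
        intro q hq q' hq' x x' hx hx' hqq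
        obtain ⟨p, a, ht, hmin⟩ := h q hq q' hq' hqq
        exact (hx.2 p a ht).trans_lt (hmin x'.1 x'.2 hx'.1)
      intro q hq q' hq' x x' hx hx'
      refine ⟨hlt' q hq q' hq' x x' hx hx', fun hxx => ?_⟩
      rcases lt_trichotomy q q' with h1 | rfl | h1
      · exact h1
      · exact absurd (hx'.2 x.1 x.2 hx.1) (not_le.2 hxx)
      · exact absurd (hlt' q' hq' q hq x' x hx' hx h1) hxx.le.not_gt
    · intro h q hq q' hq' hqq
      obtain ⟨p, -, a, ht⟩ := hreach q hq
      obtain ⟨x, hx⟩ := Layer.exists_isLeastPred ht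
      obtain ⟨p', -, a', ht'⟩ := hreach q' hq'
      obtain ⟨x', hx'⟩ := Layer.exists_isLeastPred ht'
      exact ⟨x.1, x.2, hx.1, fun p' a' ht' =>
        ((h q hq q' hq' x x' hx hx').1 hqq).trans_le (hx'.2 p' a' ht')⟩
  have hred : c.Reduced (Fintype.card α) ↔ B.IsReduced := by
    simp only [Code.Reduced, allIn, exIn, List.mem_range, ← imp_iff_not_or, hL, hR, hF, hf]
    refine and_congr ?_ ?_
    · constructor
      · intro h p hp p' hp' hall
        rcases h p (hlt hp) p' (hlt hp') ⟨hp, hp'⟩ with h | ⟨i, hi, h⟩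
        · exact h
        · obtain ⟨a, ha⟩ := exists_letter (α := α) hi
          obtain ⟨q, h1, h2⟩ := hall a
          exact absurd ⟨(hT' ha).2 h1, (hT' ha).2 h2⟩ (h q (hrt (B.trans_mem _ _ _ h1).2))
      · rintro h p _ p' _ ⟨hp, hp'⟩
        by_contra hcon
        push Not at hcon
        refine hcon.1 (h p hp p' hp' fun a => ?_)
        obtain ⟨i, ha⟩ := exists_isLetter a
        obtain ⟨q, -, h1, h2⟩ := hcon.2 i ha.lt
        exact ⟨q, (hT' ha).1 h1, (hT' ha).1 h2⟩
    · refine imp_congr_right fun _ => ?_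
      constructor
      · intro h q hq q' hq' hiff
        rcases h q (hrt hq) q' (hrt hq') ⟨hq, hq'⟩ with h | h
        · exact h
        · exact absurd hiff h
      · rintro h q _ q' _ ⟨hq, hq'⟩
        by_cases hiff : q ∈ B.final ↔ q' ∈ B.final
        · exact .inl (h q hq q' hq' hiff)
        · exact .inr hiff
  constructor
  · rintro ⟨⟨⟨h1, h2⟩, h3⟩, ⟨h4, h5⟩, h6⟩
    simp only [allIn, List.mem_range] at h1 h2
    have hinit : B.initFlag = true → B.left = {0} ∧ B.init = {0} := by
      intro hflag
      have h1 := h1.resolve_left (not_not.2 (hi.2 hflag))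
      have h0 : 0 < c.1 := h4.1.1.1
      constructor
      · ext p
        rw [Finset.mem_singleton]
        refine ⟨fun hp => ((h1 p (hlt hp)).1).1 ((hL p).2 hp), fun hp => ?_⟩
        rw [hp]
        exact (hL 0).1 h4.1.1
      · ext p
        rw [Finset.mem_singleton]
        refine ⟨fun hp => ((h1 p (hlt (B.init_subset hp))).2).1 ((hI p).2 hp), fun hp => ?_⟩
        exact (hI p).1 (((h1 p (hp ▸ h0)).2).2 hp)
    have hd : B.IsDeterministic := ⟨fun hflag => by
      obtain ⟨e1, e2⟩ := hinit hflag
      simp [e1, e2], hdet.1 h2⟩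
    obtain ⟨h3, h3'⟩ := htot.1 h3
    exact ⟨⟨hd, fun hflag => by simp [(hinit hflag).2], h3⟩,
      ⟨⟨h3', hd, (hord h3').1 h5⟩, hcontig.1 h4⟩, hred.1 h6⟩
  · rintro ⟨⟨hd, hcomp⟩, ⟨⟨h1, -, h2⟩, h3⟩, h4⟩
    refine ⟨⟨⟨?_, by simpa only [allIn, List.mem_range] using hdet.2 hd.2⟩,
      htot.2 ⟨hcomp.2, h1⟩⟩, ⟨hcontig.2 h3, (hord h1).2 h2⟩, hred.2 h4⟩
    by_cases hflag : B.initFlag = true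
    · right
      obtain ⟨e1, e2⟩ := hd.1 hflag
      obtain ⟨x, hx⟩ := Finset.card_eq_one.1 e2
      have h0 : 0 ∈ B.left := (hL 0).1 (hcontig.2 h3).1.1
      obtain rfl : x = 0 := by rw [hx] at h0; simpa [eq_comm] using h0
      intro p _
      simp only [hL, hI, e1, hx, Finset.mem_singleton, and_self]
    · exact .inl (by rwa [hi])

end good

end SecondOrder

namespace SecondOrder

/-! ### Local steps on codes and on layers -/

section steps

variable {α : Type*} [LinearOrder α] [Fintype α]

/-- The set of pairs described by a list. -/
def pairSet (f : Pairs) : Set (Finset ℕ × ℕ) := {e | ∃ e' ∈ f, e = (e'.1.toFinset, e'.2)}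

/-- The increasing list of the elements of a set of numbers `< w`. -/
noncomputable def sortedList (w : ℕ) (S : Finset ℕ) : List ℕ :=
  lfilter (List.range w) fun p => p ∈ S

theorem toFinset_sortedList {w : ℕ} {S : Finset ℕ} (h : S ⊆ Finset.range w) :
    (sortedList w S).toFinset = S := by
  ext p
  simp only [sortedList, List.mem_toFinset, mem_lfilter, List.mem_range, and_iff_right_iff_imp]
  exact fun hp => by simpa using h hp

/-- The result is a sorted list, which is unique for a given set, so equality of sets becomes
equality of lists. -/
theorem stepL_eq {w : ℕ} {v : List Bool} {B : Layer α} (hb : Codes (w, v) B) {i : ℕ} {a : α}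
    (ha : IsLetter i a) (S : List ℕ) :
    stepL (Fintype.card α) w (w, v) S i = sortedList w (stepF B S.toFinset a) := by
  obtain ⟨-, -, hT, -⟩ := codes_iff hb
  refine lfilter_congr fun q _ => ?_
  simp only [exIn, mem_stepF, List.mem_toFinset, hT]
  constructor
  · rintro ⟨p, hp, b, hb, h⟩; exact ⟨p, hp, ha.unique hb ▸ h⟩
  · rintro ⟨p, hp, h⟩; exact ⟨p, hp, a, ha, h⟩

theorem toFinset_stepL {w : ℕ} {v : List Bool} {B : Layer α} (hb : Codes (w, v) B) {i : ℕ}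
    {a : α} (ha : IsLetter i a) (S : List ℕ) :
    (stepL (Fintype.card α) w (w, v) S i).toFinset = stepF B S.toFinset a := by
  rw [stepL_eq hb ha, toFinset_sortedList ((stepF_subset _ _ _).trans hb.1.2)]

/-- The pairs before the layer `B`. -/
def startS (f : Set (Finset ℕ × ℕ)) (B : Layer α) : Set (Finset ℕ × ℕ) :=
  if B.initFlag then {(B.init, 0)} else f

theorem pairSet_startL {w : ℕ} {v : List Bool} {B : Layer α} (hb : Codes (w, v) B) (f : Pairs) :
    pairSet (startL (Fintype.card α) w (w, v) f) = startS (pairSet f) B := by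
  obtain ⟨-, -, -, hI, -, hi, -⟩ := codes_iff hb
  by_cases h : B.initFlag = true
  · have e : (lfilter (List.range w) fun p => Code.I (Fintype.card α) (w, v) p) =
        sortedList w B.init := lfilter_congr fun p _ => hI p
    rw [startL, if_pos (hi.2 h), startS, if_pos h, e]
    ext x
    simp [pairSet, toFinset_sortedList (B.init_subset.trans hb.1.1)]
  · rw [startL, if_neg (by rwa [hi]), startS, if_neg h]

/-- Membership and equality in `StepL` concern lists. The hypothesis `hf'` makes them agree with the
corresponding statements about sets. -/
theorem stepL_iff {w : ℕ} {v : List Bool} {c : Code} {B C : Layer α} (hb : Codes (w, v) B)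
    (hc : Codes c C) {f f' : Pairs} {ok : Bool} (hC : C.DC ∧ C.IsNormalized (2 ^ w) ∧ C.IsReduced)
    (hf' : ∀ e ∈ f', e.1 = sortedList w e.1.toFinset) :
    StepL (Fintype.card α) w f (w, v) c f' ok ↔
      MTrans w (pairSet f) B C (pairSet f') (ok = true) := by
  obtain ⟨-, -, hbT, hbI, hbF, hbi, hbf⟩ := codes_iff hb
  obtain ⟨hL, hR, hT, hI, hF, hi, hf⟩ := codes_iff hc
  have hlt : ∀ {p}, p ∈ C.left → p < c.1 := fun h => ((hL _).2 h).1
  have hrt : ∀ {p}, p ∈ C.right → p < c.1 := fun h => ((hR _).2 h).1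
  have hT' : ∀ {p i q a}, IsLetter i a → (c.T (Fintype.card α) p i q ↔ (p, a, q) ∈ C.trans) :=
    fun {p i q a} ha => by
      rw [hT]; exact ⟨fun ⟨b, hb, h⟩ => ha.unique hb ▸ h, fun h => ⟨a, ha, h⟩⟩
  have hvals : ∀ {f : Pairs} {p : ℕ}, (∃ e ∈ pairSet f, e.2 = p) ↔ ∃ e ∈ f, e.2 = p := by
    intro f p
    constructor
    · rintro ⟨_, ⟨e, he, rfl⟩, h⟩; exact ⟨e, he, h⟩
    · rintro ⟨e, he, h⟩; exact ⟨_, ⟨e, he, rfl⟩, h⟩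
  have hall : ∀ {f : Pairs} {P : Finset ℕ × ℕ → Prop}, (∀ e ∈ pairSet f, P e) ↔
      ∀ e ∈ f, P (e.1.toFinset, e.2) := by
    intro f P
    constructor
    · intro h e he; exact h _ ⟨e, he, rfl⟩
    · rintro h _ ⟨e, he, rfl⟩; exact h e he
  have hvals' : ∀ {f : Pairs} {S : Finset ℕ} {M : Code → ℕ → Prop},
      (∀ p, M c p ↔ p ∈ S) → (∀ p ∈ S, p < c.1) →
      (((∀ p < c.1, M c p → ∃ e ∈ f, e.2 = p) ∧ ∀ e ∈ f, M c e.2) ↔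
        ∀ p, p ∈ S ↔ ∃ e ∈ pairSet f, e.2 = p) := by
    intro f S M hM hS
    simp only [hvals, hM]
    constructor
    · rintro ⟨h1, h2⟩ p
      exact ⟨fun hp => h1 p (hS p hp) hp, fun ⟨e, he, hp⟩ => hp ▸ h2 e he⟩
    · intro h
      exact ⟨fun p _ hp => (h p).1 hp, fun e he => (h e.2).2 ⟨e, he, rfl⟩⟩
  simp only [StepL, MTrans, allIn, exIn, List.mem_range, ← imp_iff_not_or]
  refine Iff.trans ?_ (and_iff_right hC).symm
  refine and_congr (and_congr ?_ ?_) (and_congr (hvals' hL fun p => hlt) (and_congr ?_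
    (and_congr (hvals' hR fun p => hrt) (and_congr ?_ ?_))))
  · rw [hi, hbi]
    exact Bool.eq_iff_iff.symm
  · rw [hf, hbf]
    exact Bool.eq_iff_iff.symm
  · constructor
    · rintro ⟨h1, h2⟩
      ext ⟨S', q⟩
      constructor
      · rintro ⟨e', he', hx⟩
        obtain ⟨e, he, i, hi, h3, h4⟩ := h2 e' he'
        obtain ⟨a, ha⟩ := exists_letter (α := α) hi
        rw [hx]
        refine ⟨_, ⟨e, he, rfl⟩, a, ?_, (hT' ha).1 h4⟩
        show e'.1.toFinset = _
        rw [h3, toFinset_stepL hb ha]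
      · rintro ⟨_, ⟨e, he, rfl⟩, a, hS, ht⟩
        obtain ⟨i, ha⟩ := exists_isLetter a
        refine ⟨_, h1 e he i ha.lt q (hrt (C.trans_mem _ _ _ ht).2) ((hT' ha).2 ht), ?_⟩
        rw [toFinset_stepL hb ha]
        exact Prod.ext hS rfl
    · intro h
      constructor
      · intro e he i hi q _ ht
        obtain ⟨a, ha⟩ := exists_letter (α := α) hi
        have : (stepF B e.1.toFinset a, q) ∈ pairSet f' := by
          rw [h]; exact ⟨_, ⟨e, he, rfl⟩, a, rfl, (hT' ha).1 ht⟩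
        obtain ⟨e', he', hx⟩ := this
        rw [stepL_eq hb ha]
        have h1 : stepF B e.1.toFinset a = e'.1.toFinset := congrArg Prod.fst hx
        have h2 : q = e'.2 := congrArg Prod.snd hx
        rw [h1, h2, ← hf' e' he']
        exact he'
      · intro e' he'
        have : (e'.1.toFinset, e'.2) ∈ stepRel (pairSet f) B C := by
          rw [← h]; exact ⟨e', he', rfl⟩
        obtain ⟨_, ⟨e, he, rfl⟩, a, hS, ht⟩ := this
        obtain ⟨i, ha⟩ := exists_isLetter a
        refine ⟨e, he, i, ha.lt, ?_, (hT' ha).2 ht⟩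
        rw [hf' e' he', stepL_eq hb ha]
        exact congrArg _ hS
  · rw [hall]
    refine forall₂_congr fun e he => ?_
    rw [hall]
    refine forall₂_congr fun e' he' => ?_
    refine imp_congr_left ⟨fun h => by rw [h], fun h => ?_⟩
    rw [hf' e he, hf' e' he', show e.1.toFinset = e'.1.toFinset from h]
  · refine iff_congr Iff.rfl ?_
    rw [hall]
    refine forall₂_congr fun e he => ?_
    simp only [hbF, hF, List.mem_toFinset]

end steps

/-! ### Simultaneous runs with a restart at the initial layer -/

section simultaneous

variable {α : Type*} [LinearOrder α]

/-- Simultaneous runs that restart at layers with initial states. -/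
def SimI (w : ℕ) : Set (Finset ℕ × ℕ) → Prop → List (Layer α) → List (Layer α) → Prop
  | _, ok, [], [] => ok
  | f, _, B :: D, C :: Cs => ∃ f' ok', MTrans w (startS f B) B C f' ok' ∧ SimI w f' ok' D Cs
  | _, _, [], _ :: _ => False
  | _, _, _ :: _, [] => False

theorem simI_iff_sim {w : ℕ} {D : List (Layer α)} : ∀ {r : Finset ℕ} {C : List (Layer α)}
    {f : Set (Finset ℕ × ℕ)} {ok : Prop}, Chain w false r D →
    (SimI w f ok D C ↔ Sim w f ok D C) := by
  induction D with
  | nil => intro r C f ok _; cases C <;> rfl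
  | cons B D ih =>
    rintro r C f ok ⟨-, -, hi, -, hc⟩
    cases C with
    | nil => rfl
    | cons C Cs => simp only [SimI, Sim, startS, hi, ih hc, Bool.false_eq_true, if_false]

/-- The initial set of a diagram is known only once its first layer has been guessed. Runs therefore
start with no pairs, and the layer with the initial flag, which is the first and only one, sets them
to `(B.init, 0)`. -/
theorem simI_iff_canon {w : ℕ} {D C : List (Layer α)} (hD : IsODD w D) {ok : Prop} :
    SimI w ∅ ok D C ↔ Canon w D C := by
  obtain ⟨h0, r, hc⟩ := isODD_iff.1 hD
  cases D with
  | nil => simp at h0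
  | cons B D =>
    rw [← sim_iff_canon hc (ok := ok)]
    obtain ⟨-, -, hi, -, hc⟩ := hc
    cases C with
    | nil => rfl
    | cons C Cs => simp only [SimI, Sim, startS, hi, simI_iff_sim hc, if_true]

end simultaneous

/-! ### All functional lists of pairs are enumerated -/

section pairLists

variable {K w W : ℕ}

theorem length_gen_subs (hK : W ≤ K) (hw : W = 2 ^ w) :
    (subsK K (List.range w)).length = W := by
  rw [subsK, genK_eq_gen _ (by simp)
    (by rw [length_gen (m := 2) _ (by simp)]; simpa [← hw] using hK),
    length_gen (m := 2) _ (by simp)]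
  simp [hw]

theorem pairLists_eq (hw : W = 2 ^ w) (hK : (W + 1) ^ W ≤ K) :
    pairLists K w W = gen ((subsK K (List.range w)).map fun S =>
      [] :: (List.range W).map fun c => [(S, c)]) ∧ (pairLists K w W).length = (W + 1) ^ W := by
  have hW : W ≤ K := by
    have : W < (W + 1) ^ W := Nat.lt_pow_self (by have := Nat.two_pow_pos w; omega)
    omega
  have hl : (gen ((subsK K (List.range w)).map fun S =>
      [] :: (List.range W).map fun c => [(S, c)])).length = (W + 1) ^ W := by
    rw [length_gen (m := W + 1) _ (by simp), List.length_map, length_gen_subs hW hw]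
  have := genK_eq_gen (K := K) ((subsK K (List.range w)).map fun S =>
      [] :: (List.range W).map fun c => [(S, c)]) (by simp) (by rw [hl]; exact hK)
  exact ⟨this, by rw [pairLists, this, hl]⟩

/-- For each set `S` the product chooses either nothing or one pair `(S, c)`; such choices are the
partial functions `g`. -/
theorem mem_gen_pairs {l : List (List ℕ)} (g : List ℕ → Option ℕ)
    (hg : ∀ S c, g S = some c → c < W) :
    (l.flatMap fun S => ((g S).map fun c => (S, c)).toList) ∈
      gen (l.map fun S => [] :: (List.range W).map fun c => [(S, c)]) := by
  induction l with
  | nil => simp [gen]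
  | cons S l ih =>
    rw [List.map_cons]
    refine mem_gen_cons.2 ⟨((g S).map fun c => (S, c)).toList, ?_, _, ih, rfl⟩
    cases h : g S with
    | none => simp
    | some c => simpa using hg S c h

theorem nil_mem_pairLists (hw : W = 2 ^ w) (hK : (W + 1) ^ W ≤ K) : [] ∈ pairLists K w W := by
  rw [(pairLists_eq hw hK).1]
  have := mem_gen_pairs (W := W) (l := subsK K (List.range w)) (fun _ => none) (by simp)
  rwa [show ((subsK K (List.range w)).flatMap fun S : List ℕ =>
    (Option.map (fun c : ℕ => (S, c)) none).toList) = [] from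
      List.flatMap_eq_nil_iff.2 fun _ _ => rfl] at this

theorem exists_pairList (hw : W = 2 ^ w) (hK : (W + 1) ^ W ≤ K) {f : Set (Finset ℕ × ℕ)}
    (h1 : ∀ e ∈ f, e.1 ⊆ Finset.range w ∧ e.2 < W)
    (h2 : ∀ e ∈ f, ∀ e' ∈ f, e.1 = e'.1 → e.2 = e'.2) :
    ∃ l ∈ pairLists K w W, pairSet l = f ∧ ∀ e ∈ l, e.1 = sortedList w e.1.toFinset := by
  classical
  have hWK : W ≤ K := by
    have : W < (W + 1) ^ W := Nat.lt_pow_self (by have := Nat.two_pow_pos w; omega)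
    omega
  -- The value of `f` at a set is attached to the sorted list of that set only.
  let g : List ℕ → Option ℕ := fun S =>
    if h : ∃ c, (S.toFinset, c) ∈ f ∧ S = sortedList w S.toFinset then some h.choose else none
  have hg : ∀ S c, g S = some c ↔ (S.toFinset, c) ∈ f ∧ S = sortedList w S.toFinset := by
    intro S c
    by_cases h : ∃ c, (S.toFinset, c) ∈ f ∧ S = sortedList w S.toFinset
    · have hs := h.choose_spec
      simp only [g, dif_pos h, Option.some.injEq]
      constructor
      · intro e; rw [← e]; exact hs
      · intro hc; exact h2 _ hs.1 _ hc.1 rfl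
    · simp only [g, dif_neg h]
      exact ⟨fun e => by simp at e, fun hc => absurd ⟨c, hc⟩ h⟩
  have hmem : ∀ e : List ℕ × ℕ, e ∈ ((subsK K (List.range w)).flatMap fun S =>
      ((g S).map fun c => (S, c)).toList) ↔ e.1 ∈ subsK K (List.range w) ∧
        g e.1 = some e.2 := by
    rintro ⟨S, c⟩
    simp only [List.mem_flatMap, Option.mem_toList, Option.map_eq_some_iff,
      Prod.mk.injEq]
    constructor
    · rintro ⟨S', hS', c', hc', rfl, rfl⟩; exact ⟨hS', hc'⟩
    · rintro ⟨hS, hc⟩; exact ⟨S, hS, c, hc, rfl, rfl⟩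
  refine ⟨(subsK K (List.range w)).flatMap fun S => ((g S).map fun c => (S, c)).toList,
    ?_, ?_, ?_⟩
  · rw [(pairLists_eq hw hK).1]
    exact mem_gen_pairs g fun S c h => (h1 _ ((hg S c).1 h).1).2
  · ext ⟨S, c⟩
    constructor
    · rintro ⟨e, he, hx⟩
      rw [hx]
      exact ((hg _ _).1 ((hmem e).1 he).2).1
    · intro h
      have hS := toFinset_sortedList (h1 _ h).1
      refine ⟨(sortedList w S, c), (hmem _).2 ⟨?_, (hg _ _).2 ⟨?_, ?_⟩⟩, ?_⟩
      · exact lfilter_mem_subsK (by simpa [← hw] using hWK) _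
      · rw [hS]; exact h
      · show sortedList w S = _
        rw [hS]
      · show (S, c) = ((sortedList w S).toFinset, c)
        rw [hS]
  · intro e he
    exact ((hg _ _).1 ((hmem e).1 he).2).2

theorem mem_nStates {n : ℕ} {x : NSt} :
    x ∈ nStates K n w W ↔ x.1 < n ∧ x.2.1 ∈ pairLists K w W := by
  obtain ⟨q, f, ok⟩ := x
  simp only [nStates, List.mem_flatMap, List.mem_range, List.mem_cons, List.not_mem_nil, or_false]
  constructor
  · rintro ⟨q', hq', f', hf', h | h⟩ <;> cases h <;> exact ⟨hq', hf'⟩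
  · rintro ⟨hq, hf⟩
    exact ⟨q, hq, f, hf, by cases ok <;> simp⟩

theorem length_nStates (n : ℕ) (hw : W = 2 ^ w) (hK : (W + 1) ^ W ≤ K) :
    (nStates K n w W).length = n * ((W + 1) ^ W * 2) := by
  rw [nStates, length_flatMap_const (m := (W + 1) ^ W * 2)]
  · simp
  · intro q _
    rw [length_flatMap_const (m := 2) _ (by simp), (pairLists_eq hw hK).2]

end pairLists

end SecondOrder

namespace SecondOrder

/-! ### Descriptions of automata -/

section position

variable {L : Type*}

/-- The position of a state in the increasing enumeration of the states. -/
def FA.pos (F : FA L) (q : ℕ) : ℕ := (F.states.filter (· < q)).card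

theorem getElem?_length_filter_lt {l : List ℕ} (hl : l.Pairwise (· < ·)) {q : ℕ} (hq : q ∈ l) :
    l[(l.filter (· < q)).length]? = some q := by
  induction l with
  | nil => simp at hq
  | cons a l ih =>
    rw [List.pairwise_cons] at hl
    by_cases h : q = a
    · subst h
      have : (q :: l).filter (· < q) = [] := by
        rw [List.filter_eq_nil_iff]
        intro b hb
        rcases List.mem_cons.1 hb with rfl | hb
        · simp
        · simpa using (hl.1 b hb).le
      simp [this]
    · have hq : q ∈ l := (List.mem_cons.1 hq).resolve_left h
      rw [List.filter_cons_of_pos (by simpa using hl.1 q hq), List.length_cons,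
        List.getElem?_cons_succ]
      exact ih hl.2 hq

theorem FA.sort_pos (F : FA L) {q : ℕ} (hq : q ∈ F.states) :
    F.states.sort[F.pos q]? = some q := by
  have h := getElem?_length_filter_lt (l := F.states.sort) (q := q)
    F.states.sortedLT_sort.pairwise (by simpa using hq)
  convert h using 2
  rw [FA.pos, ← List.toFinset_card_of_nodup ((Finset.sort_nodup _ _).filter _),
    List.toFinset_filter, Finset.sort_toFinset]
  simp

theorem FA.pos_lt (F : FA L) {q : ℕ} (hq : q ∈ F.states) : F.pos q < F.states.card := by
  have := (List.getElem?_eq_some_iff.1 (F.sort_pos hq)).1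
  simpa using this

theorem FA.pos_inj (F : FA L) {q q' : ℕ} (hq : q ∈ F.states) (hq' : q' ∈ F.states)
    (h : F.pos q = F.pos q') : q = q' := by
  have := F.sort_pos hq
  rw [h, F.sort_pos hq'] at this
  exact (Option.some.inj this).symm

theorem FA.exists_pos (F : FA L) {i : ℕ} (hi : i < F.states.card) :
    ∃ q ∈ F.states, F.pos q = i := by
  have hi' : i < F.states.sort.length := by simpa using hi
  have hq : F.states.sort[i] ∈ F.states := by
    rw [← Finset.mem_sort (· ≤ ·)]; exact List.getElem_mem hi'
  refine ⟨_, hq, ?_⟩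
  obtain ⟨h1, h2⟩ := List.getElem?_eq_some_iff.1 (F.sort_pos hq)
  exact ((Finset.sort_nodup F.states (· ≤ ·)).getElem_inj_iff).1 h2

/-- The bit table of a set of states. -/
def FA.table (F : FA L) (S : Finset ℕ) : List Bool := F.states.sort.map fun q => decide (q ∈ S)

theorem FA.bit_table (F : FA L) {S : Finset ℕ} {q : ℕ} (hq : q ∈ F.states) :
    bit (F.table S) (F.pos q) ↔ q ∈ S := by
  rw [bit_iff, FA.table, List.getElem?_map, F.sort_pos hq]
  simp

end position

/-! ### The nondeterministic automaton recognizes the canonical forms -/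

section canonLang

variable {α : Type*} [LinearOrder α] {w : ℕ} {F : FA (Layer α)}

/-- The canonical forms of the diagrams accepted by `F`. -/
def canonLang (w : ℕ) (F : FA (Layer α)) : Set (List (Layer α)) :=
  {C | ∃ D ∈ F.lang, IsCanonicalForm w D C}

theorem canonLang_over {C : List (Layer α)} (hC : C ∈ canonLang w F) :
    ∀ B ∈ C, B ∈ layerAlphabet α (2 ^ w) := by
  obtain ⟨D, -, hc⟩ := hC
  exact hc.1.1.2.1

theorem head_initFlag_of_mem_canonLang {B : Layer α} {C : List (Layer α)}
    (hC : B :: C ∈ canonLang w F) : B.initFlag = true := by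
  obtain ⟨D, -, hc⟩ := hC
  exact (hc.1.1.2.2.2.1 0 (by simp)).2 rfl

end canonLang

section automaton

variable {α : Type*} [LinearOrder α] [Fintype α]

/-- The description of the transitions of an automaton. -/
def FA.table₃ (w : ℕ) (F : FA (Layer α)) (l : List (ℕ × Layer α × ℕ)) : List Tr :=
  l.map fun t => (F.pos t.1, t.2.1.bits w, F.pos t.2.2, ())

theorem stepL_sorted {w : ℕ} {v : List Bool} {c : Code} {B : Layer α} (hb : Codes (w, v) B)
    {f f' : Pairs} {ok : Bool} (h : StepL (Fintype.card α) w f (w, v) c f' ok) :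
    ∀ e ∈ f', e.1 = sortedList w e.1.toFinset := by
  intro e' he'
  obtain ⟨e, -, i, hi, h3, -⟩ := h.2.2.1.2 e' he'
  obtain ⟨a, ha⟩ := exists_letter (α := α) (List.mem_range.1 hi)
  rw [h3, toFinset_stepL hb ha, stepL_eq hb ha]

variable {w W K : ℕ} {F : FA (Layer α)} {l : List (ℕ × Layer α × ℕ)}

/-- A run of the automaton on `Cs` guesses a path of `F`, labelled `D`, together with a simultaneous
run on `D` and `Cs`. Completeness needs the pairs of the simultaneous run to be among the enumerated
lists, which their functionality guarantees. -/
theorem nAcc_iff (hF : F.IsOver (layerAlphabet α w)) (hl : ∀ t, t ∈ l ↔ t ∈ F.trans)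
    (hw : W = 2 ^ w) (hK : (W + 1) ^ W ≤ K) {Cs : List (Layer α)} :
    ∀ {q : ℕ} {f : Pairs} {ok : Bool}, q ∈ F.states → (∀ C ∈ Cs, C ∈ layerAlphabet α W) →
    (NAcc (nStates K F.states.card w W) (NTrans (Fintype.card α) w (F.table₃ w l))
      (NFinal (F.table F.final)) (Cs.map Layer.code) (F.pos q, f, ok) ↔
    ∃ D, ∃ q' ∈ F.final, F.Reaches D q q' ∧ SimI w (pairSet f) (ok = true) D Cs) := by
  induction Cs with
  | nil =>
    intro q f ok hq _
    rw [List.map_nil, NAcc, NFinal, F.bit_table hq]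
    constructor
    · rintro ⟨h1, h2⟩; exact ⟨[], q, h1, rfl, h2⟩
    · rintro ⟨D, q', h1, h2, h3⟩
      cases D with
      | nil => rw [show q = q' from h2]; exact ⟨h1, h3⟩
      | cons B D => exact h3.elim
  | cons C Cs ih =>
    intro q f ok hq hCs
    have hC : C ∈ layerAlphabet α (2 ^ w) := hw ▸ hCs C (by simp)
    have hCs' : ∀ C ∈ Cs, C ∈ layerAlphabet α W := fun C hC => hCs C (by simp [hC])
    rw [List.map_cons, NAcc]
    constructor
    · rintro ⟨⟨p, f', ok'⟩, -, ⟨hgood, τ, hτ, ⟨h1, h2⟩, h3⟩, hacc⟩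
      obtain ⟨⟨q₁, B, q₂⟩, ht, rfl⟩ := List.mem_map.1 hτ
      have ht' := (hl _).1 ht
      obtain ⟨hq₁, hq₂⟩ := F.trans_mem _ _ _ ht'
      obtain rfl : q₁ = q := F.pos_inj hq₁ hq h1
      obtain rfl : F.pos q₂ = p := h2
      have hb : Codes (w, B.bits w) B := ⟨hF _ _ _ ht', rfl⟩
      rw [stepL_iff hb (codes_code C) ((good_iff (codes_code C) hC).1 hgood)
        (stepL_sorted hb h3), pairSet_startL hb] at h3
      obtain ⟨D, q', hq', hr, hs⟩ := (ih hq₂ hCs').1 hacc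
      exact ⟨B :: D, q', hq', ⟨q₂, ht', hr⟩, _, _, h3, hs⟩
    · rintro ⟨D, q', hq', hr, hs⟩
      cases D with
      | nil => exact hs.elim
      | cons B D =>
        obtain ⟨r, ht, hr⟩ := hr
        obtain ⟨f', ok', hm, hs⟩ := hs
        obtain ⟨b, rfl⟩ : ∃ b : Bool, ok' = (b = true) := by
          classical exact ⟨decide ok', by simp⟩
        have hb : Codes (w, B.bits w) B := ⟨hF _ _ _ ht, rfl⟩
        -- First components arise from steps of `B`, of width `w`; second components are right
        -- states of `C`, of width `2 ^ w`.
        obtain ⟨f₁, hf₁, rfl, hsort⟩ := exists_pairList (f := f') hw hK (by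
          intro e he
          have he2 : e.2 ∈ C.right := (hm.2.2.2.2.1 _).2 ⟨e, he, rfl⟩
          rw [hm.2.2.2.1] at he
          obtain ⟨e', -, a, h1, -⟩ := he
          refine ⟨h1 ▸ (stepF_subset _ _ _).trans hb.1.2, ?_⟩
          rw [hw]
          simpa using hC.2 he2) hm.2.2.2.2.2.1
        obtain ⟨-, hrs⟩ := F.trans_mem _ _ _ ht
        refine ⟨(F.pos r, f₁, b), mem_nStates.2 ⟨F.pos_lt hrs, hf₁⟩, ⟨?_, _,
          List.mem_map_of_mem ((hl _).2 ht), ⟨rfl, rfl⟩, ?_⟩, (ih hrs hCs').2 ⟨D, q', hq', hr, hs⟩⟩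
        · exact (good_iff (codes_code C) hC).2 hm.1
        · show StepL _ _ _ (w, B.bits w) _ _ _
          rw [stepL_iff hb (codes_code C) hm.1 hsort, pairSet_startL hb]
          exact hm

theorem exists_nInit_nAcc_iff [Nonempty α] (hF : F.IsSOFA w) (hl : ∀ t, t ∈ l ↔ t ∈ F.trans)
    (hw : W = 2 ^ w) (hK : (W + 1) ^ W ≤ K) {Cs : List (Layer α)}
    (hCs : ∀ C ∈ Cs, C ∈ layerAlphabet α W) :
    (∃ x ∈ nInit K F.states.card w W (F.table F.init),
      NAcc (nStates K F.states.card w W) (NTrans (Fintype.card α) w (F.table₃ w l))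
      (NFinal (F.table F.final)) (Cs.map Layer.code) x) ↔ Cs ∈ canonLang w F := by
  have hempty : pairSet [] = ∅ := by ext; simp [pairSet]
  constructor
  · rintro ⟨⟨i, f, ok⟩, hx, hacc⟩
    obtain ⟨hx1, hx2, hx3, hx4⟩ := mem_lfilter.1 hx
    obtain ⟨q, hq, rfl⟩ := F.exists_pos (mem_nStates.1 hx1).1
    obtain ⟨D, q', hq', hr, hs⟩ := (nAcc_iff hF.1 hl hw hK hq hCs).1 hacc
    have hD : D ∈ F.lang := ⟨q, (F.bit_table hq).1 hx2, q', hq', hr⟩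
    refine ⟨D, hD, (isCanonicalForm_iff (hF.2 D hD)).2 ?_⟩
    rw [show f = [] from hx3, hempty] at hs
    exact (simI_iff_canon (hF.2 D hD)).1 hs
  · rintro ⟨D, ⟨q, hq, q', hq', hr⟩, hcan⟩
    have hD : D ∈ F.lang := ⟨q, hq, q', hq', hr⟩
    have hqs := F.init_subset hq
    refine ⟨(F.pos q, [], false), mem_lfilter.2 ⟨mem_nStates.2 ⟨F.pos_lt hqs,
      nil_mem_pairLists hw hK⟩, (F.bit_table hqs).2 hq, rfl, rfl⟩,
      (nAcc_iff hF.1 hl hw hK hqs hCs).2 ⟨D, q', hq', hr, ?_⟩⟩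
    rw [hempty]
    exact (simI_iff_canon (hF.2 D hD)).2 ((isCanonicalForm_iff (hF.2 D hD)).1 hcan)

/-- The layer without states and flags. -/
def emptyLayer (α : Type*) : Layer α where
  left := ∅
  right := ∅
  trans := ∅
  init := ∅
  final := ∅
  initFlag := false
  finalFlag := false
  trans_mem := by simp
  init_subset := by simp
  final_subset := by simp
  init_eq_empty := fun _ => rfl
  final_eq_empty := fun _ => rfl

theorem emptyLayer_bits : (emptyLayer α).bits (emptyLayer α).width = [false, false] := by
  have : (emptyLayer α).width = 0 := by simp [Layer.width, emptyLayer]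
  rw [this]
  simp [Layer.bits, emptyLayer]

theorem emptyLayer_lt {B : Layer α} (hB : B.width ≠ 0) : Layer.Lt (emptyLayer α) B := by
  rw [Layer.Lt, emptyLayer_bits]
  refine .of_length_lt ?_
  rw [length_bits]
  simp only [codeLen, List.length_cons, List.length_nil]
  omega

/-- A word with a letter outside the alphabet has no extension that is a canonical form. Neither has
the one-letter word of the empty layer, since canonical forms begin with a layer carrying the
initial flag. The foreign letter has positive width, so the empty layer precedes it, and the word
cannot be the first of its class. Hence enlarging the alphabet does not change the first words. -/
theorem minRep_over {u : List (Layer α)} (hu : MinRep Layer.Lt (canonLang w F) u) :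
    ∀ B ∈ u, B ∈ layerAlphabet α (2 ^ w) := by
  by_contra hcon
  push Not at hcon
  obtain ⟨B, hB, hBw⟩ := hcon
  have hBw' : B.width ≠ 0 := fun h => hBw (width_le_iff.1 (by rw [h]; exact Nat.zero_le _))
  refine hu [emptyLayer α] ?_ fun z => ?_
  · cases u with
    | nil => simp at hB
    | cons A u =>
      cases u with
      | nil =>
        obtain rfl : B = A := by simpa using hB
        exact .of_lex rfl (.rel (emptyLayer_lt hBw'))
      | cons A' u => exact .of_length_lt (by simp)
  · refine iff_of_false (fun h => ?_) fun h => hBw (canonLang_over h B (by simp [hB]))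
    have := head_initFlag_of_mem_canonLang h
    simp [emptyLayer] at this

end automaton

end SecondOrder

namespace SecondOrder

/-! ### The minimal automaton of the canonical forms -/

/-- The bits at width `W` of a layer of smaller width given by its code. -/
noncomputable def outBits (s W : ℕ) (c : Code) : List Bool :=
  (List.range W).map (fun p => toBool (c.L p)) ++
  (List.range W).map (fun q => toBool (c.R q)) ++
  (List.range W).flatMap (fun p => (List.range s).flatMap fun a =>
    (List.range W).map fun q => toBool (c.T s p a q)) ++
  (List.range W).map (fun p => toBool (c.I s p)) ++
  (List.range W).map (fun q => toBool (c.F s q)) ++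
  [toBool (c.iFlag s), toBool (c.fFlag s)]

/-- The descriptions of initial states, final states and transitions of the automaton whose
states are the sets in `R`. -/
noncomputable def outTuple (s W : ℕ) (Qs : List NSt) (Ls : List Code) (w : ℕ) (tr : List Tr)
    (fb : List Bool) (𝒴 R : List (List NSt)) :
    ℕ × ℕ × ℕ × List Bool × List Bool × List Tr × Unit :=
  (s, W, R.length, (List.range R.length).map (fun i => toBool (i = 0)),
    R.map (fun X => toBool (exIn X fun x => NFinal fb x)),
    (lfilter ((List.range R.length).product (Ls.product (List.range R.length))) fun t =>
      exIn ((R.drop t.1).take 1) fun X => exIn ((R.drop t.2.2).take 1) fun Y =>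
        Eqv 𝒴 (del Qs (NTrans s w tr) X t.2.1) Y).map fun t =>
          (t.1, outBits s W t.2.1, t.2.2, ()),
    ())

/-- The description of the minimal automaton, where the fuel `K` bounds the numbers of objects that
are enumerated. -/
noncomputable def mainOut (K W s w n : ℕ) (ib fb : List Bool) (tr : List Tr) :
    ℕ × ℕ × ℕ × List Bool × List Bool × List Tr × Unit :=
  outTuple s W (nStates K n w W) (letters K s W) w tr fb
    (pres (nStates K n w W) (letters K s W) (NTrans s w tr) (NFinal fb) K)
    ((repStep (nStates K n w W) (letters K s W) (NTrans s w tr)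
      (pres (nStates K n w W) (letters K s W) (NTrans s w tr) (NFinal fb) K))^[K]
        [nInit K n w W ib])

theorem flatMap_range_eq {β γ : Type*} (l : List β) {f : ℕ → List γ} {g : β → List γ}
    (h : ∀ i a, l[i]? = some a → f i = g a) : (List.range l.length).flatMap f = l.flatMap g := by
  rw [List.flatMap_def, List.flatMap_def]
  congr 1
  refine List.ext_getElem (by simp) fun i h1 h2 => ?_
  simp only [List.getElem_map, List.getElem_range]
  exact h i _ (List.getElem?_eq_getElem (by simpa using h1))

theorem product_map {β γ δ ε : Type*} (f : β → δ) (g : γ → ε) (l : List β) (l' : List γ) :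
    (l.map f).product (l'.map g) = (l.product l').map (Prod.map f g) := by
  simp [List.product, List.flatMap_map, List.map_flatMap, Function.comp_def]

theorem mem_product_iff {β γ : Type*} {l : List β} {l' : List γ} {b : β} {c : γ} :
    (b, c) ∈ l.product l' ↔ b ∈ l ∧ c ∈ l' := List.mem_product

theorem exIn_drop_take_one {β : Type} {l : List β} {i : ℕ} (hi : i < l.length) {p : β → Prop} :
    exIn ((l.drop i).take 1) p ↔ p l[i] := by
  simp [exIn, List.take_one, List.head?_drop, List.getElem?_eq_getElem hi]

section correctness

variable {α : Type*} [LinearOrder α] [Fintype α]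

theorem outBits_eq {c : Code} {B : Layer α} (hc : Codes c B) (W : ℕ) :
    outBits (Fintype.card α) W c = B.bits W := by
  obtain ⟨hL, hR, hT, hI, hF, hi, hf⟩ := codes_iff hc
  have hT' : ∀ {p i q a}, IsLetter i a → (c.T (Fintype.card α) p i q ↔ (p, a, q) ∈ B.trans) :=
    fun {p i q a} ha => by
      rw [hT]; exact ⟨fun ⟨b, hb, h⟩ => ha.unique hb ▸ h, fun h => ⟨a, ha, h⟩⟩
  have hb : ∀ {p q : Prop} [Decidable q], (p ↔ q) → toBool p = decide q := fun {p q} _ h => by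
    rw [Bool.eq_iff_iff, toBool_eq_true, h, decide_eq_true_iff]
  have hlen : (Finset.univ : Finset α).sort.length = Fintype.card α := by simp
  rw [outBits, Layer.bits]
  congr 1
  · congr 1
    · congr 1
      · congr 1
        · congr 1
          · exact List.map_congr_left fun p _ => hb (hL p)
          · exact List.map_congr_left fun p _ => hb (hR p)
        · congr 1
          funext p
          rw [← hlen]
          exact flatMap_range_eq _ fun i a ha => List.map_congr_left fun q _ => hb (hlen ▸ hT' ha)
      · exact List.map_congr_left fun p _ => hb (hI p)
    · exact List.map_congr_left fun p _ => hb (hF p)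
  · rw [List.cons.injEq, List.cons.injEq]
    exact ⟨by rw [Bool.eq_iff_iff, toBool_eq_true, hi],
      by rw [Bool.eq_iff_iff, toBool_eq_true, hf], rfl⟩

theorem layerAlphabet_finite (W : ℕ) : (layerAlphabet α W).Finite := by
  obtain ⟨Ls, -, -, h⟩ := exists_letters (α := α) (W := W) le_rfl
  exact (List.finite_toSet Ls).subset fun B hB => (h B).2 hB

/-- The alphabet of layers as a finite set. -/
noncomputable def layerFinset (α : Type*) [LinearOrder α] [Fintype α] (W : ℕ) :
    Finset (Layer α) := (layerAlphabet_finite W).toFinset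

theorem coe_layerFinset (W : ℕ) : (layerFinset α W : Set (Layer α)) = layerAlphabet α W := by
  simp [layerFinset]

theorem mem_layerFinset {W : ℕ} {B : Layer α} : B ∈ layerFinset α W ↔ B ∈ layerAlphabet α W := by
  simp [layerFinset]

/-- The second canonical form of an automaton. -/
noncomputable def secondCanon (w : ℕ) (F : FA (Layer α)) : FA (Layer α) :=
  minFA Layer.Lt (canonLang w F) (layerFinset α (2 ^ w))

variable [Nonempty α] {w W K : ℕ} {F : FA (Layer α)}

theorem isRepList_canonLang {l : List (ℕ × Layer α × ℕ)} (hF : F.IsSOFA w)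
    (hl : ∀ t, t ∈ l ↔ t ∈ F.trans) (hw : W = 2 ^ w) (hK : (W + 1) ^ W ≤ K)
    (hKn : 2 ^ (F.states.card * ((W + 1) ^ W * 2)) ≤ K) {Bs : List (Layer α)}
    (hBs : letters K (Fintype.card α) W = Bs.map Layer.code) (hBs' : Bs.Pairwise Layer.Lt)
    (hmem : ∀ B, B ∈ Bs ↔ B ∈ layerAlphabet α W) :
    IsRepList Layer.Lt (canonLang w F) ((addRep (canonLang w F) Bs)^[K] [[]]) := by
  have hover : ∀ C ∈ canonLang w F, ∀ B ∈ C, B ∈ Bs := fun C hC B hB =>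
    (hmem B).2 (hw ▸ canonLang_over hC B hB)
  refine isRepList_iterate_addRep layer_lt_wf hBs'
    (fun u hu B hB => (hmem B).2 (hw ▸ minRep_over hu B hB)) fun R hR hR' => ?_
  exact length_le_of_pairwise_not_ner (Qs := nStates K F.states.card w W)
    (t := NTrans (Fintype.card α) w (F.table₃ w l)) (fin := NFinal (F.table F.final)) hBs
    (by rwa [length_nStates _ hw hK]) (X₀ := nInit K F.states.card w W (F.table F.init))
    ⟨_, rfl⟩ hover (fun u hu => exists_nInit_nAcc_iff hF hl hw hK fun B hB => (hmem B).1 (hu B hB))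
    hR hR'

theorem exists_isRepList (hF : F.IsSOFA w) :
    ∃ R, IsRepList Layer.Lt (canonLang w F) R := by
  obtain ⟨K, hK1, hK2, hK3⟩ : ∃ K, (2 ^ w + 1) ^ 2 ^ w ≤ K ∧
      2 ^ (F.states.card * ((2 ^ w + 1) ^ 2 ^ w * 2)) ≤ K ∧
      2 ^ codeLen (Fintype.card α) (2 ^ w) ≤ K :=
    ⟨max _ (max _ _), le_max_left _ _, (le_max_left _ _).trans (le_max_right _ _),
      (le_max_right _ _).trans (le_max_right _ _)⟩
  obtain ⟨Bs, h1, h2, h3⟩ := exists_letters hK3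
  exact ⟨_, isRepList_canonLang (l := F.trans.toList) hF (by simp) rfl hK1 hK2 h1 h2 h3⟩

/-- The sets found by `repStep` are those reached by the first words in `R`. So equivalence of the
successor of the `i`-th set under a letter `B` with the `j`-th set is Nerode equivalence of `R[i]`
followed by `B` with `R[j]`, and a set meets the final states if and only if its word belongs to the
language. -/
theorem mainOut_encodes {l : List (ℕ × Layer α × ℕ)} (hF : F.IsSOFA w)
    (hl : ∀ t, t ∈ l ↔ t ∈ F.trans) (hw : W = 2 ^ w) (hK : (W + 1) ^ W ≤ K)
    (hKn : 2 ^ (F.states.card * ((W + 1) ^ W * 2)) ≤ K)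
    (hKs : 2 ^ codeLen (Fintype.card α) W ≤ K) :
    (secondCanon w F).Encodes (2 ^ w) (Enc.enc (mainOut K W (Fintype.card α) w F.states.card
      (F.table F.init) (F.table F.final) (F.table₃ w l))) := by
  classical
  obtain ⟨Bs, hBs, hBs', hmem⟩ := exists_letters (α := α) hKs
  set 𝓛 := canonLang w F with h𝓛
  set Qs := nStates K F.states.card w W with hQs
  set t := NTrans (Fintype.card α) w (F.table₃ w l) with ht
  set fin := NFinal (F.table F.final) with hfin
  set X₀ := nInit K F.states.card w W (F.table F.init) with hX₀
  have hX₀' : ∀ x ∈ X₀, x ∈ Qs := fun x hx => (mem_lfilter.1 hx).1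
  have hQK : 2 ^ Qs.length ≤ K := by rwa [length_nStates _ hw hK]
  have hover : ∀ C ∈ 𝓛, ∀ B ∈ C, B ∈ Bs := fun C hC B hB =>
    (hmem B).2 (hw ▸ canonLang_over hC B hB)
  have hacc : ∀ u : List (Layer α), (∀ B ∈ u, B ∈ Bs) →
      ((∃ x ∈ X₀, NAcc Qs t fin (u.map Layer.code) x) ↔ u ∈ 𝓛) :=
    fun u hu => exists_nInit_nAcc_iff hF hl hw hK fun B hB => (hmem B).1 (hu B hB)
  have hrep := isRepList_canonLang hF hl hw hK hKn hBs hBs' hmem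
  obtain ⟨hit, hRBs⟩ := iterate_repStep (Ls := letters K (Fintype.card α) W) hBs hQK hX₀' hover
    hacc K
  set R := (addRep 𝓛 Bs)^[K] [[]] with hR
  set run : List (Layer α) → List NSt := fun u => (u.map Layer.code).foldl (del Qs t) X₀ with hrun
  rw [secondCanon, minFA_eq layer_lt_wf hrep]
  -- The states form an initial segment, so each is its own position.
  have hpos : ∀ i < R.length, ((Finset.range R.length).filter (· < i)).card = i := by
    intro i hi
    rw [show (Finset.range R.length).filter (· < i) = Finset.range i by
      ext j; simp; omega, Finset.card_range]
  have hget : ∀ i (hi : i < R.length), R.getD i [] = R[i] := fun i hi => by simp [hi]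
  refine ⟨lfilter ((List.range R.length).product (Bs.product (List.range R.length))) fun t =>
    Ner 𝓛 (R.getD t.1 [] ++ [t.2.1]) (R.getD t.2.2 []), ?_, ?_, ?_⟩
  · refine List.Nodup.sublist (lfilter_sublist _ _) ?_
    exact List.nodup_range.product
      ((nodup_of_pairwise_wf layer_lt_wf hBs').product List.nodup_range)
  · rintro ⟨i, B, j⟩
    rw [mem_lfilter, mem_repFA_trans, mem_product_iff, mem_product_iff, mem_layerFinset, hmem, hw]
    simp only [List.mem_range]
    tauto
  · rw [mainOut, outTuple, ← hQs, ← ht, ← hX₀, hit]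
    simp only [repFA, Finset.card_range, Finset.sort_range, List.length_map]
    have e1 : (List.range R.length).map (fun i => toBool (i = 0)) =
        (List.range R.length).map fun q => decide (q ∈ (Finset.range R.length).filter (· = 0)) := by
      refine List.map_congr_left fun i hi => ?_
      rw [Bool.eq_iff_iff, toBool_eq_true, decide_eq_true_iff, Finset.mem_filter]
      simpa using fun _ => List.mem_range.1 hi
    have e2 : (R.map run).map (fun X => toBool (exIn X fun x => fin x)) =
        (List.range R.length).map fun q => decide (q ∈ (Finset.range R.length).filter
          fun i => R.getD i [] ∈ 𝓛) := by
      refine List.ext_getElem (by simp) fun i h1 h2 => ?_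
      have hi : i < R.length := by simpa using h1
      simp only [List.getElem_map, List.getElem_range]
      rw [Bool.eq_iff_iff, toBool_eq_true, decide_eq_true_iff, Finset.mem_filter, hget i hi,
        ← hacc _ (hRBs _ (List.getElem_mem hi))]
      have := exIn_foldl_del_NAcc (Qs := Qs) (t := t) (fin := fin) (z := [])
        (u := R[i].map Layer.code) (X := X₀)
      rw [List.append_nil] at this
      rw [← this]
      simp only [Finset.mem_range, hi, true_and]
      exact Iff.rfl
    -- Both listings run through the same product in the same order; letters correspond to their
    -- codes, and the two filters agree.
    have e3 : (lfilter ((List.range R.length).product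
        ((letters K (Fintype.card α) W).product (List.range R.length))) fun τ =>
          exIn (((R.map run).drop τ.1).take 1) fun X => exIn (((R.map run).drop τ.2.2).take 1)
            fun Y => Eqv (pres Qs (letters K (Fintype.card α) W) t fin K)
              (del Qs t X τ.2.1) Y).map (fun τ =>
                ((τ.1, outBits (Fintype.card α) W τ.2.1, τ.2.2, ()) : Tr)) =
        (lfilter ((List.range R.length).product (Bs.product (List.range R.length))) fun t =>
          Ner 𝓛 (R.getD t.1 [] ++ [t.2.1]) (R.getD t.2.2 [])).map fun τ =>
            (((Finset.range R.length).filter (· < τ.1)).card, τ.2.1.bits (2 ^ w),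
              ((Finset.range R.length).filter (· < τ.2.2)).card, ()) := by
      have hprod : (List.range R.length).product
          ((letters K (Fintype.card α) W).product (List.range R.length)) =
          ((List.range R.length).product (Bs.product (List.range R.length))).map
            (Prod.map id (Prod.map Layer.code id)) := by
        rw [← product_map, ← product_map, ← hBs, List.map_id]
      rw [hprod, lfilter_map, List.map_map]
      have hfilter : (lfilter ((List.range R.length).product (Bs.product (List.range R.length)))
          fun τ => exIn (((R.map run).drop τ.1).take 1) fun X =>
            exIn (((R.map run).drop τ.2.2).take 1) fun Y =>
              Eqv (pres Qs (letters K (Fintype.card α) W) t fin K)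
                (del Qs t X τ.2.1.code) Y) =
          lfilter ((List.range R.length).product (Bs.product (List.range R.length))) fun t =>
            Ner 𝓛 (R.getD t.1 [] ++ [t.2.1]) (R.getD t.2.2 []) := by
        refine lfilter_congr ?_
        rintro ⟨i, B, j⟩ hτ
        rw [mem_product_iff, mem_product_iff, List.mem_range, List.mem_range] at hτ
        obtain ⟨hi, hB, hj⟩ := hτ
        rw [exIn_drop_take_one (by simpa using hi), exIn_drop_take_one (by simpa using hj),
          List.getElem_map, List.getElem_map, hget i hi, hget j hj,
          ← eqv_iff_ner (Ls := letters K (Fintype.card α) W) hBs hQK hX₀' hover hacc ?_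
            (hRBs _ (List.getElem_mem hj))]
        · simp [hrun]
        · intro a ha
          rcases List.mem_append.1 ha with ha | ha
          · exact hRBs _ (List.getElem_mem hi) a ha
          · simp at ha; rwa [ha]
      refine Eq.trans (congrArg (List.map _) hfilter) (List.map_congr_left ?_)
      rintro ⟨i, B, j⟩ hτ
      have hτ := (mem_lfilter.1 hτ).1
      rw [mem_product_iff, mem_product_iff, List.mem_range, List.mem_range] at hτ
      simp only [Function.comp, Prod.map, id, hpos i hτ.1, hpos j hτ.2.2,
        outBits_eq (codes_code B), hw]
    rw [e1, e2, e3, hw]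
    simp only [Enc.enc, Dat.list, Dat.boolList, List.map_map, Function.comp_def]
    congr!

end correctness

end SecondOrder

namespace SecondOrder

/-! ### The running time of the construction -/

section enumeration

variable {α δ : Type} [Enc α] [Enc δ]

@[fun_prop]
theorem PT.genStep {H acc : α → List (List δ)} (hH : PT H) (hacc : PT acc) :
    PT fun x => genStep (H x) (acc x) := by
  unfold SecondOrder.genStep; fun_prop

/-- At most `K + 1` words are kept, and each consists of one word from each factor, so its size is
at most that of the list of factors. -/
theorem size_genK_le (K : ℕ) (l : List (List (List δ))) :
    size (l.foldl (fun acc H => (genStep H acc).take K) [[]]) ≤ (K + 1) * (size l + 1) + 1 := by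
  have h1 : (l.foldl (fun acc H => (genStep H acc).take K) [[]]).length ≤ K + 1 := by
    rcases List.eq_nil_or_concat' l with rfl | ⟨l, H, rfl⟩
    · simp
    · rw [List.foldl_append, List.foldl_cons, List.foldl_nil, List.length_take]
      omega
  have h2 : ∀ z ∈ l.foldl (fun acc H => (genStep H acc).take K) [[]], size z ≤ size l := by
    clear h1
    induction l using List.reverseRecOn with
    | nil => simp
    | append_singleton l H ih =>
      intro z hz
      rw [List.foldl_append, List.foldl_cons, List.foldl_nil] at hz
      have hz := List.mem_of_mem_take hz
      simp only [SecondOrder.genStep, List.mem_flatMap, List.mem_map] at hz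
      obtain ⟨y, hy, z', hz', rfl⟩ := hz
      have e1 := ih z' hz'
      have e2 := size_le_of_mem hy
      have e3 := size_append y z'
      have e4 := size_append l [H]
      simp only [size_cons, size_nil] at e4
      omega
  refine (size_le_of_forall h2).trans ?_
  gcongr

@[fun_prop]
theorem PT.genK {K : α → ℕ} {l : α → List (List (List δ))} (hK : PT K) (hl : PT l) :
    PT fun x => genK (K x) (l x) := by
  unfold SecondOrder.genK
  refine PT.foldl (g := fun x acc H => (SecondOrder.genStep H acc).take (K x)) (by fun_prop)
    (by fun_prop) (by fun_prop) (u := fun x => (size (K x) + 1) * (size (l x) + 1) + 1)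
    (((hK.size_le.add (PB.const 1)).mul (hl.size_le.add (PB.const 1))).add (PB.const 1)) ?_
  intro x l₁ l₂ h
  refine (size_genK_le (K x) l₁).trans ?_
  have h1 : size l₁ ≤ size (l x) := by
    rw [← size_reverse (l x), h]
    exact size_le_of_sublist (List.sublist_append_left _ _)
  have h2 : K x ≤ size (K x) := by rw [size_nat]; omega
  gcongr

@[fun_prop]
theorem PT.subsK {K : α → ℕ} {l : α → List δ} (hK : PT K) (hl : PT l) :
    PT fun x => subsK (K x) (l x) := by
  unfold SecondOrder.subsK; fun_prop

@[fun_prop]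
theorem PT.allBits {K m : α → ℕ} (hK : PT K) (hm : PT m) : PT fun x => allBits (K x) (m x) := by
  unfold SecondOrder.allBits; fun_prop

@[fun_prop]
theorem PT.product {β γ : Type} [Enc β] [Enc γ] {l : α → List β} {l' : α → List γ} (hl : PT l)
    (hl' : PT l') : PT fun x => (l x).product (l' x) := by
  unfold List.product; fun_prop

end enumeration

/-! ### Predicates on codes are polynomial -/

section codes

variable {α : Type} [Enc α]

@[fun_prop]
theorem PT.bit {v : α → List Bool} {i : α → ℕ} (hv : PT v) (hi : PT i) :
    PT fun x => bit (v x) (i x) := by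
  unfold SecondOrder.bit; fun_prop

@[fun_prop]
theorem PT.codeLen {s u : α → ℕ} (hs : PT s) (hu : PT u) : PT fun x => codeLen (s x) (u x) := by
  unfold SecondOrder.codeLen; fun_prop

variable {s : α → ℕ} {c : α → Code} {p a q : α → ℕ}

@[fun_prop]
theorem PT.codeL (hc : PT c) (hp : PT p) : PT fun x => (c x).L (p x) := by
  unfold Code.L; fun_prop

@[fun_prop]
theorem PT.codeR (hc : PT c) (hp : PT p) : PT fun x => (c x).R (p x) := by
  unfold Code.R; fun_prop

@[fun_prop]
theorem PT.codeT (hs : PT s) (hc : PT c) (hp : PT p) (ha : PT a) (hq : PT q) :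
    PT fun x => (c x).T (s x) (p x) (a x) (q x) := by
  unfold Code.T; fun_prop

@[fun_prop]
theorem PT.codeI (hs : PT s) (hc : PT c) (hp : PT p) : PT fun x => (c x).I (s x) (p x) := by
  unfold Code.I; fun_prop

@[fun_prop]
theorem PT.codeF (hs : PT s) (hc : PT c) (hp : PT p) : PT fun x => (c x).F (s x) (p x) := by
  unfold Code.F; fun_prop

@[fun_prop]
theorem PT.code_iFlag (hs : PT s) (hc : PT c) : PT fun x => (c x).iFlag (s x) := by
  unfold Code.iFlag; fun_prop

@[fun_prop]
theorem PT.code_fFlag (hs : PT s) (hc : PT c) : PT fun x => (c x).fFlag (s x) := by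
  unfold Code.fFlag; fun_prop

@[fun_prop]
theorem PT.code_valid (hs : PT s) (hc : PT c) : PT fun x => (c x).Valid (s x) := by
  unfold Code.Valid; fun_prop

@[fun_prop]
theorem PT.letters {K W : α → ℕ} (hK : PT K) (hs : PT s) (hW : PT W) :
    PT fun x => letters (K x) (s x) (W x) := by
  unfold SecondOrder.letters; fun_prop

@[fun_prop]
theorem PT.code_det (hs : PT s) (hc : PT c) : PT fun x => (c x).Det (s x) := by
  unfold Code.Det; fun_prop

@[fun_prop]
theorem PT.code_total (hs : PT s) (hc : PT c) : PT fun x => (c x).Total (s x) := by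
  unfold Code.Total; fun_prop

@[fun_prop]
theorem PT.code_contig (hc : PT c) : PT fun x => (c x).Contig := by
  unfold Code.Contig; fun_prop

@[fun_prop]
theorem PT.code_ordered (hs : PT s) (hc : PT c) : PT fun x => (c x).Ordered (s x) := by
  unfold Code.Ordered; fun_prop

@[fun_prop]
theorem PT.code_reduced (hs : PT s) (hc : PT c) : PT fun x => (c x).Reduced (s x) := by
  unfold Code.Reduced; fun_prop

@[fun_prop]
theorem PT.code_good (hs : PT s) (hc : PT c) : PT fun x => (c x).Good (s x) := by
  unfold Code.Good; fun_prop

@[fun_prop]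
theorem PT.outBits {W : α → ℕ} (hs : PT s) (hW : PT W) (hc : PT c) :
    PT fun x => outBits (s x) (W x) (c x) := by
  unfold SecondOrder.outBits; fun_prop

end codes

/-! ### The automaton and its minimization are polynomial -/

section nfa

variable {α : Type} [Enc α] {s w W K n : α → ℕ} {b c : α → Code} {f f' : α → Pairs}

@[fun_prop]
theorem PT.stepL {S : α → List ℕ} {i : α → ℕ} (hs : PT s) (hw : PT w) (hb : PT b) (hS : PT S)
    (hi : PT i) : PT fun x => stepL (s x) (w x) (b x) (S x) (i x) := by
  unfold SecondOrder.stepL; fun_prop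

@[fun_prop]
theorem PT.startL (hs : PT s) (hw : PT w) (hb : PT b) (hf : PT f) :
    PT fun x => startL (s x) (w x) (b x) (f x) := by
  unfold SecondOrder.startL; fun_prop

@[fun_prop]
theorem PT.stepRelL {ok : α → Bool} (hs : PT s) (hw : PT w) (hf : PT f) (hb : PT b) (hc : PT c)
    (hf' : PT f') (hok : PT ok) :
    PT fun x => StepL (s x) (w x) (f x) (b x) (c x) (f' x) (ok x) := by
  unfold SecondOrder.StepL; fun_prop

variable {tr : α → List Tr} {ib fb : α → List Bool} {y z : α → NSt}

@[fun_prop]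
theorem PT.nTrans (hs : PT s) (hw : PT w) (htr : PT tr) (hy : PT y) (hc : PT c) (hz : PT z) :
    PT fun x => NTrans (s x) (w x) (tr x) (y x) (c x) (z x) := by
  unfold NTrans; fun_prop

@[fun_prop]
theorem PT.pairLists (hK : PT K) (hw : PT w) (hW : PT W) :
    PT fun x => pairLists (K x) (w x) (W x) := by
  unfold SecondOrder.pairLists; fun_prop

@[fun_prop]
theorem PT.nStates (hK : PT K) (hn : PT n) (hw : PT w) (hW : PT W) :
    PT fun x => nStates (K x) (n x) (w x) (W x) := by
  unfold SecondOrder.nStates; fun_prop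

@[fun_prop]
theorem PT.nFinal (hfb : PT fb) (hy : PT y) : PT fun x => NFinal (fb x) (y x) := by
  unfold NFinal; fun_prop

@[fun_prop]
theorem PT.nInit (hK : PT K) (hn : PT n) (hw : PT w) (hW : PT W) (hib : PT ib) :
    PT fun x => nInit (K x) (n x) (w x) (W x) (ib x) := by
  unfold SecondOrder.nInit; fun_prop

variable {Qs X Y : α → List NSt} {Ls : α → List Code} {𝒴 R : α → List (List NSt)}

@[fun_prop]
theorem PT.eqv (h𝒴 : PT 𝒴) (hX : PT X) (hY : PT Y) : PT fun x => Eqv (𝒴 x) (X x) (Y x) := by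
  unfold Eqv; fun_prop

@[fun_prop]
theorem PT.del (hQs : PT Qs) (hs : PT s) (hw : PT w) (htr : PT tr) (hX : PT X) (hc : PT c) :
    PT fun x => del (Qs x) (NTrans (s x) (w x) (tr x)) (X x) (c x) := by
  unfold SecondOrder.del; fun_prop

@[fun_prop]
theorem PT.pre (hQs : PT Qs) (hs : PT s) (hw : PT w) (htr : PT tr) (hc : PT c) (hY : PT Y) :
    PT fun x => pre (Qs x) (NTrans (s x) (w x) (tr x)) (c x) (Y x) := by
  unfold SecondOrder.pre; fun_prop

@[fun_prop]
theorem PT.preStep (hQs : PT Qs) (hLs : PT Ls) (hs : PT s) (hw : PT w) (htr : PT tr) (hfb : PT fb)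
    (hK : PT K) (h𝒴 : PT 𝒴) : PT fun x =>
      preStep (Qs x) (Ls x) (NTrans (s x) (w x) (tr x)) (NFinal (fb x)) (K x) (𝒴 x) := by
  unfold SecondOrder.preStep; fun_prop

@[fun_prop]
theorem PT.repStep (hQs : PT Qs) (hLs : PT Ls) (hs : PT s) (hw : PT w) (htr : PT tr)
    (h𝒴 : PT 𝒴) (hR : PT R) : PT fun x =>
      repStep (Qs x) (Ls x) (NTrans (s x) (w x) (tr x)) (𝒴 x) (R x) := by
  unfold SecondOrder.repStep; fun_prop

/-- All iterates after the first are sublists of the enumerated subsets, so they stay small. -/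
theorem PT.pres (hQs : PT Qs) (hLs : PT Ls) (hs : PT s) (hw : PT w) (htr : PT tr) (hfb : PT fb)
    (hK : PT K) : PT fun x =>
      pres (Qs x) (Ls x) (NTrans (s x) (w x) (tr x)) (NFinal (fb x)) (K x) := by
  unfold SecondOrder.pres
  refine PT.iterate (g := fun x 𝒴 =>
    SecondOrder.preStep (Qs x) (Ls x) (NTrans (s x) (w x) (tr x)) (NFinal (fb x)) (K x) 𝒴) hK
    (PT.const []) (by fun_prop) (hK.subsK hQs).size_le fun x m _ => ?_
  cases m with
  | zero => exact size_pos _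
  | succ m =>
    rw [Function.iterate_succ_apply']
    exact size_le_of_sublist (lfilter_sublist _ _)

/-- Each round adds at most one set, which is a sublist of the list of states; growth is linear in
the number of rounds. -/
theorem PT.iterate_repStep (hQs : PT Qs) (hLs : PT Ls) (hs : PT s) (hw : PT w) (htr : PT tr)
    (h𝒴 : PT 𝒴) (hX : PT X) (hK : PT K) : PT fun x =>
      (SecondOrder.repStep (Qs x) (Ls x) (NTrans (s x) (w x) (tr x)) (𝒴 x))^[K x] [X x] := by
  refine PT.iterate (g := fun x R =>
    SecondOrder.repStep (Qs x) (Ls x) (NTrans (s x) (w x) (tr x)) (𝒴 x) R) hK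
    (hX.lcons (PT.const [])) (by fun_prop)
    (u := fun x => (size (K x) + 1) * (size (Qs x) + size (X x) + 1) + 1)
    (((hK.size_le.add (PB.const 1)).mul ((hQs.size_le.add hX.size_le).add (PB.const 1))).add
      (PB.const 1)) fun x m hm => ?_
  set g := SecondOrder.repStep (Qs x) (Ls x) (NTrans (s x) (w x) (tr x)) (𝒴 x)
  have h : (g^[m] [X x]).length ≤ m + 1 ∧
      ∀ Y ∈ g^[m] [X x], size Y ≤ size (Qs x) + size (X x) := by
    clear hm
    induction m with
    | zero => simp
    | succ m ih =>
      rw [Function.iterate_succ_apply']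
      constructor
      · change (SecondOrder.repStep _ _ _ _ (g^[m] [X x])).length ≤ _
        rw [SecondOrder.repStep, List.length_append, List.length_take]
        omega
      · intro Y hY
        rcases List.mem_append.1 hY with hY | hY
        · exact ih.2 Y hY
        · obtain ⟨X', -, hY⟩ := List.mem_flatMap.1 (mem_lfilter.1 (List.mem_of_mem_take hY)).1
          obtain ⟨c, -, rfl⟩ := List.mem_map.1 hY
          exact (size_le_of_sublist (lfilter_sublist _ _)).trans (Nat.le_add_right _ _)
  refine (size_le_of_forall h.2).trans ?_
  have h2 : m ≤ size (K x) := by rw [size_nat]; omega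
  have := h.1
  gcongr
  omega

theorem PT.outTuple (hs : PT s) (hW : PT W) (hQs : PT Qs) (hLs : PT Ls) (hw : PT w) (htr : PT tr)
    (hfb : PT fb) (h𝒴 : PT 𝒴) (hR : PT R) : PT fun x =>
      outTuple (s x) (W x) (Qs x) (Ls x) (w x) (tr x) (fb x) (𝒴 x) (R x) := by
  unfold SecondOrder.outTuple; fun_prop

theorem PT.mainOut (hK : PT K) (hW : PT W) (hs : PT s) (hw : PT w) (hn : PT n) (hib : PT ib)
    (hfb : PT fb) (htr : PT tr) : PT fun x =>
      mainOut (K x) (W x) (s x) (w x) (n x) (ib x) (fb x) (tr x) := by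
  have h𝒴 := PT.pres (hK.nStates hn hw hW) (hK.letters hs hW) hs hw htr hfb hK
  exact PT.outTuple hs hW (hK.nStates hn hw hW) (hK.letters hs hW) hw htr hfb h𝒴
    (PT.iterate_repStep (hK.nStates hn hw hW) (hK.letters hs hW) hs hw htr h𝒴
      (hK.nInit hn hw hW hib) hK)

end nfa

end SecondOrder

namespace SecondOrder

open Enc

/-! ### The program -/

section fuel

variable {β : Type} [Enc β] {v : β → ℕ}

theorem PT.ptw {γ : Type} [Enc γ] {f : β → γ} (hf : PT f) (hv : ∀ x, size x ≤ v x) : PTW v f := by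
  obtain ⟨c, T, hc, hT, hs⟩ := hf
  exact ⟨c, T, hc, (PB.self.mono hv).trans hT, (PB.self.mono hv).trans hs⟩

theorem iterate_double (m : ℕ) : (fun y : ℕ => y + y)^[m] 1 = 2 ^ m := by
  induction m with
  | zero => rfl
  | succ m ih => rw [Function.iterate_succ_apply', ih, pow_succ]; ring

/-- Repeated doubling in unary; affordable because the result is polynomial in `v`. -/
theorem PTW.two_pow {a : β → ℕ} (hv : ∀ x, size x ≤ v x) (ha : PTW v a)
    (hb : PB v fun x => 2 ^ a x) : PTW v fun x => 2 ^ a x := by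
  have := PTW.iterate hv (g := fun _ (y : ℕ) => y + y) ha ((PT.const 1).ptw hv) (by fun_prop)
    (u := fun x => 2 * 2 ^ a x + 1) (((PB.const 2).mul hb).add (PB.const 1)) (fun x m hm => by
      rw [iterate_double, size_nat]
      have := Nat.pow_le_pow_right (n := 2) (by omega) hm
      omega)
  simpa only [iterate_double] using this

end fuel

/-- The tuples that describe automata. -/
abbrev Desc := ℕ × ℕ × ℕ × List Bool × List Bool × List Tr × Unit

/-- The bound for the numbers of objects that are enumerated. -/
def fuel (s w n : ℕ) : ℕ := 2 ^ (max 1 n * 2 ^ (4 * s * w * 2 ^ w))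

/-- The function computed by the program. -/
noncomputable def fullOut (x : Desc) : Desc :=
  mainOut (fuel x.1 x.2.1 x.2.2.1) (2 ^ x.2.1) x.1 x.2.1 x.2.2.1 x.2.2.2.1 x.2.2.2.2.1
    x.2.2.2.2.2.1

/-- The quantity in which the running time is polynomial. -/
def weight (x : Desc) : ℕ := fuel x.1 x.2.1 x.2.2.1 + 2 ^ x.2.1 + size x

/-- The fuel is not polynomial in the input, so time is measured against `weight`. The tower of
exponents is computed from the inside out, and each intermediate value is polynomial in the weight.
-/
theorem ptw_fullOut : PTW weight fullOut := by
  have hv : ∀ x : Desc, size x ≤ weight x := fun x => Nat.le_add_left _ _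
  have hW : PTW weight fun x : Desc => 2 ^ x.2.1 :=
    PTW.two_pow hv (PT.ptw (by fun_prop) hv) (PB.self.mono fun x => by
      unfold weight; omega)
  have he : PTW weight fun x : Desc => 4 * x.1 * x.2.1 * 2 ^ x.2.1 :=
    PTW.comp (f := fun p : Desc × ℕ => 4 * p.1.1 * p.1.2.1 * p.2) (by fun_prop)
      (PTW.pair (PT.id'.ptw hv) hW)
  have hle : ∀ x : Desc, max 1 x.2.2.1 * 2 ^ (4 * x.1 * x.2.1 * 2 ^ x.2.1) ≤ weight x := fun x => by
    refine Nat.lt_two_pow_self.le.trans ?_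
    exact (Nat.le_add_right (fuel x.1 x.2.1 x.2.2.1) _).trans (Nat.le_add_right _ _)
  have hE : PTW weight fun x : Desc => 2 ^ (4 * x.1 * x.2.1 * 2 ^ x.2.1) :=
    PTW.two_pow hv he (PB.self.mono fun x =>
      (Nat.le_mul_of_pos_left _ (by omega)).trans (hle x))
  have hm : PT fun x : Desc => max 1 x.2.2.1 := by
    classical
    refine (PT.ite (p := fun x : Desc => x.2.2.1 = 0) (f := fun _ => 1) (g := fun x => x.2.2.1)
      (by fun_prop) (by fun_prop) (by fun_prop)).congr fun x => ?_
    split_ifs <;> omega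
  have hK : PTW weight fun x : Desc => fuel x.1 x.2.1 x.2.2.1 :=
    PTW.two_pow hv (PTW.comp (f := fun p : ℕ × ℕ => p.1 * p.2) (by fun_prop)
      (PTW.pair (hm.ptw hv) hE)) (PB.self.mono fun x =>
        (Nat.le_add_right (fuel x.1 x.2.1 x.2.2.1) _).trans (Nat.le_add_right _ _))
  exact PTW.comp (f := fun p : ℕ × ℕ × Desc => mainOut p.1 p.2.1 p.2.2.1 p.2.2.2.1 p.2.2.2.2.1
      p.2.2.2.2.2.1 p.2.2.2.2.2.2.1 p.2.2.2.2.2.2.2.1)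
    (PT.mainOut (by fun_prop) (by fun_prop) (by fun_prop) (by fun_prop) (by fun_prop)
      (by fun_prop) (by fun_prop) (by fun_prop)) (PTW.pair hK (PTW.pair hW (PT.id'.ptw hv)))

/-! ### Estimates -/

/-- The left side is the number of states of the nondeterministic automaton per state of the given
one. The constant `4` leaves room for this and for the length of the descriptions of layers. -/
theorem two_mul_succ_pow_le {s w : ℕ} (hs : 0 < s) (hw : 0 < w) :
    (2 ^ w + 1) ^ 2 ^ w * 2 ≤ 2 ^ (4 * s * w * 2 ^ w) := by
  have h1 : 2 ^ w + 1 ≤ 2 ^ (w + 1) := by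
    have := Nat.two_pow_pos w
    rw [pow_succ]; omega
  calc (2 ^ w + 1) ^ 2 ^ w * 2 ≤ (2 ^ (w + 1)) ^ 2 ^ w * 2 := by gcongr
    _ = 2 ^ ((w + 1) * 2 ^ w + 1) := by rw [← pow_mul, pow_succ]
    _ ≤ 2 ^ (4 * s * w * 2 ^ w) := by
        apply Nat.pow_le_pow_right (by omega)
        have h2 := Nat.two_pow_pos w
        have h3 : w * 2 ^ w ≤ s * (w * 2 ^ w) := Nat.le_mul_of_pos_left _ hs
        have h4 : 2 ^ w ≤ w * 2 ^ w := Nat.le_mul_of_pos_left _ hw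
        have h5 : 4 * s * w * 2 ^ w = 4 * (s * (w * 2 ^ w)) := by ring
        rw [h5, add_mul]
        omega

theorem codeLen_le {s w : ℕ} (hs : 0 < s) (hw : 0 < w) :
    codeLen s (2 ^ w) ≤ 2 ^ (4 * s * w * 2 ^ w) := by
  have hW : 2 ≤ 2 ^ w := by simpa using Nat.pow_le_pow_right (n := 2) (by omega) hw
  have h1 : codeLen s (2 ^ w) ≤ 8 * (s * (2 ^ w * 2 ^ w)) := by
    have h2 : 2 ^ w * 2 ^ w ≤ s * (2 ^ w * 2 ^ w) := Nat.le_mul_of_pos_left _ hs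
    have h3 : 2 * 2 ^ w ≤ 2 ^ w * 2 ^ w := Nat.mul_le_mul_right _ hW
    have h4 : 2 ^ w * (s * 2 ^ w) = s * (2 ^ w * 2 ^ w) := by ring
    unfold codeLen
    rw [h4]
    omega
  have h2 : s ≤ 2 ^ s := Nat.lt_two_pow_self.le
  calc codeLen s (2 ^ w) ≤ 8 * (s * (2 ^ w * 2 ^ w)) := h1
    _ ≤ 2 ^ 3 * (2 ^ s * (2 ^ w * 2 ^ w)) := by gcongr; norm_num
    _ = 2 ^ (3 + (s + (w + w))) := by simp only [pow_add]
    _ ≤ 2 ^ (4 * s * w * 2 ^ w) := by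
        apply Nat.pow_le_pow_right (by omega)
        have h3 : s * w * 2 ≤ s * w * 2 ^ w := Nat.mul_le_mul_left _ hW
        have h4 : s ≤ s * w := Nat.le_mul_of_pos_right _ hw
        have h5 : w ≤ s * w := Nat.le_mul_of_pos_left _ hs
        have h6 : 4 * s * w * 2 ^ w = 4 * (s * w * 2 ^ w) := by ring
        rw [h6]
        omega

theorem two_pow_le_fuel {s w n m : ℕ} (h : m ≤ max 1 n * 2 ^ (4 * s * w * 2 ^ w)) :
    2 ^ m ≤ fuel s w n := Nat.pow_le_pow_right (by omega) h

/-- The term `(K * K * K) * (8 * K + 20)` accounts for at most `K ^ 3` transitions of linear size;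
from `16 ≤ K` on, `K ^ 7` absorbs all constants. -/
theorem weight_le {K W z : ℕ} (hK : 16 ≤ K) (hW : W ≤ K)
    (hz : z ≤ 6 * K + 8 * K + 20 + (K * K * K) * (8 * K + 20)) :
    K + W + z + 2 ≤ K ^ 7 := by
  have h1 : 14 * K + 20 + 2 + 2 * K ≤ K * K * K := by nlinarith
  have h2 : 8 * K + 20 ≤ K * K := by nlinarith
  have h3 : (K * K * K) * (8 * K + 20) ≤ (K * K * K) * (K * K) := Nat.mul_le_mul_left _ h2
  have h4 : K + W + z + 2 ≤ K * K * K + K * K * K * (K * K) := by omega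
  refine h4.trans ?_
  have h5 : K * K * K * 1 ≤ K * K * K * (K * K) := Nat.mul_le_mul_left _ (by nlinarith)
  have h6 : K * K * K * (K * K) * 2 ≤ K * K * K * (K * K) * (K * K) :=
    Nat.mul_le_mul_left _ (by nlinarith)
  have h7 : K ^ 7 = K * K * K * (K * K) * (K * K) := by ring
  omega

section descriptions

variable {α : Type*} [LinearOrder α] [Fintype α]

theorem card_layerFinset_le (w : ℕ) :
    (layerFinset α w).card ≤ 2 ^ codeLen (Fintype.card α) w := by
  classical
  have := Finset.card_le_card_of_injOn (s := layerFinset α w)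
    (t := (Finset.univ : Finset (Fin (codeLen (Fintype.card α) w) → Bool)))
    (fun B i => (B.bits w)[i]'(by rw [length_bits]; exact i.2)) (by simp) ?_
  · simpa using this
  · intro B hB B' hB' h
    have hB : B ∈ layerAlphabet α w := mem_layerFinset.1 hB
    have hB' : B' ∈ layerAlphabet α w := mem_layerFinset.1 hB'
    have hbits : B.bits w = B'.bits w := by
      refine List.ext_getElem (by simp [length_bits]) fun i h1 h2 => ?_
      exact congrFun h ⟨i, by simpa [length_bits] using h1⟩
    exact Codes.unique (c := (w, B.bits w)) ⟨hB, rfl⟩ ⟨hB', hbits⟩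

variable {w : ℕ} {F : FA (Layer α)} {l : List (ℕ × Layer α × ℕ)}

/-- Without repetitions the listing is at most as long as the number of possible transitions. This
bounds the input size in terms of `n`, `w` and the alphabet, as the time bound requires. -/
theorem length_trans_le (hF : F.IsOver (layerAlphabet α w)) (hnd : l.Nodup)
    (hl : ∀ t, t ∈ l ↔ t ∈ F.trans) :
    l.length ≤ F.states.card * 2 ^ codeLen (Fintype.card α) w * F.states.card := by
  classical
  rw [← List.toFinset_card_of_nodup hnd]
  have : l.toFinset ⊆ F.states ×ˢ (layerFinset α w ×ˢ F.states) := by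
    rintro ⟨q, B, q'⟩ ht
    have ht := (hl _).1 (List.mem_toFinset.1 ht)
    obtain ⟨h1, h2⟩ := F.trans_mem _ _ _ ht
    simp only [Finset.mem_product]
    exact ⟨h1, mem_layerFinset.2 (hF _ _ _ ht), h2⟩
  refine (Finset.card_le_card this).trans ?_
  rw [Finset.card_product, Finset.card_product, ← mul_assoc]
  gcongr
  exact card_layerFinset_le w

theorem size_boolList_le (l : List Bool) : size l ≤ l.length * 4 + 1 :=
  size_le_of_forall fun b _ => size_bool b

/-- The tuple that describes `F`. -/
def FA.desc (w : ℕ) (F : FA (Layer α)) (l : List (ℕ × Layer α × ℕ)) : Desc :=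
  (Fintype.card α, w, F.states.card, F.table F.init, F.table F.final, F.table₃ w l, ())

theorem encodes_iff {d : Dat} : F.Encodes w d ↔ ∃ l : List (ℕ × Layer α × ℕ), l.Nodup ∧
    (∀ t, t ∈ l ↔ t ∈ F.trans) ∧ d = enc (F.desc w l) := by
  simp only [FA.Encodes, FA.desc, FA.table, FA.table₃, FA.pos, Enc.enc, Dat.list, Dat.boolList,
    List.map_map, Function.comp_def]

theorem size_desc_le {K : ℕ} (hF : F.IsOver (layerAlphabet α w)) (hnd : l.Nodup)
    (hl : ∀ t, t ∈ l ↔ t ∈ F.trans) (hs : Fintype.card α ≤ K) (hw : w ≤ K)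
    (hn : F.states.card ≤ K) (hm : 2 ^ codeLen (Fintype.card α) w ≤ K) :
    size (F.desc w l) ≤ 6 * K + 8 * K + 20 + (K * K * K) * (8 * K + 20) := by
  have h1 : ∀ S, size (F.table S) ≤ 4 * K + 1 := fun S => by
    refine (size_boolList_le _).trans ?_
    simp only [FA.table, List.length_map, Finset.length_sort]
    omega
  have h2 : size (F.table₃ w l) ≤ (K * K * K) * (8 * K + 20) + 1 := by
    refine (size_le_of_forall (m := 8 * K + 19) ?_).trans ?_
    · intro τ hτ
      obtain ⟨⟨q, B, q'⟩, ht, rfl⟩ := List.mem_map.1 hτ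
      obtain ⟨h3, h4⟩ := F.trans_mem _ _ _ ((hl _).1 ht)
      have h5 := F.pos_lt h3
      have h6 := F.pos_lt h4
      have h7 := size_boolList_le (B.bits w)
      rw [length_bits] at h7
      have h8 : codeLen (Fintype.card α) w < 2 ^ codeLen (Fintype.card α) w :=
        Nat.lt_two_pow_self
      simp only [size_pair, size_nat, size_unit]
      omega
    · have h3 := length_trans_le hF hnd hl
      have h4 : F.states.card * 2 ^ codeLen (Fintype.card α) w * F.states.card ≤ K * K * K := by
        gcongr
      simp only [FA.table₃, List.length_map]
      gcongr
      omega
  have h3 := h1 F.init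
  have h4 := h1 F.final
  simp only [FA.desc, size_pair, size_nat, size_unit]
  omega

end descriptions

/-- Raising to the power `7 * k` multiplies the first exponent by `7 * k ≤ 2 ^ (7 * k)`, which moves
into the second exponent as a summand. -/
theorem time_le {K n e k c : ℕ} (hK : K = 2 ^ (n * 2 ^ e)) (hc : e + 7 * k ≤ c) :
    (K ^ 7) ^ k ≤ 2 ^ (n * 2 ^ c) := by
  rw [hK, ← pow_mul, ← pow_mul]
  apply Nat.pow_le_pow_right (by omega)
  calc n * 2 ^ e * (7 * k) ≤ n * 2 ^ e * 2 ^ (7 * k) := by gcongr; exact Nat.lt_two_pow_self.le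
    _ = n * 2 ^ (e + 7 * k) := by rw [pow_add]; ring
    _ ≤ n * 2 ^ c := by gcongr; omega

/-- A program that computes second canonical forms within the time bound. -/
theorem exists_program : ∃ (prog : Cmd) (c : ℕ), ∀ (α : Type*) [LinearOrder α] [Fintype α]
    [Nonempty α] (w : ℕ), 0 < w → ∀ F : FA (Layer α), F.IsSOFA w → ∀ x : Dat, F.Encodes w x →
      ∃ (y : Dat) (t : ℕ), Computes prog x y t ∧ (secondCanon w F).Encodes (2 ^ w) y ∧
        t ≤ 2 ^ (max 1 F.states.card * 2 ^ (c * (Fintype.card α * w * 2 ^ w))) := by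
  obtain ⟨cmd, T, hrun, ⟨k, hT⟩, -⟩ := ptw_fullOut
  -- `4` is the constant in `fuel`, `7` the degree of the weight in the fuel, and `k` the degree of
  -- the running time in the weight.
  refine ⟨cmd 0, 4 + 7 * k, fun α _ _ _ w hw F hF x hx => ?_⟩
  obtain ⟨l, hnd, hl, rfl⟩ := encodes_iff.1 hx
  obtain ⟨σ, t, he, h0, -, ht⟩ := hrun 0 (Function.update (fun _ => Dat.nil) 0 (enc (F.desc w l)))
    (F.desc w l) (by simp)
  have hs : 0 < Fintype.card α := Fintype.card_pos
  set s := Fintype.card α with hsdef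
  set n := F.states.card with hn
  set K := fuel s w n with hK
  have hE := Nat.two_pow_pos (4 * s * w * 2 ^ w)
  have hM : ∀ {m}, m ≤ 2 ^ (4 * s * w * 2 ^ w) → 2 ^ m ≤ K := fun {m} hm =>
    two_pow_le_fuel (hm.trans (Nat.le_mul_of_pos_left _ (by omega)))
  have hle : ∀ {m}, m ≤ 2 ^ (4 * s * w * 2 ^ w) → m ≤ K := fun {m} hm =>
    Nat.lt_two_pow_self.le.trans (hM hm)
  have hpow := two_mul_succ_pow_le hs hw
  have hcode := codeLen_le hs hw
  have hcl : codeLen s (2 ^ w) = 2 ^ w + 2 ^ w + 2 ^ w * (s * 2 ^ w) + 2 ^ w + 2 ^ w + 2 := rfl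
  have hww : w < 2 ^ w := Nat.lt_two_pow_self
  have hsW : s ≤ 2 ^ w * (s * 2 ^ w) := by
    have := Nat.two_pow_pos w
    calc s = 1 * (s * 1) := by ring
      _ ≤ _ := by gcongr <;> omega
  have hnK : n ≤ K := Nat.lt_two_pow_self.le.trans (two_pow_le_fuel
    ((le_max_right 1 n).trans (Nat.le_mul_of_pos_right _ hE)))
  have hcw : 2 ^ codeLen s w ≤ K :=
    hM (((codeLen_strictMono s).monotone hww.le).trans hcode)
  refine ⟨enc (fullOut (F.desc w l)), t, ⟨σ, he, h0⟩, ?_, ht.trans ((hT _).trans ?_)⟩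
  · exact mainOut_encodes hF hl rfl (hle (m := (2 ^ w + 1) ^ 2 ^ w) (by omega)) (two_pow_le_fuel (by
      calc n * ((2 ^ w + 1) ^ 2 ^ w * 2) ≤ max 1 n * 2 ^ (4 * s * w * 2 ^ w) :=
            Nat.mul_le_mul (le_max_right _ _) hpow)) (hM hcode)
  · have h16 : 16 ≤ K := by
      have : 2 ^ 4 ≤ K := hM (by omega)
      simpa using this
    have hsize := size_desc_le hF.1 hnd hl (hle (by omega)) (hle (by omega)) hnK hcw
    have hwt : weight (F.desc w l) + 2 ≤ K ^ 7 :=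
      weight_le h16 (hle (m := 2 ^ w) (by omega)) hsize
    refine (Nat.pow_le_pow_left hwt k).trans (time_le (e := 4 * s * w * 2 ^ w) rfl ?_)
    have h1 : 0 < s * w * 2 ^ w := by positivity
    have h2 : 7 * k * 1 ≤ 7 * k * (s * w * 2 ^ w) := Nat.mul_le_mul_left _ h1
    calc 4 * s * w * 2 ^ w + 7 * k ≤ 4 * (s * w * 2 ^ w) + 7 * k * (s * w * 2 ^ w) := by
          have : 4 * s * w * 2 ^ w = 4 * (s * w * 2 ^ w) := by ring
          omega
      _ = (4 + 7 * k) * (s * w * 2 ^ w) := by ring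

end SecondOrder

namespace SecondOrder

/-! ### Properties of second canonical forms -/

section properties

variable {α : Type*} [LinearOrder α] [Fintype α] [Nonempty α] {w w' : ℕ} {F F' : FA (Layer α)}

theorem exists_secondCanon_eq (hF : F.IsSOFA w) : ∃ R, IsRepList Layer.Lt (canonLang w F) R ∧
    secondCanon w F = repFA (canonLang w F) R (layerFinset α (2 ^ w)) := by
  obtain ⟨R, hR⟩ := exists_isRepList hF
  exact ⟨R, hR, minFA_eq layer_lt_wf hR _⟩

theorem secondCanon_lang (hF : F.IsSOFA w) : (secondCanon w F).lang = canonLang w F := by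
  obtain ⟨R, hR, h⟩ := exists_secondCanon_eq hF
  rw [h, repFA_lang layer_lt_wf hR]
  ext C
  exact ⟨fun hC => hC.1, fun hC => ⟨hC, fun B hB => mem_layerFinset.2 (canonLang_over hC B hB)⟩⟩

theorem secondCanon_isSOFA (hF : F.IsSOFA w) : (secondCanon w F).IsSOFA (2 ^ w) := by
  refine ⟨?_, fun C hC => ?_⟩
  · obtain ⟨R, hR, h⟩ := exists_secondCanon_eq hF
    rw [h]
    intro q B q' ht
    exact mem_layerFinset.1 (mem_repFA_trans.1 ht).2.1
  · rw [secondCanon_lang hF] at hC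
    obtain ⟨D, -, hc⟩ := hC
    exact hc.1.1

theorem secondCanon_isDeterministic (hF : F.IsSOFA w) : (secondCanon w F).IsDeterministic := by
  obtain ⟨R, hR, h⟩ := exists_secondCanon_eq hF
  rw [h]
  exact repFA_isDeterministic layer_lt_wf hR

theorem secondCanon_isComplete (hF : F.IsSOFA w) :
    (secondCanon w F).IsComplete (layerAlphabet α (2 ^ w)) := by
  obtain ⟨R, hR, h⟩ := exists_secondCanon_eq hF
  rw [h, ← coe_layerFinset]
  exact repFA_isComplete layer_lt_wf hR

theorem secondCanon_isNormalized (hF : F.IsSOFA w) :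
    (secondCanon w F).IsNormalized Layer.Lt := by
  obtain ⟨R, hR, h⟩ := exists_secondCanon_eq hF
  rw [h]
  exact repFA_isNormalized layer_lt_wf hR fun u hu B hB => mem_layerFinset.2 (minRep_over hu B hB)

theorem secondCanon_secondLang (hF : F.IsSOFA w) :
    (secondCanon w F).secondLang = F.secondLang := by
  rw [FA.secondLang, secondCanon_lang hF]
  ext x
  constructor
  · rintro ⟨C, ⟨D, hD, hc⟩, rfl⟩
    exact ⟨D, hD, hc.2.2.2.symm⟩
  · rintro ⟨D, hD, rfl⟩
    obtain ⟨C, hC, -⟩ := existsUnique_isCanonicalForm (hF.2 D hD)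
    exact ⟨C, ⟨D, hD, hC⟩, hC.2.2.2⟩

/-- A canonical form is determined by the language of its diagram, even across different widths, so
a diagram of `F'` with the same language has the same canonical form. -/
theorem canonLang_subset (hF : F.IsSOFA w) (hF' : F'.IsSOFA w')
    (h : F.secondLang = F'.secondLang) : canonLang w F ⊆ canonLang w' F' := by
  rintro C ⟨D, hD, hc⟩
  obtain ⟨D', hD', he⟩ : oddLang D ∈ F'.secondLang := h ▸ ⟨D, hD, rfl⟩
  obtain ⟨C', hC'⟩ := exists_canon (hF'.2 D' hD')
  rw [(hc.canon (hF.2 D hD)).unique hC' he.symm]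
  exact ⟨D', hD', hC'.isCanonicalForm⟩

theorem canonLang_eq (hF : F.IsSOFA w) (hF' : F'.IsSOFA w') (h : F.secondLang = F'.secondLang) :
    canonLang w F = canonLang w' F' :=
  (canonLang_subset hF hF' h).antisymm (canonLang_subset hF' hF h.symm)

/-- Both automata are Nerode automata of the same set of words; only their alphabets differ. -/
theorem secondCanon_restrict (hF : F.IsSOFA w) (hF' : F'.IsSOFA w')
    (h : F.secondLang = F'.secondLang) :
    (secondCanon w F).restrict (layerAlphabet α (2 ^ w')) =
      (secondCanon w' F').restrict (layerAlphabet α (2 ^ w)) := by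
  rw [secondCanon, secondCanon, canonLang_eq hF hF' h, ← coe_layerFinset, ← coe_layerFinset]
  exact minFA_restrict _ _

end properties

end SecondOrder

open SecondOrder in
theorem theorem3p3 :
    ∃ (prog : Cmd) (c : ℕ), ∀ (α : Type*) [LinearOrder α] [Fintype α] [Nonempty α],
      ∃ C₂ : ℕ → FA (Layer α) → FA (Layer α),
        ∀ (w : ℕ), 0 < w → ∀ F : FA (Layer α), F.IsSOFA w →
          -- the second canonical form is constructed within the time bound
          (∀ x : Dat, F.Encodes w x → ∃ (y : Dat) (t : ℕ),
            Computes prog x y t ∧ (C₂ w F).Encodes (2 ^ w) y ∧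
            t ≤ 2 ^ (max 1 F.states.card * 2 ^ (c * (Fintype.card α * w * 2 ^ w)))) ∧
          -- it is a deterministic, complete, normalized SOFA of width `2 ^ w`
          (C₂ w F).IsSOFA (2 ^ w) ∧
          (C₂ w F).IsDeterministic ∧
          (C₂ w F).IsComplete (layerAlphabet α (2 ^ w)) ∧
          (C₂ w F).IsNormalized Layer.Lt ∧
          -- its first language is the set of canonical forms of the ODDs accepted by `F`
          (∀ D ∈ F.lang, ∃! C, IsCanonicalForm w D C) ∧
          (C₂ w F).lang = {C | ∃ D ∈ F.lang, IsCanonicalForm w D C} ∧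
          -- it has the second language of `F`
          (C₂ w F).secondLang = F.secondLang ∧
          -- it depends on the second language only: equality for equal widths, and for
          -- different widths equality over the common alphabet of layers
          (∀ F' : FA (Layer α), F'.IsSOFA w → F'.secondLang = F.secondLang →
            C₂ w F' = C₂ w F) ∧
          (∀ w' : ℕ, 0 < w' → ∀ F' : FA (Layer α), F'.IsSOFA w' →
            F'.secondLang = F.secondLang →
            (C₂ w' F').restrict (layerAlphabet α (2 ^ w)) =
              (C₂ w F).restrict (layerAlphabet α (2 ^ w'))) := by
  obtain ⟨prog, c, hprog⟩ := exists_program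
  refine ⟨prog, c, fun α _ _ _ => ⟨secondCanon, fun w hw F hF => ?_⟩⟩
  refine ⟨hprog α w hw F hF, secondCanon_isSOFA hF, secondCanon_isDeterministic hF,
    secondCanon_isComplete hF, secondCanon_isNormalized hF,
    fun D hD => existsUnique_isCanonicalForm (hF.2 D hD), secondCanon_lang hF,
    secondCanon_secondLang hF, fun F' hF' h => ?_, fun w' _ F' hF' h => ?_⟩
  · rw [secondCanon, secondCanon, canonLang_eq hF' hF h]
  · exact secondCanon_restrict hF' hF h
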